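/- **Notation.** A function $u:\mathbb C\to[-\infty,\infty)$ is subharmonic if it is upper semicontinuous, $u\not\equiv-\infty$, and $u(z)\le\frac1{2\pi}\int_0^{2\pi}u(z+re^{i\theta})\,d\theta$ for all $z\in\mathbb C$, $r>0$. A function $u$ is $\delta$-subharmonic on $\mathbb C$ if $u=u_1-u_2$ with $u_1,u_2$ subharmonic on $\mathbb C$ (wherever the difference is defined). Its distributional Laplacian is then a difference of two mutually singular, locally finite positive Borel measures, $\Delta u=(\Delta u)^+-(\Delta u)^-$. Put $n_s(t,u)=\frac1{2\pi}(\Delta u)^-(\{|z|<t\})$ for $t>0$, $n_s(0,u)=\frac1{2\pi}(\Delta u)^-(\{0\})$, and $$N_s(r,u)=\int_0^r\frac{n_s(t,u)-n_s(0,u)}{t}\,dt+n_s(0,u)\log r,\qquad m_s(r,u)=\frac1{2\pi}\int_0^{2\pi}u^+(re^{i\theta})\,d\theta,\qquad T_s(r,u)=m_s(r,u)+N_s(r,u).$$ For subharmonic $u$ put $\mathcal T_s(r,u)=\frac1{2\pi}\int_0^{2\pi}u(re^{i\theta})\,d\theta$. For a meromorphic function $f$ on $\mathbb C$ let $T(r,f)$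 be its Nevanlinna characteristic. For a holomorphic curve $f=[f_0:\dots:f_n]:\mathbb C\to\mathbb P^n(\mathbb C)$, where $f_0,\dots,f_n$ are entire functions without common zeros, at least one of them non-constant, put $\mathcal T(r,f)=\mathcal T_s(r,v_f)-v_f(0)$ with $v_f=\max_j\log|f_j|$. For $c\in\mathbb C$ write $u_c(z)=u(z+c)$, and $f_c=[f_0(\cdot+c):\dots:f_n(\cdot+c)]$ for a curve. For measurable $E\subseteq[1,\infty)$ the upper and lower densities $\overline{\rm dens}\,E$, $\underline{\rm dens}\,E$ are the $\limsup$ and $\liminf$, as $r\to\infty$, of $\frac1r|E\cap[1,r]|$, and the logarithmic measure of $E$ is $\int_E\frac{dt}{t}$. **Theorem 2.1.** Let $c\in\mathbb C$ and let $u$ be a $\delta$-subharmonic function on $\mathbb C$ such that $N_s(r,u)$ and $N_s(r,u_c)$ are finite (that is, the defining integrals converge at $0$). Then there is a measurable set $E\subseteq[1,\infty)$ with $$N_s(r,u_c)\sim N_s(r,u)\qquad\text{as } r\to\infty,\ r\notin E,$$ such that 1. if $\displaystyle\liminf_{r\to\infty}\frac{\log N_s(r,u)}{r}=0$, then $\underline{\rm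 dens}\,E=0$; 2. if $\displaystyle\limsup_{r\to\infty}\frac{\log N_s(r,u)}{r}=0$, then $\overline{\rm dens}\,E=0$; 3. if $\displaystyle\limsup_{r\to\infty}\frac{(\log r)^{1+\varepsilon}\log N_s(r,u)}{r}=0$ for some $\varepsilon>0$, then $E$ has finite logarithmic measure. (Here $S\sim T$ means $S-T=o(T)$; in particular $S=T$ where $T$ vanishes identically.) The same statement holds with $N_s$ replaced throughout * by $T_s$, for $u$ as above; * by $\mathcal T_s$, for every subharmonic $u$ with $\mathcal T_s(r,u)\to\infty$ as $r\to\infty$ (equivalently, $u$ not harmonic); * by $T(r,f)$ and $T(r,f_c)$, for every meromorphic function $f$ on $\mathbb C$; * by $\mathcal T(r,f)$ and $\mathcal T(r,f_c)$, for every holomorphic curve $f:\mathbb C\to\mathbb P^n(\mathbb C)$. -/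

import Mathlib

open Filter MeasureTheory Set Topology
open scoped ENNReal ContDiff Laplacian

noncomputable section

namespace ShiftInvariance

/-! ### Subharmonic and `δ`-subharmonic functions on the plane -/

/-- Mean value over the circle `|w - z| = r` of an extended real function, as an extended real:
the mean of the positive part minus the mean of the negative part. For a function that is bounded
above on the circle the first term is finite, so the difference is meaningful
(it may be `-∞`). -/
def circleMean (u : ℂ → EReal) (z : ℂ) (r : ℝ) : EReal :=
  ((⨍⁻ θ in Ioc 0 (2 * Real.pi), (u (circleMap z r θ)).toENNReal ∂volume : ℝ≥0∞) : EReal)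
    - ((⨍⁻ θ in Ioc 0 (2 * Real.pi), (-u (circleMap z r θ)).toENNReal ∂volume : ℝ≥0∞) : EReal)

/-- `u : ℂ → [-∞, ∞)` is subharmonic on `ℂ`: upper semicontinuous, not identically `-∞`,
and at most its mean over every circle around each point. -/
structure IsSubharmonic (u : ℂ → EReal) : Prop where
  ne_top : ∀ z, u z ≠ ⊤
  exists_ne_bot : ∃ z, u z ≠ ⊥
  upperSemicontinuous : UpperSemicontinuous u
  le_circleMean : ∀ z, ∀ r : ℝ, 0 < r → u z ≤ circleMean u z r

/-- `u` is `δ`-subharmonic on `ℂ`: it is the difference of two subharmonic functions, wherever that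
difference is defined (i.e. off the polar set on which both functions are `-∞`). -/
def IsDeltaSubharmonic (u : ℂ → EReal) : Prop :=
  ∃ u₁ u₂ : ℂ → EReal, IsSubharmonic u₁ ∧ IsSubharmonic u₂ ∧
    ∀ z, ¬ (u₁ z = ⊥ ∧ u₂ z = ⊥) → u z = u₁ z - u₂ z

/-- The shifted function `u_c (z) = u (z + c)`. -/
def shift {α : Type*} (c : ℂ) (u : ℂ → α) : ℂ → α := fun z => u (z + c)

/-! ### The Laplacian of a `δ`-subharmonic function and its negative variation -/

/-- `(μ, ν)` is the Jordan decomposition of the distributional Laplacian of `u`: two mutually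
singular, locally finite Borel measures with `Δu = μ - ν` in the sense of distributions. -/
structure IsLaplacianJordan (u : ℂ → EReal) (μ ν : Measure ℂ) : Prop where
  locallyFinite_pos : IsLocallyFiniteMeasure μ
  locallyFinite_neg : IsLocallyFiniteMeasure ν
  mutuallySingular : μ ⟂ₘ ν
  integral_laplacian : ∀ φ : ℂ → ℝ, ContDiff ℝ ∞ φ → HasCompactSupport φ →
    ∫ z, (u z).toReal * (Δ φ) z = (∫ z, φ z ∂μ) - ∫ z, φ z ∂ν

open Classical in
/-- The negative variation `(Δu)⁻` of the Laplacian of `u`. The Jordan decomposition exists for every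
`δ`-subharmonic function (Riesz) and is unique; the value `0` is only used when there is none. -/
def laplacianNeg (u : ℂ → EReal) : Measure ℂ :=
  if h : ∃ ν, ∃ μ, IsLaplacianJordan u μ ν then h.choose else 0

/-! ### Counting function, proximity function and characteristics -/

/-- `n_s(t, u) = (1 / 2π) (Δu)⁻(B(0, t))` for `t > 0`. -/
def nS (t : ℝ) (u : ℂ → EReal) : ℝ :=
  (2 * Real.pi)⁻¹ * (laplacianNeg u).real (Metric.ball 0 t)

/-- `n_s(0, u) = (1 / 2π) (Δu)⁻({0})`, the limit of `n_s(t, u)` as `t → 0+`. -/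
def nSZero (u : ℂ → EReal) : ℝ :=
  (2 * Real.pi)⁻¹ * (laplacianNeg u).real {0}

/-- The integral in the definition of `N_s(r, u)` converges at `0`, i.e. `N_s(r, u)` is finite. -/
def NSFinite (u : ℂ → EReal) : Prop :=
  IntervalIntegrable (fun t => (nS t u - nSZero u) / t) volume 0 1

/-- `N_s(r, u) = ∫₀^r (n_s(t, u) - n_s(0, u)) / t dt + n_s(0, u) log r`. -/
def NS (r : ℝ) (u : ℂ → EReal) : ℝ :=
  (∫ t in (0 : ℝ)..r, (nS t u - nSZero u) / t) + nSZero u * Real.log r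

/-- `m_s(r, u)`, the mean of `u⁺ = max (u, 0)` over the circle `|z| = r`. -/
def mS (r : ℝ) (u : ℂ → EReal) : ℝ :=
  Real.circleAverage (fun z => (max (u z) 0).toReal) 0 r

/-- The Nevanlinna characteristic `T_s(r, u) = m_s(r, u) + N_s(r, u)`. -/
def TS (r : ℝ) (u : ℂ → EReal) : ℝ := mS r u + NS r u

/-- The Cartan characteristic of a subharmonic function: its mean over the circle `|z| = r`. -/
def cartanS (r : ℝ) (u : ℂ → EReal) : ℝ :=
  Real.circleAverage (fun z => (u z).toReal) 0 r

/-- `f = (f₀, …, f_n)` is a reduced representation of a holomorphic curve `ℂ → ℙⁿ(ℂ)`: the `f_j` are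
entire, without common zeros, and at least one of them is non-constant. -/
structure IsReducedRepresentation {n : ℕ} (f : Fin (n + 1) → ℂ → ℂ) : Prop where
  entire : ∀ j, Differentiable ℂ (f j)
  no_common_zero : ∀ z, ∃ j, f j z ≠ 0
  exists_nonconstant : ∃ j, ∃ z w, f j z ≠ f j w

/-- `v_f = max_j log |f_j|`, with `log 0 = -∞`. -/
def curvePotential {n : ℕ} (f : Fin (n + 1) → ℂ → ℂ) (z : ℂ) : EReal :=
  ⨆ j, ENNReal.log ‖f j z‖ₑ

/-- The Cartan characteristic of a holomorphic curve. -/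
def cartanCurve {n : ℕ} (r : ℝ) (f : Fin (n + 1) → ℂ → ℂ) : ℝ :=
  cartanS r (curvePotential f) - (curvePotential f 0).toReal

/-! ### Exceptional sets -/

/-- Upper density of a subset of `[1, ∞)`. -/
def upperDensity (E : Set ℝ) : ℝ≥0∞ :=
  limsup (fun r : ℝ => volume (E ∩ Icc 1 r) / ENNReal.ofReal r) atTop

/-- Lower density of a subset of `[1, ∞)`. -/
def lowerDensity (E : Set ℝ) : ℝ≥0∞ :=
  liminf (fun r : ℝ => volume (E ∩ Icc 1 r) / ENNReal.ofReal r) atTop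

/-- Logarithmic measure `∫_E dt / t` of a subset of `[1, ∞)`. -/
def logMeasure (E : Set ℝ) : ℝ≥0∞ := ∫⁻ t in E, ENNReal.ofReal (1 / t)

/-- `S(r) ∼ T(r)` as `r → ∞` outside a set `E ⊆ [1, ∞)`, whose size is controlled by the growth
of `T` in the three ways (1), (2), (3). The upper and lower limits are taken in `[-∞, ∞]`. -/
def EquivOutsideSmallSet (S T : ℝ → ℝ) : Prop :=
  ∃ E : Set ℝ, E ⊆ Ici 1 ∧ MeasurableSet E ∧
    Asymptotics.IsEquivalent (atTop ⊓ 𝓟 Eᶜ) S T ∧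
    (liminf (fun r => ((Real.log (T r) / r : ℝ) : EReal)) atTop = 0 → lowerDensity E = 0) ∧
    (limsup (fun r => ((Real.log (T r) / r : ℝ) : EReal)) atTop = 0 → upperDensity E = 0) ∧
    (∀ ε : ℝ, 0 < ε →
      limsup (fun r => ((Real.log r ^ (1 + ε) * Real.log (T r) / r : ℝ) : EReal)) atTop = 0 →
      logMeasure E < ⊤)

end ShiftInvariance

end

open ShiftInvariance

namespace ShiftInvariance

open Real (circleAverage)
open scoped CompactlySupported

/-! ### Exceptional sets of monotone functions -/

/-! The growth of every characteristic in the theorem is governed by a positive measure, and a shift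
only moves the centre from which that measure is seen. With `annularKernel r₀ r z` = log max(r, |z|)
- log max(r₀, |z|), the characteristic F satisfies F(r) - F(r₀) = ∫ `annularKernel r₀ r z` dμ(z),
and the characteristic G of the shifted function has the same increments with z - c in place of z.
Moving the centre by s = |c| costs a factor 1 + s/r₀ and an enlargement of both radii by s
(`annularKernel_le_of_norm_sub_le`). Hence G(r) - G(r₀) ≤ (1 + s/r₀)(F(r + s) - F(r₀ + s)), and the
same with F and G exchanged. If F tends to infinity, a large r₀ gives (1 - ε) F(r - s') ≤ G(r) ≤ (1
+ ε) F(r + s') for large r, with s' = s + 1.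

What remains is a fact about the increasing function L = log F: the integral of L(r + s') - L(r -
s') over [a, b] telescopes to at most 2s' L(b + s'). By Markov's inequality the increment is small
outside a set whose size is controlled by the growth of L. Three choices of thresholds give the
three kinds of exceptional set, and `equivOutsideSmallSet_of_le` combines them.

The measures are as follows. For N_s it is (Δu)⁻/2π. For the Cartan characteristics it is the Riesz
measure over 2π, by Jensen's formula. For T_s, write u = u₁ - u₂ with Riesz measures μ + σ and ν +
σ, where μ and ν are mutually singular. Since u⁺ = max(u₁, u₂) - u₂, the measure is that of max(u₁,
u₂) minus σ; it is positive because the Riesz measure of the maximum dominates the common part σ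
(`integral_le_integral_sup`). For meromorphic f, Cartan's formula writes T(r, f) as the mean over
|a| = 1 of the counting functions of f - a plus a constant, and the inequalities are averaged over
a.

The Riesz measure is built as the weak limit of 4ρ⁻²(A_ρ v - v), A_ρ being the mean over circles of
radius ρ. Jensen's formula then comes from the self-adjointness of A_ρ and the commutation of
iterated circle means of log |·|.

If F does not tend to infinity it is constant, by convexity in log r. Then F and G must be equal: in
the measure cases μ = 0, and when this alone does not suffice, a nonnegative function with constant
circle means about each of two centres has equal means there (`circleAverage_const_le`). -/

/-- The two translated integrals cancel except over an interval of length 2s at each end; the one at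
a enters negatively and is dropped. -/
theorem integral_add_sub_sub_le {L : ℝ → ℝ} (hL : Monotone L) (h0 : ∀ x, 0 ≤ L x) {s a b : ℝ}
    (hs : 0 < s) : ∫ r in a..b, (L (r + s) - L (r - s)) ≤ 2 * s * L (b + s) := by
  have hi : ∀ x y : ℝ, IntervalIntegrable L volume x y := fun x y => hL.intervalIntegrable
  have hi1 : IntervalIntegrable (fun r => L (r + s)) volume a b :=
    Monotone.intervalIntegrable fun x y h => hL (by linarith)
  have hi2 : IntervalIntegrable (fun r => L (r - s)) volume a b :=
    Monotone.intervalIntegrable fun x y h => hL (by linarith)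
  rw [intervalIntegral.integral_sub hi1 hi2, intervalIntegral.integral_comp_add_right,
    intervalIntegral.integral_comp_sub_right]
  have e1 : (∫ x in (a + s)..(b + s), L x) - ∫ x in (a - s)..(b - s), L x
      = (∫ x in (b - s)..(b + s), L x) - ∫ x in (a - s)..(a + s), L x := by
    have h1 := intervalIntegral.integral_add_adjacent_intervals (hi (a - s) (b - s))
      (hi (b - s) (b + s))
    have h2 := intervalIntegral.integral_add_adjacent_intervals (hi (a - s) (a + s))
      (hi (a + s) (b + s))
    linarith
  rw [e1]
  have h3 : 0 ≤ ∫ x in (a - s)..(a + s), L x :=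
    intervalIntegral.integral_nonneg (by linarith) fun x _ => h0 x
  have h4 : ∫ x in (b - s)..(b + s), L x ≤ ∫ _ in (b - s)..(b + s), L (b + s) :=
    intervalIntegral.integral_mono_on (by linarith) (hi _ _) (by simp)
      fun x hx => hL hx.2
  rw [intervalIntegral.integral_const, smul_eq_mul] at h4
  linarith [show (b + s - (b - s)) * L (b + s) = 2 * s * L (b + s) by ring]

/-- Markov's inequality applied to the telescoping bound. -/
theorem volume_lt_add_sub_sub_le {L : ℝ → ℝ} (hL : Monotone L) (h0 : ∀ x, 0 ≤ L x) {s a b δ : ℝ}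
    (hs : 0 < s) (hδ : 0 < δ) :
    volume ({r | δ < L (r + s) - L (r - s)} ∩ Icc a b)
      ≤ ENNReal.ofReal (2 * s * L (b + s) / δ) := by
  rcases lt_or_ge b a with hab | hab
  · simp [Icc_eq_empty (not_le.2 hab)]
  have hg0 : ∀ r, 0 ≤ L (r + s) - L (r - s) := fun r => sub_nonneg.2 (hL (by linarith))
  have hm : Measurable fun r => L (r + s) - L (r - s) :=
    (hL.measurable.comp (measurable_id.add_const s)).sub
      (hL.measurable.comp (measurable_id.sub_const s))
  have hi : IntervalIntegrable (fun r => L (r + s) - L (r - s)) volume a b :=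
    (Monotone.intervalIntegrable fun x y h => hL (by linarith)).sub
      (Monotone.intervalIntegrable fun x y h => hL (by linarith))
  have h1 := mul_meas_ge_le_lintegral (μ := volume.restrict (Icc a b))
    (f := fun r => ENNReal.ofReal (L (r + s) - L (r - s))) hm.ennreal_ofReal (ENNReal.ofReal δ)
  rw [← ofReal_integral_eq_lintegral_ofReal
    ((intervalIntegrable_iff_integrableOn_Icc_of_le hab).1 hi) (ae_of_all _ hg0),
    integral_Icc_eq_integral_Ioc, ← intervalIntegral.integral_of_le hab] at h1
  have h2 : volume ({r | δ < L (r + s) - L (r - s)} ∩ Icc a b)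
      ≤ (volume.restrict (Icc a b))
        {r | ENNReal.ofReal δ ≤ ENNReal.ofReal (L (r + s) - L (r - s))} := by
    rw [Measure.restrict_apply' measurableSet_Icc]
    exact measure_mono (inter_subset_inter_left _ fun r hr => ENNReal.ofReal_le_ofReal hr.le)
  rw [ENNReal.ofReal_div_of_pos hδ, ENNReal.le_div_iff_mul_le (by simp [hδ]) (by simp), mul_comm]
  exact (mul_le_mul_right h2 _).trans
    (h1.trans (ENNReal.ofReal_le_ofReal (integral_add_sub_sub_le hL h0 hs)))

theorem measurable_add_sub_sub {L : ℝ → ℝ} (hL : Monotone L) (s : ℝ) :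
    Measurable fun r => L (r + s) - L (r - s) :=
  (hL.measurable.comp (measurable_id.add_const s)).sub
    (hL.measurable.comp (measurable_id.sub_const s))

/-- A monotone function growing slowly along a sequence `x` has small increments outside a set which
is sparse along `x`. -/
theorem exists_sparse_along {L : ℝ → ℝ} (hL : Monotone L) (h0 : ∀ x, 0 ≤ L x) {s : ℝ} (hs : 0 < s)
    {x : ℕ → ℝ} (hx : Tendsto x atTop atTop)
    (hq : Tendsto (fun j => L (x j + s) / x j) atTop (𝓝 0)) :
    ∃ E ⊆ Ici (1 : ℝ), MeasurableSet E ∧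
      Tendsto (fun r => L (r + s) - L (r - s)) (atTop ⊓ 𝓟 Eᶜ) (𝓝 0) ∧
      Tendsto (fun j => volume (E ∩ Icc 1 (x j)) / ENNReal.ofReal (x j)) atTop (𝓝 0) := by
  -- With threshold √q, Markov's bound along x is at most (q/√q) x = √q x, so threshold and relative
  -- measure tend to zero together. The summand 1/(j + 1) only keeps the threshold positive.
  set q : ℕ → ℝ := fun j => 2 * s * |L (x j + s) / x j| + 1 / ((j : ℝ) + 1) with hqdef
  have hqpos : ∀ j, 0 < q j := fun j => by positivity
  have hq0 : Tendsto (fun j => Real.sqrt (q j)) atTop (𝓝 0) := by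
    have : Tendsto q atTop (𝓝 (2 * s * |0| + 0)) :=
      (hq.abs.const_mul _).add tendsto_one_div_add_atTop_nhds_zero_nat
    simpa [Function.comp_def] using (Real.continuous_sqrt.tendsto _).comp this
  -- A point is exceptional only if it violates the threshold of every j with r ≤ x j. Hence E ∩ [1,
  -- x j] obeys the bound for that j, while a point off E satisfies at least one threshold.
  set E : Set ℝ := Ici 1 ∩ ⋂ j, {r | r ≤ x j → Real.sqrt (q j) < L (r + s) - L (r - s)} with hE
  have hEm : MeasurableSet E := by
    refine measurableSet_Ici.inter (MeasurableSet.iInter fun j => ?_)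
    have : {r | r ≤ x j → Real.sqrt (q j) < L (r + s) - L (r - s)}
      = (Iic (x j))ᶜ ∪ {r | Real.sqrt (q j) < L (r + s) - L (r - s)} := by
      ext r; simp only [mem_ofPred_eq, mem_union, mem_compl_iff, mem_Iic]; tauto
    rw [this]
    exact measurableSet_Iic.compl.union
      (measurableSet_lt measurable_const (measurable_add_sub_sub hL s))
  refine ⟨E, inter_subset_left, hEm, ?_, ?_⟩
  · rw [Metric.tendsto_nhds]
    intro η hη
    obtain ⟨J, hJ⟩ := eventually_atTop.1 ((tendsto_order.1 hq0).2 η hη)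
    -- Beyond the first J terms of x, the index j with r ≤ x j must be at least J, where the
    -- threshold is below η. No monotonicity of x is needed.
    obtain ⟨M, hM⟩ : ∃ M, ∀ j < J, x j ≤ M := by
      obtain ⟨M, hM⟩ := ((Finset.range J).image x).bddAbove
      exact ⟨M, fun j hj => hM (by simpa using ⟨j, hj, rfl⟩)⟩
    rw [eventually_inf_principal]
    filter_upwards [eventually_gt_atTop M, eventually_ge_atTop 1] with r hr h1 hrE
    have : ∃ j, r ≤ x j ∧ L (r + s) - L (r - s) ≤ Real.sqrt (q j) := by
      by_contra! hcon
      exact hrE ⟨h1, mem_iInter.2 fun j => hcon j⟩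
    obtain ⟨j, hj1, hj2⟩ := this
    have hjJ : J ≤ j := by
      by_contra! h
      linarith [hM j h]
    rw [Real.dist_eq, sub_zero, abs_of_nonneg (sub_nonneg.2 (hL (by linarith)))]
    exact hj2.trans_lt (hJ j hjJ)
  · have hlim : Tendsto (fun j => ENNReal.ofReal (Real.sqrt (q j))) atTop (𝓝 0) := by
      simpa [Function.comp_def] using (ENNReal.continuous_ofReal.tendsto _).comp hq0
    refine tendsto_of_tendsto_of_tendsto_of_le_of_le' tendsto_const_nhds hlim
      (Eventually.of_forall fun _ => zero_le) ?_
    filter_upwards [hx.eventually_gt_atTop 0] with j hj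
    have hsub : E ∩ Icc 1 (x j) ⊆
        {r | Real.sqrt (q j) < L (r + s) - L (r - s)} ∩ Icc 1 (x j) := fun r hr =>
      ⟨mem_iInter.1 hr.1.2 j hr.2.2, hr.2⟩
    have hsq : 0 < Real.sqrt (q j) := Real.sqrt_pos.2 (hqpos j)
    refine ENNReal.div_le_of_le_mul ((measure_mono hsub).trans
      ((volume_lt_add_sub_sub_le hL h0 hs hsq).trans ?_))
    rw [← ENNReal.ofReal_mul hsq.le]
    refine ENNReal.ofReal_le_ofReal ?_
    rw [div_le_iff₀ hsq]
    have h1 : Real.sqrt (q j) * x j * Real.sqrt (q j) = q j * x j := by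
      rw [mul_right_comm, Real.mul_self_sqrt (hqpos j).le]
    rw [h1]
    have h2 : 2 * s * L (x j + s) = 2 * s * |L (x j + s) / x j| * x j := by
      rw [abs_of_nonneg (div_nonneg (h0 _) hj.le)]; field_simp
    rw [h2]
    refine mul_le_mul_of_nonneg_right ?_ hj.le
    simp only [hqdef]
    have : (0 : ℝ) < 1 / ((j : ℝ) + 1) := by positivity
    linarith

theorem exists_lowerDensity_eq_zero {L : ℝ → ℝ} (hL : Monotone L) (h0 : ∀ x, 0 ≤ L x) {s : ℝ}
    (hs : 0 < s) (hq : ∀ η > 0, ∃ᶠ r in atTop, L r / r < η) :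
    ∃ E ⊆ Ici (1 : ℝ), MeasurableSet E ∧
      Tendsto (fun r => L (r + s) - L (r - s)) (atTop ⊓ 𝓟 Eᶜ) (𝓝 0) ∧ lowerDensity E = 0 := by
  have h1 : ∀ j : ℕ, ∃ y : ℝ, (j : ℝ) + 2 * s ≤ y ∧ L y / y < 1 / ((j : ℝ) + 1) := fun j => by
    obtain ⟨y, hy1, hy2⟩ := ((hq (1 / ((j : ℝ) + 1)) (by positivity)).and_eventually
      (eventually_ge_atTop ((j : ℝ) + 2 * s))).exists
    exact ⟨y, hy2, hy1⟩
  choose y hy1 hy2 using h1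
  -- The sequence is y j - s because the sparse set is controlled by L(x j + s); y j ≥ 2s makes
  -- division by y j - s cost at most a factor 2.
  have hx : Tendsto (fun j => y j - s) atTop atTop :=
    tendsto_atTop_mono (fun j => by linarith [hy1 j]) tendsto_natCast_atTop_atTop
  obtain ⟨E, hE1, hE2, hE3, hE4⟩ := exists_sparse_along hL h0 hs hx (by
    have h2 : Tendsto (fun j : ℕ => 2 * (1 / ((j : ℝ) + 1))) atTop (𝓝 0) := by
      simpa using tendsto_one_div_add_atTop_nhds_zero_nat.const_mul (2 : ℝ)
    refine squeeze_zero (fun j => div_nonneg (h0 _) ?_) (fun j => ?_) h2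
    · have := hy1 j
      have : (0 : ℝ) ≤ j := by positivity
      linarith
    · have h3 := hy1 j
      have h4 : (0 : ℝ) ≤ j := by positivity
      have h5 : 0 < y j := by linarith
      have h6 : y j ≤ 2 * (y j - s) := by linarith
      rw [sub_add_cancel]
      have h7 := hy2 j
      rw [div_lt_iff₀ h5] at h7
      rw [div_le_iff₀ (by linarith)]
      have h8 : (0 : ℝ) < 1 / ((j : ℝ) + 1) := by positivity
      nlinarith)
  refine ⟨E, hE1, hE2, hE3, le_antisymm ?_ zero_le⟩
  calc lowerDensity E
      ≤ liminf (fun r : ℝ => volume (E ∩ Icc 1 r) / ENNReal.ofReal r)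
          (map (fun j => y j - s) atTop) := liminf_le_liminf_of_le hx
    _ = 0 := hE4.liminf_eq

theorem exists_upperDensity_eq_zero {L : ℝ → ℝ} (hL : Monotone L) (h0 : ∀ x, 0 ≤ L x) {s : ℝ}
    (hs : 0 < s) (hq : Tendsto (fun r => L r / r) atTop (𝓝 0)) :
    ∃ E ⊆ Ici (1 : ℝ), MeasurableSet E ∧
      Tendsto (fun r => L (r + s) - L (r - s)) (atTop ⊓ 𝓟 Eᶜ) (𝓝 0) ∧ upperDensity E = 0 := by
  have hx : Tendsto (fun j : ℕ => (j : ℝ)) atTop atTop := tendsto_natCast_atTop_atTop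
  obtain ⟨E, hE1, hE2, hE3, hE4⟩ := exists_sparse_along hL h0 hs hx (by
    have h1 : Tendsto (fun j : ℕ => 2 * (L (j + s) / (j + s))) atTop (𝓝 0) := by
      simpa using (hq.comp (tendsto_atTop_add_const_right _ s hx)).const_mul (2 : ℝ)
    refine squeeze_zero' (Eventually.of_forall fun j => div_nonneg (h0 _) (by positivity)) ?_ h1
    filter_upwards [hx.eventually_gt_atTop s] with j hj
    rw [← mul_div_assoc, div_le_div_iff₀ (by linarith) (by linarith)]
    nlinarith [h0 (j + s)])
  refine ⟨E, hE1, hE2, hE3, Tendsto.limsup_eq ?_⟩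
  -- The density was controlled at integers only; rounding r up to ⌈r⌉ ≤ 2r loses a factor 2.
  have h2 : Tendsto (fun r : ℝ => 2 * (volume (E ∩ Icc 1 (⌈r⌉₊ : ℝ)) / ENNReal.ofReal ⌈r⌉₊)) atTop
      (𝓝 0) := by
    have := ENNReal.Tendsto.const_mul (a := 2) (hE4.comp (tendsto_nat_ceil_atTop (α := ℝ))) (Or.inr (by simp))
    simpa using this
  refine tendsto_of_tendsto_of_tendsto_of_le_of_le' tendsto_const_nhds h2
    (Eventually.of_forall fun _ => zero_le) ?_
  filter_upwards [eventually_ge_atTop 1] with r hr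
  have hc1 : r ≤ ⌈r⌉₊ := Nat.le_ceil r
  have hc2 : (⌈r⌉₊ : ℝ) ≤ 2 * r := by
    have := Nat.ceil_lt_add_one (show 0 ≤ r by linarith)
    linarith
  have hpos : 0 < r := by linarith
  have hpos' : (0 : ℝ) < ⌈r⌉₊ := by linarith
  have h3 : volume (E ∩ Icc 1 r) ≤ volume (E ∩ Icc 1 (⌈r⌉₊ : ℝ)) :=
    measure_mono (inter_subset_inter_right _ (Icc_subset_Icc_right hc1))
  refine ENNReal.div_le_of_le_mul (h3.trans ?_)
  have h4 : ENNReal.ofReal ⌈r⌉₊ ≤ 2 * ENNReal.ofReal r := by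
    rw [show (2 : ℝ≥0∞) = ENNReal.ofReal 2 by simp, ← ENNReal.ofReal_mul (by norm_num)]
    exact ENNReal.ofReal_le_ofReal hc2
  calc volume (E ∩ Icc 1 (⌈r⌉₊ : ℝ))
      = volume (E ∩ Icc 1 (⌈r⌉₊ : ℝ)) / ENNReal.ofReal ⌈r⌉₊ * ENNReal.ofReal ⌈r⌉₊ := by
        rw [ENNReal.div_mul_cancel (by simpa using hpos') (by simp)]
    _ ≤ volume (E ∩ Icc 1 (⌈r⌉₊ : ℝ)) / ENNReal.ofReal ⌈r⌉₊ * (2 * ENNReal.ofReal r) := by gcongr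
    _ = _ := by ring

/-- On the dyadic block [2^k, 2^(k+1)) the threshold (k + 1)^(-ε/2) is used. The growth hypothesis
makes L there O(2^k / k^(1+ε)), so the block contributes O(k^(-1-ε/2)) to the logarithmic measure, a
convergent series. Half of ε pays for the decay of the thresholds and the other half for
summability. -/
theorem exists_logMeasure_lt_top {L : ℝ → ℝ} (hL : Monotone L) (h0 : ∀ x, 0 ≤ L x) {s : ℝ}
    (hs : 0 < s) {ε : ℝ} (hε : 0 < ε)
    (hq : ∀ᶠ r in atTop, Real.log r ^ (1 + ε) * L r / r < 1) :
    ∃ E ⊆ Ici (1 : ℝ), MeasurableSet E ∧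
      Tendsto (fun r => L (r + s) - L (r - s)) (atTop ⊓ 𝓟 Eᶜ) (𝓝 0) ∧ logMeasure E < ⊤ := by
  set δ : ℕ → ℝ := fun k => ((k : ℝ) + 1) ^ (-(ε / 2)) with hδ
  have hδpos : ∀ k, 0 < δ k := fun k => by positivity
  set A : ℕ → Set ℝ := fun k => {r | δ k < L (r + s) - L (r - s)} ∩ Ico (2 ^ k) (2 ^ (k + 1))
    with hA
  have hAm : ∀ k, MeasurableSet (A k) := fun k =>
    (measurableSet_lt measurable_const (measurable_add_sub_sub hL s)).inter measurableSet_Ico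
  have hAge : ∀ k, ∀ r ∈ A k, (2 : ℝ) ^ k ≤ r := fun k r hr => hr.2.1
  refine ⟨⋃ k, A k, ?_, MeasurableSet.iUnion hAm, ?_, ?_⟩
  · refine iUnion_subset fun k r hr => ?_
    exact (one_le_pow₀ (by norm_num : (1 : ℝ) ≤ 2)).trans (hAge k r hr)
  · have hδ0 : Tendsto δ atTop (𝓝 0) :=
      (tendsto_rpow_neg_atTop (half_pos hε)).comp
        (tendsto_atTop_add_const_right _ 1 tendsto_natCast_atTop_atTop)
    rw [Metric.tendsto_nhds]
    intro η hη
    obtain ⟨K, hK⟩ := eventually_atTop.1 ((tendsto_order.1 hδ0).2 η hη)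
    rw [eventually_inf_principal]
    filter_upwards [eventually_ge_atTop ((2 : ℝ) ^ K), eventually_ge_atTop 1] with r hr h1 hrE
    obtain ⟨k, hk1, hk2⟩ := exists_nat_pow_near h1 (by norm_num : (1 : ℝ) < 2)
    have hKk : K ≤ k := by
      by_contra! h
      have : (2 : ℝ) ^ (k + 1) ≤ 2 ^ K := pow_le_pow_right₀ (by norm_num) h
      linarith
    have h2 : ¬ δ k < L (r + s) - L (r - s) := fun h =>
      hrE (mem_iUnion.2 ⟨k, h, hk1, hk2⟩)
    rw [Real.dist_eq, sub_zero, abs_of_nonneg (sub_nonneg.2 (hL (by linarith)))]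
    exact (not_lt.1 h2).trans_lt (hK k hKk)
  · set a : ℕ → ℝ := fun k => 2 * s * L (2 ^ (k + 1) + s) / δ k / 2 ^ k with ha
    have hlog : ∀ k, logMeasure (A k) ≤ ENNReal.ofReal (a k) := fun k => by
      have h2 : (0 : ℝ) < 2 ^ k := by positivity
      calc logMeasure (A k) ≤ ∫⁻ _ in A k, ENNReal.ofReal (1 / 2 ^ k) :=
            setLIntegral_mono' (hAm k) fun r hr => ENNReal.ofReal_le_ofReal
              (one_div_le_one_div_of_le h2 (hAge k r hr))
        _ = ENNReal.ofReal (1 / 2 ^ k) * volume (A k) := by simp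
        _ ≤ ENNReal.ofReal (1 / 2 ^ k) *
            ENNReal.ofReal (2 * s * L (2 ^ (k + 1) + s) / δ k) := by
          gcongr
          exact (measure_mono (inter_subset_inter_right _ Ico_subset_Icc_self)).trans
            (volume_lt_add_sub_sub_le hL h0 hs (hδpos k))
        _ = ENNReal.ofReal (a k) := by
          rw [← ENNReal.ofReal_mul (by positivity)]
          congr 1
          simp only [ha]; ring
    have hsum : Summable a := by
      have hb : Summable fun k : ℕ => ((k : ℝ) + 1) ^ (-(1 + ε / 2)) := by
        have := (Real.summable_nat_rpow (p := -(1 + ε / 2))).2 (by linarith)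
        simpa using (summable_nat_add_iff 1).2 this
      refine summable_of_isBigO_nat hb (Asymptotics.IsBigO.of_bound
        (2 * s * 4 / Real.log 2 ^ (1 + ε)) ?_)
      have ht : Tendsto (fun k : ℕ => (2 : ℝ) ^ (k + 2)) atTop atTop :=
        (tendsto_pow_atTop_atTop_of_one_lt (by norm_num)).comp (tendsto_add_atTop_nat 2)
      filter_upwards [ht.eventually hq, (ht.eventually_ge_atTop (2 * s))] with k hk hks
      have hlog2 : 0 < Real.log 2 := Real.log_pos (by norm_num)
      have hk1 : (0 : ℝ) < k + 1 := by positivity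
      have hp2 : (0 : ℝ) < 2 ^ (k + 2) := by positivity
      have hlogk : Real.log 2 * (k + 1) ≤ Real.log (2 ^ (k + 2)) := by
        rw [Real.log_pow]; push_cast; nlinarith
      have hmono : L (2 ^ (k + 1) + s) ≤ L (2 ^ (k + 2)) := hL (by
        have : (2 : ℝ) ^ (k + 2) = 2 * 2 ^ (k + 1) := by ring
        linarith)
      have hLle : L (2 ^ (k + 2)) * (Real.log 2 ^ (1 + ε) * ((k : ℝ) + 1) ^ (1 + ε))
          ≤ 2 ^ (k + 2) := by
        rw [← Real.mul_rpow hlog2.le hk1.le]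
        rw [div_lt_one hp2] at hk
        refine le_trans ?_ hk.le
        rw [mul_comm]
        exact mul_le_mul_of_nonneg_right (Real.rpow_le_rpow (by positivity) hlogk (by linarith))
          (h0 _)
      have e1 : ((k : ℝ) + 1) ^ (-(1 + ε / 2)) = ((k : ℝ) + 1) ^ (ε / 2) / (k + 1) ^ (1 + ε) := by
        rw [← Real.rpow_sub hk1]; congr 1; ring
      have e2 : δ k = (((k : ℝ) + 1) ^ (ε / 2))⁻¹ := Real.rpow_neg hk1.le _
      rw [Real.norm_of_nonneg (by have := h0 (2 ^ (k + 1) + s); have := hδpos k; positivity),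
        Real.norm_of_nonneg (by positivity), e1]
      simp only [ha]
      rw [e2]
      have hA1 : 0 < ((k : ℝ) + 1) ^ (ε / 2) := by positivity
      have hA2 : 0 < ((k : ℝ) + 1) ^ (1 + ε) := by positivity
      have hA3 : 0 < Real.log 2 ^ (1 + ε) := by positivity
      have h2k : (0 : ℝ) < 2 ^ k := by positivity
      rw [div_inv_eq_mul, div_le_iff₀ h2k]
      have h5 : L (2 ^ (k + 1) + s) ≤ 4 * 2 ^ k / (Real.log 2 ^ (1 + ε) * ((k : ℝ) + 1) ^ (1 + ε)) := by
        rw [le_div_iff₀ (by positivity)]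
        calc _ ≤ L (2 ^ (k + 2)) * (Real.log 2 ^ (1 + ε) * ((k : ℝ) + 1) ^ (1 + ε)) := by gcongr
          _ ≤ 2 ^ (k + 2) := hLle
          _ = 4 * 2 ^ k := by ring
      calc 2 * s * L (2 ^ (k + 1) + s) * ((k : ℝ) + 1) ^ (ε / 2)
          ≤ 2 * s * (4 * 2 ^ k / (Real.log 2 ^ (1 + ε) * ((k : ℝ) + 1) ^ (1 + ε)))
            * ((k : ℝ) + 1) ^ (ε / 2) := by gcongr
        _ = _ := by field_simp
    calc logMeasure (⋃ k, A k) ≤ ∑' k, logMeasure (A k) := lintegral_iUnion_le _ _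
      _ ≤ ∑' k, ENNReal.ofReal (a k) := ENNReal.tsum_le_tsum hlog
      _ < ⊤ := by
        rw [lt_top_iff_ne_top]
        exact hsum.tsum_ofReal_ne_top

/-! ### From shifted inequalities to asymptotic equivalence -/

theorem equivOutsideSmallSet_of_eventuallyEq {S T : ℝ → ℝ} (h : S =ᶠ[atTop] T) :
    EquivOutsideSmallSet S T := by
  refine ⟨∅, empty_subset _, MeasurableSet.empty, ?_, ?_, ?_, ?_⟩
  · exact (Filter.EventuallyEq.isEquivalent h).mono inf_le_left
  · simp [lowerDensity]
  · simp [upperDensity]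
  · simp [logMeasure]

/-- S is squeezed between values of T at r - s and r + s, and their ratio is the exponential of an
increment of log T, which is small off a sparse set. One set has to serve all three growth
conditions: a set is built for each condition, and the three are intersected. -/
theorem equivOutsideSmallSet_of_le {S T : ℝ → ℝ} {s : ℝ} (hs : 0 < s) (hT : MonotoneOn T (Ioi 0))
    (htop : Tendsto T atTop atTop)
    (hupper : ∀ ε > 0, ∀ᶠ r in atTop, S r ≤ (1 + ε) * T (r + s))
    (hlower : ∀ ε > 0, ε < 1 → ∀ᶠ r in atTop, (1 - ε) * T (r - s) ≤ S r) :
    EquivOutsideSmallSet S T := by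
  obtain ⟨r₁, hr₁⟩ := eventually_atTop.1 ((htop.eventually_ge_atTop 1).and (eventually_gt_atTop 0))
  -- Freezing T below r₁, where T may be less than 1, makes log T monotone and nonnegative on the
  -- whole line.
  set L : ℝ → ℝ := fun r => Real.log (T (max r r₁)) with hLdef
  have hLT : ∀ r, r₁ ≤ r → L r = Real.log (T r) := fun r hr => by simp [hLdef, max_eq_left hr]
  have hmax : ∀ r, 1 ≤ T (max r r₁) := fun r => (hr₁ _ (le_max_right _ _)).1
  have hL : Monotone L := fun x y hxy => by
    refine Real.log_le_log (by linarith [hmax x]) (hT ?_ ?_ (max_le_max_right _ hxy))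
    · exact (hr₁ _ (le_max_right _ _)).2
    · exact (hr₁ _ (le_max_right _ _)).2
  have hL0 : ∀ r, 0 ≤ L r := fun r => Real.log_nonneg (hmax r)
  have hLev : L =ᶠ[atTop] fun r => Real.log (T r) :=
    (eventually_ge_atTop r₁).mono hLT
  -- When the growth condition P fails, E = [1, ∞) is admissible: the limit is then along the
  -- trivial filter and the size condition is void.
  have key : ∀ (P : Prop) (Q : Set ℝ → Prop), (P → ∃ E ⊆ Ici (1 : ℝ), MeasurableSet E ∧
      Tendsto (fun r => L (r + s) - L (r - s)) (atTop ⊓ 𝓟 Eᶜ) (𝓝 0) ∧ Q E) →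
      ∃ E ⊆ Ici (1 : ℝ), MeasurableSet E ∧
      Tendsto (fun r => L (r + s) - L (r - s)) (atTop ⊓ 𝓟 Eᶜ) (𝓝 0) ∧ (P → Q E) := by
    intro P Q h
    by_cases hP : P
    · obtain ⟨E, h1, h2, h3, h4⟩ := h hP
      exact ⟨E, h1, h2, h3, fun _ => h4⟩
    · refine ⟨Ici 1, subset_rfl, measurableSet_Ici, ?_, fun h => absurd h hP⟩
      have : (atTop ⊓ 𝓟 (Ici (1 : ℝ))ᶜ) = ⊥ := by
        rw [← disjoint_iff, disjoint_principal_right, compl_compl]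
        exact Ici_mem_atTop 1
      rw [this]
      exact tendsto_bot
  obtain ⟨E₁, hE₁, hm₁, ht₁, hd₁⟩ := key
    (liminf (fun r => ((Real.log (T r) / r : ℝ) : EReal)) atTop = 0) (fun E => lowerDensity E = 0)
    (fun h => exists_lowerDensity_eq_zero hL hL0 hs fun η hη => by
      have h1 : liminf (fun r => ((Real.log (T r) / r : ℝ) : EReal)) atTop < (η : EReal) := by
        rw [h]; exact_mod_cast hη
      refine ((frequently_lt_of_liminf_lt (by isBoundedDefault) h1).and_eventually hLev).mono
        fun r hr => ?_
      rw [hr.2]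
      exact_mod_cast hr.1)
  obtain ⟨E₂, hE₂, hm₂, ht₂, hd₂⟩ := key
    (limsup (fun r => ((Real.log (T r) / r : ℝ) : EReal)) atTop = 0) (fun E => upperDensity E = 0)
    (fun h => exists_upperDensity_eq_zero hL hL0 hs (by
      rw [Metric.tendsto_nhds]
      intro η hη
      have h1 : limsup (fun r => ((Real.log (T r) / r : ℝ) : EReal)) atTop < (η : EReal) := by
        rw [h]; exact_mod_cast hη
      filter_upwards [eventually_lt_of_limsup_lt h1 (by isBoundedDefault), hLev,
        eventually_gt_atTop 0] with r hr1 hr2 hr3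
      rw [Real.dist_eq, sub_zero, abs_of_nonneg (div_nonneg (hL0 r) hr3.le), hr2]
      exact_mod_cast hr1))
  obtain ⟨E₃, hE₃, hm₃, ht₃, hd₃⟩ := key
    (∃ ε : ℝ, 0 < ε ∧
      limsup (fun r => ((Real.log r ^ (1 + ε) * Real.log (T r) / r : ℝ) : EReal)) atTop = 0)
    (fun E => logMeasure E < ⊤)
    (fun ⟨ε, hε, h⟩ => exists_logMeasure_lt_top hL hL0 hs hε (by
      have h1 : limsup (fun r => ((Real.log r ^ (1 + ε) * Real.log (T r) / r : ℝ) : EReal)) atTop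
          < ((1 : ℝ) : EReal) := by
        rw [h]; exact_mod_cast one_pos
      filter_upwards [eventually_lt_of_limsup_lt h1 (by isBoundedDefault), hLev] with r hr1 hr2
      rw [hr2]
      exact_mod_cast hr1))
  -- The complement of the intersection is the union of the complements, and increments tend to zero
  -- along each of them.
  have ht : Tendsto (fun r => L (r + s) - L (r - s)) (atTop ⊓ 𝓟 (E₁ ∩ E₂ ∩ E₃)ᶜ) (𝓝 0) := by
    rw [compl_inter, compl_inter, ← sup_principal, ← sup_principal, inf_sup_left, inf_sup_left]
    exact (ht₁.sup ht₂).sup ht₃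
  refine ⟨E₁ ∩ E₂ ∩ E₃, fun r hr => hE₁ hr.1.1, (hm₁.inter hm₂).inter hm₃, ?_, ?_, ?_, ?_⟩
  · set l := atTop ⊓ 𝓟 (E₁ ∩ E₂ ∩ E₃)ᶜ with hl
    have hll : l ≤ atTop := inf_le_left
    refine (Asymptotics.isLittleO_iff).2 fun {ε} hε => ?_
    have hc1 : Tendsto (fun η : ℝ => (1 + η) * Real.exp η) (𝓝[>] 0) (𝓝 1) := by
      have : Continuous fun η : ℝ => (1 + η) * Real.exp η := by fun_prop
      simpa using (this.tendsto 0).mono_left nhdsWithin_le_nhds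
    have hc2 : Tendsto (fun η : ℝ => (1 - η) * Real.exp (-η)) (𝓝[>] 0) (𝓝 1) := by
      have : Continuous fun η : ℝ => (1 - η) * Real.exp (-η) := by fun_prop
      simpa using (this.tendsto 0).mono_left nhdsWithin_le_nhds
    -- The error η is spent twice, once in the shifted inequalities and once as the bound for the
    -- increment of log T, hence the factors (1 ± η) e^(±η).
    obtain ⟨η, h1, h2, h3, h4⟩ := (((tendsto_order.1 hc1).2 (1 + ε) (by linarith)).and
      (((tendsto_order.1 hc2).1 (1 - ε) (by linarith)).and
      ((eventually_mem_nhdsWithin (a := (0 : ℝ)) (s := Ioi 0)).and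
      (mem_nhdsWithin_of_mem_nhds (Iio_mem_nhds (zero_lt_one (α := ℝ))))))).exists
    replace h3 : 0 < η := h3
    replace h4 : η < 1 := h4
    filter_upwards [hll (hupper η h3), hll (hlower η h3 h4), (tendsto_order.1 ht).2 η h3,
      hll (eventually_ge_atTop (max r₁ 1 + s))] with r g1 g2 g3 g4
    have k0 : r₁ ≤ r - s := by linarith [le_max_left r₁ 1]
    have k0' : 0 < r - s := by linarith [le_max_right r₁ 1]
    have k1 : 1 ≤ T (r - s) := (hr₁ _ k0).1
    have k2 : T (r - s) ≤ T r := hT k0' (show (0 : ℝ) < r by linarith) (by linarith)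
    have k3 : T r ≤ T (r + s) :=
      hT (show (0 : ℝ) < r by linarith) (show (0 : ℝ) < r + s by linarith) (by linarith)
    rw [hLT _ k0, hLT _ (by linarith)] at g3
    have k4 : T (r + s) ≤ Real.exp η * T (r - s) := by
      have h5 : Real.log (T (r + s)) ≤ η + Real.log (T (r - s)) := by linarith
      have h6 := Real.exp_le_exp.2 h5
      rwa [Real.exp_add, Real.exp_log (by linarith), Real.exp_log (by linarith)] at h6
    have k5 : Real.exp (-η) * T r ≤ T (r - s) := by
      rw [Real.exp_neg, inv_mul_le_iff₀ (Real.exp_pos _)]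
      linarith
    have hTpos : 0 < T r := by linarith
    simp only [Pi.sub_apply]
    rw [Real.norm_eq_abs, Real.norm_of_nonneg hTpos.le, abs_le]
    constructor
    · have : (1 - η) * (Real.exp (-η) * T r) ≤ (1 - η) * T (r - s) :=
        mul_le_mul_of_nonneg_left k5 (by linarith)
      nlinarith
    · have a1 : T (r + s) ≤ Real.exp η * T r :=
        k4.trans (mul_le_mul_of_nonneg_left k2 (Real.exp_pos _).le)
      have : (1 + η) * T (r + s) ≤ (1 + η) * (Real.exp η * T r) :=
        mul_le_mul_of_nonneg_left a1 (by linarith)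
      nlinarith
  · intro h
    refine le_antisymm ((liminf_le_liminf (Eventually.of_forall fun r => ?_)).trans
      (hd₁ h).le) zero_le
    exact ENNReal.div_le_div_right (measure_mono (inter_subset_inter_left _ fun r hr => hr.1.1)) _
  · intro h
    refine le_antisymm ((limsup_le_limsup (Eventually.of_forall fun r => ?_)).trans
      (hd₂ h).le) zero_le
    exact ENNReal.div_le_div_right (measure_mono (inter_subset_inter_left _ fun r hr => hr.1.2)) _
  · intro ε hε h
    exact (lintegral_mono_set fun r hr => hr.2).trans_lt (hd₃ ⟨ε, hε, h⟩)

/-! ### The annular kernel and functions of logarithmic growth -/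

/-- The difference of the means of `log |z - ·|` over the circles of radius `r` and `r₀` around the
origin. -/
noncomputable def annularKernel (r₀ r : ℝ) (z : ℂ) : ℝ :=
  Real.log (max r ‖z‖) - Real.log (max r₀ ‖z‖)

section annularKernel

variable {r₀ r : ℝ}

theorem annularKernel_nonneg (h₀ : 0 < r₀) (h : r₀ ≤ r) (z : ℂ) : 0 ≤ annularKernel r₀ r z :=
  sub_nonneg.2 (Real.log_le_log (lt_max_of_lt_left h₀) (max_le_max_right _ h))

theorem annularKernel_of_le {z : ℂ} (h : r₀ ≤ r) (hz : r ≤ ‖z‖) : annularKernel r₀ r z = 0 := by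
  simp [annularKernel, max_eq_right hz, max_eq_right (h.trans hz)]

theorem continuous_annularKernel (h₀ : 0 < r₀) (hr : 0 < r) : Continuous (annularKernel r₀ r) := by
  unfold annularKernel
  refine Continuous.sub ?_ ?_
  · exact (continuous_const.max continuous_norm).log fun _ => (lt_max_of_lt_left hr).ne'
  · exact (continuous_const.max continuous_norm).log fun _ => (lt_max_of_lt_left h₀).ne'

theorem hasCompactSupport_annularKernel (h : r₀ ≤ r) : HasCompactSupport (annularKernel r₀ r) :=
  HasCompactSupport.intro (isCompact_closedBall 0 r) fun z hz =>
    annularKernel_of_le h (by simpa using (not_le.1 (by simpa using hz)).le)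

theorem continuous_annularKernel_sub (h₀ : 0 < r₀) (hr : 0 < r) (c : ℂ) :
    Continuous fun z => annularKernel r₀ r (z - c) :=
  (continuous_annularKernel h₀ hr).comp (continuous_id.sub continuous_const)

theorem hasCompactSupport_annularKernel_sub (h : r₀ ≤ r) (c : ℂ) :
    HasCompactSupport fun z => annularKernel r₀ r (z - c) :=
  (hasCompactSupport_annularKernel h).comp_homeomorph (Homeomorph.subRight c)

theorem integrable_annularKernel_sub (μ : Measure ℂ) [IsLocallyFiniteMeasure μ] (h₀ : 0 < r₀)
    (h : r₀ ≤ r) (c : ℂ) : Integrable (fun z => annularKernel r₀ r (z - c)) μ :=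
  (continuous_annularKernel_sub h₀ (h₀.trans_le h) c).integrable_of_hasCompactSupport
    (hasCompactSupport_annularKernel_sub h c)

/-- The change of the annular kernel under a translation. -/
theorem annularKernel_le_of_norm_sub_le {s : ℝ} (hs : 0 ≤ s) (h₀ : 0 < r₀) (h : r₀ ≤ r) {z w : ℂ}
    (hzw : ‖z - w‖ ≤ s) :
    annularKernel r₀ r w ≤ (1 + s / r₀) * annularKernel (r₀ + s) (r + s) z := by
  rcases le_total r ‖w‖ with hw | hw
  · rw [annularKernel_of_le h hw]
    exact mul_nonneg (by positivity) (annularKernel_nonneg (by linarith) (by linarith) z)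
  have hz : ‖z‖ ≤ ‖w‖ + s := by
    have := norm_add_le w (z - w)
    rw [add_sub_cancel] at this
    linarith
  -- Both kernels are logarithms of quotients: the left one is log(r/x), and the one at z is at
  -- least log((r + s)/(x + s)).
  set x := max r₀ ‖w‖ with hx
  have hx0 : r₀ ≤ x := le_max_left _ _
  have hxr : x ≤ r := max_le h hw
  have hxw : ‖w‖ ≤ x := le_max_right _ _
  have hr : 0 < r := h₀.trans_le h
  have h1 : annularKernel r₀ r w = Real.log r - Real.log x := by
    rw [annularKernel, max_eq_left hw]
  have h2 : Real.log (r + s) - Real.log (x + s) ≤ annularKernel (r₀ + s) (r + s) z := by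
    rw [annularKernel, max_eq_left (by linarith : ‖z‖ ≤ r + s)]
    have : Real.log (max (r₀ + s) ‖z‖) ≤ Real.log (x + s) :=
      Real.log_le_log (lt_max_of_lt_left (by linarith)) (max_le (by linarith) (by linarith))
    linarith
  have hp : 0 ≤ s / r₀ := by positivity
  refine le_trans ?_ (mul_le_mul_of_nonneg_left h2 (by linarith))
  rw [h1, ← Real.log_div (by linarith) (by linarith), ← Real.log_div (by linarith) (by linarith),
    ← Real.log_rpow (div_pos (by linarith) (by linarith))]
  have hxs : 0 < x + s := by linarith
  have hxp : 0 < x := by linarith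
  refine Real.log_le_log (div_pos hr hxp) ?_
  -- Bernoulli's inequality with exponent p = 1 + s/r₀. As (x + s)/x ≤ p for x ≥ r₀, it gives r/x ≤
  -- ((r + s)/(x + s))^p.
  have hB := one_add_mul_self_le_rpow_one_add (s := (r - x) / (x + s)) (p := 1 + s / r₀)
    (by have : 0 ≤ (r - x) / (x + s) := div_nonneg (by linarith) hxs.le
        linarith) (by linarith)
  have e : 1 + (r - x) / (x + s) = (r + s) / (x + s) := by field_simp; ring
  rw [e] at hB
  refine le_trans ?_ hB
  have h3 : (x + s) / x ≤ 1 + s / r₀ := by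
    rw [add_div, div_self hxp.ne']
    gcongr
  have h4 : (x + s) / x * ((r - x) / (x + s)) ≤ (1 + s / r₀) * ((r - x) / (x + s)) :=
    mul_le_mul_of_nonneg_right h3 (div_nonneg (by linarith) hxs.le)
  have h5 : (x + s) / x * ((r - x) / (x + s)) = r / x - 1 := by field_simp
  linarith

/-- Midpoint convexity of log max(r, |z|) as a function of log r, at the points r/q, r and qr. -/
theorem annularKernel_div_le_mul {q : ℝ} (hr : 0 < r) (hq : 1 ≤ q) (z : ℂ) :
    annularKernel (r / q) r z ≤ annularKernel r (q * r) z := by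
  have hq0 : 0 < q := by linarith
  have h1 : Real.log (max r ‖z‖) + Real.log (max r ‖z‖)
      ≤ Real.log (max (q * r) ‖z‖) + Real.log (max (r / q) ‖z‖) := by
    rw [← Real.log_mul (lt_max_of_lt_left hr).ne' (lt_max_of_lt_left hr).ne',
      ← Real.log_mul (lt_max_of_lt_left (by positivity)).ne'
      (lt_max_of_lt_left (by positivity)).ne']
    refine Real.log_le_log (mul_pos (lt_max_of_lt_left hr) (lt_max_of_lt_left hr)) ?_
    rcases le_total ‖z‖ r with h | h
    · rw [max_eq_left h]
      calc r * r = q * r * (r / q) := by field_simp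
        _ ≤ _ := mul_le_mul (le_max_left _ _) (le_max_left _ _) (by positivity)
          (le_max_of_le_left (by positivity))
    · rw [max_eq_right h]
      exact mul_le_mul (le_max_right _ _) (le_max_right _ _) (norm_nonneg _)
        (le_max_of_le_left (by positivity))
  unfold annularKernel
  linarith

/-- The annular kernel as an integral over the radii of discs. -/
theorem integral_indicator_div_eq_annularKernel (h₀ : 0 < r₀) (h : r₀ ≤ r) (z : ℂ) :
    ∫ t in r₀..r, (Ioi ‖z‖).indicator (fun t => t⁻¹) t = annularKernel r₀ r z := by
  have hr := h₀.trans_le h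
  have hint : ∀ a b : ℝ, 0 < a → 0 < b → IntervalIntegrable (fun t : ℝ => t⁻¹) volume a b :=
    fun a b ha hb => intervalIntegral.intervalIntegrable_inv
      (fun x hx => ne_of_gt (lt_of_lt_of_le (lt_min ha hb) hx.1)) continuousOn_id
  have key : ∀ a b : ℝ, 0 < a → a ≤ b → ‖z‖ ≤ a →
      ∫ t in a..b, (Ioi ‖z‖).indicator (fun t => t⁻¹) t = Real.log b - Real.log a := by
    intro a b ha hab hz
    rw [← Real.log_div (by linarith) (by linarith), ← integral_inv_of_pos ha (by linarith)]
    refine intervalIntegral.integral_congr_ae (ae_of_all _ fun t ht => ?_)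
    rw [uIoc_of_le hab] at ht
    exact indicator_of_mem (show ‖z‖ < t by linarith [ht.1]) _
  have key0 : ∀ a b : ℝ, a ≤ b → b ≤ ‖z‖ →
      ∫ t in a..b, (Ioi ‖z‖).indicator (fun t => t⁻¹) t = 0 := by
    intro a b hab hz
    refine intervalIntegral.integral_zero_ae (ae_of_all _ fun t ht => ?_)
    rw [uIoc_of_le hab] at ht
    exact indicator_of_notMem (show ¬ ‖z‖ < t by linarith [ht.2]) _
  rcases le_total ‖z‖ r₀ with h1 | h1
  · rw [key r₀ r h₀ h h1, annularKernel, max_eq_left h1, max_eq_left (h1.trans h)]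
  rcases le_total r ‖z‖ with h2 | h2
  · rw [key0 r₀ r h h2, annularKernel_of_le h h2]
  · have hzpos : 0 < ‖z‖ := h₀.trans_le h1
    rw [← intervalIntegral.integral_add_adjacent_intervals (b := ‖z‖), key0 _ _ h1 le_rfl,
      key _ _ hzpos h2 le_rfl, annularKernel, max_eq_left h2, max_eq_right h1, zero_add]
    · rw [intervalIntegrable_iff]
      exact (intervalIntegrable_iff.1 (hint _ _ h₀ hzpos)).indicator measurableSet_Ioi
    · rw [intervalIntegrable_iff]
      exact (intervalIntegrable_iff.1 (hint _ _ hzpos hr)).indicator measurableSet_Ioi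

end annularKernel

/-- Increasing functions of `r > 0` whose increments grow over geometric progressions. -/
structure IsLogConvexGrowth (F : ℝ → ℝ) : Prop where
  monotoneOn : MonotoneOn F (Ioi 0)
  sub_div_le : ∀ r q : ℝ, 0 < r → 1 ≤ q → F r - F (r / q) ≤ F (q * r) - F r

/-- A positive increment from a to b is repeated, at least, by every further multiplication of the
radius by q = b/a, so F grows at least linearly in n along qⁿa. -/
theorem IsLogConvexGrowth.const_or_tendsto {F : ℝ → ℝ} (hF : IsLogConvexGrowth F) :
    (∀ r r', 0 < r → 0 < r' → F r = F r') ∨ Tendsto F atTop atTop := by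
  by_cases h : ∀ r r', 0 < r → 0 < r' → F r = F r'
  · exact Or.inl h
  right
  obtain ⟨a, b, ha, hab, hlt⟩ : ∃ a b, 0 < a ∧ a < b ∧ F a < F b := by
    push Not at h
    obtain ⟨r, r', hr, hr', hne⟩ := h
    rcases lt_trichotomy r r' with h1 | h1 | h1
    · exact ⟨r, r', hr, h1, lt_of_le_of_ne (hF.monotoneOn hr hr' h1.le) hne⟩
    · exact absurd (by rw [h1]) hne
    · exact ⟨r', r, hr', h1, lt_of_le_of_ne (hF.monotoneOn hr' hr h1.le) hne.symm⟩
  have hb : 0 < b := ha.trans hab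
  set q := b / a with hq
  have hq1 : 1 < q := (one_lt_div ha).2 hab
  have hq0 : 0 < q := by linarith
  have step : ∀ n : ℕ, F b - F a ≤ F (q ^ (n + 1) * a) - F (q ^ n * a) := by
    intro n
    induction n with
    | zero =>
      have : q ^ 1 * a = b := by rw [pow_one, hq]; field_simp
      rw [zero_add, this, pow_zero, one_mul]
    | succ n ih =>
      have h1 := hF.sub_div_le (q ^ (n + 1) * a) q (by positivity) hq1.le
      have h2 : q ^ (n + 1) * a / q = q ^ n * a := by rw [pow_succ]; field_simp
      have h3 : q * (q ^ (n + 1) * a) = q ^ (n + 1 + 1) * a := by ring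
      rw [h2, h3] at h1
      linarith
  have hlow : ∀ n : ℕ, F a + n * (F b - F a) ≤ F (q ^ n * a) := by
    intro n
    induction n with
    | zero => simp
    | succ n ih => push_cast; linarith [step n]
  rw [tendsto_atTop]
  intro C
  obtain ⟨n, hn⟩ := exists_nat_gt ((C - F a) / (F b - F a))
  rw [div_lt_iff₀ (by linarith)] at hn
  filter_upwards [eventually_ge_atTop (q ^ n * a)] with r hr
  have hpos : 0 < q ^ n * a := by positivity
  have := hF.monotoneOn hpos (show (0 : ℝ) < r by linarith) hr
  linarith [hlow n]

/-- `G` is controlled by `F` up to a shift of the argument by `s`. -/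
def IsShiftDominated (s : ℝ) (G F : ℝ → ℝ) : Prop :=
  ∀ r₀ r : ℝ, 0 < r₀ → r₀ ≤ r → G r - G r₀ ≤ (1 + s / r₀) * (F (r + s) - F (r₀ + s))

/-- A base radius r₀ with s/r₀ < ε/2 brings the factor 1 + s/r₀ close to 1, and the terms at the
base radius are constants absorbed by F → ∞. The shift s is replaced by s + 1 so that it is positive
even for c = 0. -/
theorem equivOutsideSmallSet_of_isShiftDominated {F G : ℝ → ℝ} {s : ℝ} (hs : 0 ≤ s)
    (hF : IsLogConvexGrowth F) (hGF : IsShiftDominated s G F)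
    (hFG : IsShiftDominated s F G) (htop : Tendsto F atTop atTop) : EquivOutsideSmallSet G F := by
  have hs1 : 0 < s + 1 := by linarith
  have hrate : ∀ ε > 0, ∃ r₀ : ℝ, 0 < r₀ ∧ s / r₀ < ε := fun ε hε => by
    refine ⟨(s + 1) / ε, by positivity, ?_⟩
    rw [div_lt_iff₀ (by positivity)]
    field_simp
    linarith
  have hlarge : ∀ C : ℝ, ∀ t : ℝ, ∀ ε > 0, ∀ᶠ r in atTop, C ≤ ε * F (r + t) := fun C t ε hε => by
    have := (htop.comp (tendsto_atTop_add_const_right atTop t tendsto_id)).eventually_ge_atTop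
      (C / ε)
    filter_upwards [this] with r hr
    rw [div_le_iff₀ hε] at hr
    simpa [mul_comm] using hr
  refine equivOutsideSmallSet_of_le hs1 hF.monotoneOn htop ?_ ?_
  · intro ε hε
    obtain ⟨r₀, h0, h1⟩ := hrate (ε / 2) (by linarith)
    have hsr : 0 ≤ s / r₀ := div_nonneg hs h0.le
    filter_upwards [eventually_ge_atTop r₀, htop.comp
      (tendsto_atTop_add_const_right atTop s tendsto_id) |>.eventually_ge_atTop 0,
      hlarge (G r₀ - (1 + s / r₀) * F (r₀ + s)) s (ε / 2) (by linarith)] with r hr h2 h3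
    have h4 := hGF r₀ r h0 hr
    have h5 : F (r + s) ≤ F (r + (s + 1)) := hF.monotoneOn (show (0 : ℝ) < _ by linarith)
      (show (0 : ℝ) < _ by linarith) (by linarith)
    simp only [Function.comp, id] at h2
    nlinarith
  · intro ε hε hε1
    obtain ⟨r₀, h0, h1⟩ := hrate (ε / 2) (by linarith)
    have hsr : 0 ≤ s / r₀ := div_nonneg hs h0.le
    have hev : ∀ᶠ r in atTop, (1 - ε / 2) * F (r - s) - (1 - ε / 2) * F r₀ + G (r₀ + s) ≤ G r ∧
        F (r - (s + 1)) ≤ F (r - s) ∧ 0 ≤ F (r - (s + 1)) ∧ F r₀ ≤ F (r - s) := by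
      filter_upwards [eventually_ge_atTop (r₀ + s), eventually_gt_atTop (s + 1),
        htop.comp (tendsto_atTop_add_const_right atTop (-(s + 1)) tendsto_id)
          |>.eventually_ge_atTop 0] with r hr hr1 h2
      have h4 := hFG r₀ (r - s) h0 (by linarith)
      rw [sub_add_cancel] at h4
      have h7 : F r₀ ≤ F (r - s) := hF.monotoneOn h0
        (show (0 : ℝ) < _ by linarith) (by linarith)
      refine ⟨?_, hF.monotoneOn (show (0 : ℝ) < _ by linarith)
        (show (0 : ℝ) < _ by linarith) (by linarith),
        by simpa [sub_eq_add_neg] using h2, h7⟩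
      have h6 : (1 - ε / 2) * (1 + s / r₀) ≤ 1 := by nlinarith
      -- This increment of G dominates, up to a positive factor, an increment of the increasing
      -- function F.
      have hd : 0 ≤ G r - G (r₀ + s) := by
        by_contra! hneg
        nlinarith
      have := mul_le_mul_of_nonneg_left h4 (by linarith : 0 ≤ 1 - ε / 2)
      nlinarith
    filter_upwards [hev, hlarge ((1 - ε / 2) * F r₀ - G (r₀ + s)) (-(s + 1)) (ε / 2)
      (by linarith)] with r h1' h2'
    obtain ⟨k1, k2, k3, -⟩ := h1'
    rw [← sub_eq_add_neg] at h2'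
    nlinarith

/-! ### Increments given by a locally finite measure -/

section measure

variable {μ : Measure ℂ} [IsLocallyFiniteMeasure μ] {F G : ℝ → ℝ} {c : ℂ}

theorem isLogConvexGrowth_of_eq_integral
    (hF : ∀ r₀ r : ℝ, 0 < r₀ → r₀ ≤ r → F r - F r₀ = ∫ z, annularKernel r₀ r (z - c) ∂μ) :
    IsLogConvexGrowth F := by
  constructor
  · intro r₀ h₀ r _ h
    have := hF r₀ r h₀ h
    have h2 : 0 ≤ ∫ z, annularKernel r₀ r (z - c) ∂μ :=
      integral_nonneg fun z => annularKernel_nonneg h₀ h _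
    linarith
  · intro r q hr hq
    have hq0 : 0 < q := by linarith
    have h1 : r / q ≤ r := div_le_self hr.le hq
    have h2 : r ≤ q * r := le_mul_of_one_le_left hr.le hq
    rw [hF _ _ (by positivity) h1, hF _ _ hr h2]
    exact integral_mono (integrable_annularKernel_sub μ (by positivity) h1 c)
      (integrable_annularKernel_sub μ hr h2 c) fun z => annularKernel_div_le_mul hr hq _

theorem isShiftDominated_of_eq_integral {c' : ℂ}
    (hF : ∀ r₀ r : ℝ, 0 < r₀ → r₀ ≤ r → F r - F r₀ = ∫ z, annularKernel r₀ r (z - c) ∂μ)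
    (hG : ∀ r₀ r : ℝ, 0 < r₀ → r₀ ≤ r → G r - G r₀ = ∫ z, annularKernel r₀ r (z - c') ∂μ) :
    IsShiftDominated ‖c - c'‖ G F := by
  intro r₀ r h₀ h
  have hn := norm_nonneg (c - c')
  rw [hG _ _ h₀ h, hF _ _ (by linarith) (by linarith), ← integral_const_mul]
  refine integral_mono (integrable_annularKernel_sub μ h₀ h c')
    ((integrable_annularKernel_sub μ (by linarith) (by linarith) c).const_mul _) fun z => ?_
  refine annularKernel_le_of_norm_sub_le hn h₀ h ?_
  rw [show z - c - (z - c') = -(c - c') by ring, norm_neg]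

theorem equivOutsideSmallSet_of_eq_integral
    (hF : ∀ r₀ r : ℝ, 0 < r₀ → r₀ ≤ r → F r - F r₀ = ∫ z, annularKernel r₀ r z ∂μ)
    (hG : ∀ r₀ r : ℝ, 0 < r₀ → r₀ ≤ r → G r - G r₀ = ∫ z, annularKernel r₀ r (z - c) ∂μ)
    (htop : Tendsto F atTop atTop) : EquivOutsideSmallSet G F := by
  have hF' : ∀ r₀ r : ℝ, 0 < r₀ → r₀ ≤ r →
      F r - F r₀ = ∫ z, annularKernel r₀ r (z - 0) ∂μ := by simpa using hF
  have h1 := isShiftDominated_of_eq_integral hF' hG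
  have h2 := isShiftDominated_of_eq_integral hG hF'
  rw [norm_sub_rev] at h2
  exact equivOutsideSmallSet_of_isShiftDominated (norm_nonneg _)
    (isLogConvexGrowth_of_eq_integral hF') h1 h2 htop

end measure

/-! ### Circle means as integrals over a probability space of angles -/

/-- The uniform probability measure on the angles `(0, 2π]`. -/
noncomputable def angleMeasure : Measure ℝ :=
  (ENNReal.ofReal (2 * Real.pi))⁻¹ • volume.restrict (Ioc 0 (2 * Real.pi))

instance : IsProbabilityMeasure angleMeasure := by
  constructor
  rw [angleMeasure, Measure.smul_apply, Measure.restrict_apply_univ, Real.volume_Ioc, sub_zero,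
    smul_eq_mul]
  exact ENNReal.inv_mul_cancel (by simpa using Real.pi_pos) ENNReal.ofReal_ne_top

theorem integral_angleMeasure (f : ℝ → ℝ) :
    ∫ θ, f θ ∂angleMeasure = (2 * Real.pi)⁻¹ * ∫ θ in (0 : ℝ)..2 * Real.pi, f θ := by
  rw [angleMeasure, integral_smul_measure, intervalIntegral.integral_of_le Real.two_pi_pos.le,
    ENNReal.toReal_inv, ENNReal.toReal_ofReal Real.two_pi_pos.le, smul_eq_mul]

theorem integrable_angleMeasure_iff (f : ℝ → ℝ) :
    Integrable f angleMeasure ↔ IntervalIntegrable f volume 0 (2 * Real.pi) := by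
  rw [angleMeasure, integrable_smul_measure (ENNReal.inv_ne_zero.2 ENNReal.ofReal_ne_top)
    (by simpa using Real.pi_pos),
    intervalIntegrable_iff_integrableOn_Ioc_of_le Real.two_pi_pos.le, IntegrableOn]

theorem circleAverage_eq_integral (f : ℂ → ℝ) (c : ℂ) (r : ℝ) :
    circleAverage f c r = ∫ θ, f (circleMap c r θ) ∂angleMeasure := by
  rw [integral_angleMeasure]; rfl

theorem circleIntegrable_iff_integrable {f : ℂ → ℝ} {c : ℂ} {r : ℝ} :
    CircleIntegrable f c r ↔ Integrable (fun θ => f (circleMap c r θ)) angleMeasure :=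
  (integrable_angleMeasure_iff _).symm

theorem ae_angleMeasure_iff {p : ℝ → Prop} :
    (∀ᵐ θ ∂angleMeasure, p θ) ↔ ∀ᵐ θ ∂volume.restrict (Ioc 0 (2 * Real.pi)), p θ := by
  rw [angleMeasure, Measure.ae_ennreal_smul_measure_iff (ENNReal.inv_ne_zero.2 ENNReal.ofReal_ne_top)]

theorem ae_circleMap_ne {r : ℝ} (hr : 0 < r) (c w : ℂ) :
    ∀ᵐ θ ∂angleMeasure, circleMap c r θ ≠ w := by
  rw [ae_angleMeasure_iff, ae_restrict_iff' measurableSet_Ioc]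
  have hs : {θ ∈ Ioc 0 (2 * Real.pi) | circleMap c r θ = w}.Subsingleton := by
    intro a ha b hb
    have := injOn_circleMap_of_abs_sub_le (c := c) hr.ne' (a := 0) (b := 2 * Real.pi) (by simp [abs_of_pos Real.pi_pos])
    rw [uIoc_of_le Real.two_pi_pos.le] at this
    exact this ha.1 hb.1 (ha.2.trans hb.2.symm)
  have h0 := hs.measure_zero (volume : Measure ℝ)
  filter_upwards [compl_mem_ae_iff.2 h0] with θ hθ hθ' h
  exact hθ ⟨hθ', h⟩

theorem circleMap_eq_add (c : ℂ) (r θ : ℝ) : circleMap c r θ = c + circleMap 0 r θ := by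
  simp [circleMap]

theorem norm_circleMap_zero_of_pos {r : ℝ} (hr : 0 < r) (θ : ℝ) : ‖circleMap 0 r θ‖ = r := by
  rw [norm_circleMap_zero, abs_of_pos hr]

theorem norm_circleMap_le {r : ℝ} (hr : 0 < r) (c : ℂ) (θ : ℝ) : ‖circleMap c r θ‖ ≤ ‖c‖ + r := by
  rw [circleMap_eq_add]
  exact (norm_add_le _ _).trans (by rw [norm_circleMap_zero_of_pos hr])

theorem continuous_circleMap_uncurry (r : ℝ) :
    Continuous fun p : ℂ × ℝ => circleMap p.1 r p.2 := by
  unfold circleMap; fun_prop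

/-! ### The logarithmic kernel -/

/-- `log⁺ (ρ / |z|)`, the mean of `log |z - ·|` over the circle of radius `ρ` minus its value at the
centre. -/
noncomputable def logKernel (ρ : ℝ) (z : ℂ) : ℝ := Real.posLog (ρ * ‖z‖⁻¹)

theorem logKernel_nonneg (ρ : ℝ) (z : ℂ) : 0 ≤ logKernel ρ z := Real.posLog_nonneg

theorem measurable_logKernel (ρ : ℝ) : Measurable (logKernel ρ) :=
  Real.continuous_posLog.measurable.comp (measurable_const.mul measurable_norm.inv)

theorem logKernel_of_le {ρ : ℝ} (hρ : 0 < ρ) {z : ℂ} (hz : ρ ≤ ‖z‖) : logKernel ρ z = 0 := by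
  have hz0 : 0 < ‖z‖ := hρ.trans_le hz
  rw [logKernel, Real.posLog_eq_zero_iff, abs_of_pos (by positivity), ← div_eq_mul_inv]
  exact (div_le_one hz0).2 hz

theorem logKernel_eq {ρ : ℝ} (hρ : 0 < ρ) {z : ℂ} (hz : z ≠ 0) :
    logKernel ρ z = Real.log (max ρ ‖z‖) - Real.log ‖z‖ := by
  have hz0 : 0 < ‖z‖ := norm_pos_iff.2 hz
  rcases le_total ρ ‖z‖ with h | h
  · rw [logKernel_of_le hρ h, max_eq_right h, sub_self]
  · rw [logKernel, Real.posLog_eq_log, max_eq_left h, ← div_eq_mul_inv,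
      Real.log_div hρ.ne' hz0.ne']
    rw [abs_of_pos (by positivity), ← div_eq_mul_inv]
    exact (one_le_div hz0).2 h

theorem logKernel_mono {ρ ρ' : ℝ} (hρ : 0 < ρ) (h : ρ ≤ ρ') (z : ℂ) :
    logKernel ρ z ≤ logKernel ρ' z :=
  Real.posLog_le_posLog (by positivity) (by gcongr)

theorem logKernel_radial (ρ : ℝ) {z w : ℂ} (h : ‖z‖ = ‖w‖) : logKernel ρ z = logKernel ρ w := by
  rw [logKernel, logKernel, h]

theorem circleAverage_log_norm {r : ℝ} (hr : 0 < r) (c : ℂ) :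
    circleAverage (fun z => Real.log ‖z‖) c r = Real.log (max r ‖c‖) := by
  have h := circleAverage_log_norm_sub_const_eq_log_radius_add_posLog (a := 0) (c := c) hr.ne'
  simp only [sub_zero] at h
  rw [h, Real.posLog_eq_log_max_one (by positivity), ← Real.log_mul hr.ne' (by positivity),
    mul_max_of_nonneg _ _ hr.le, mul_one, mul_inv_cancel_left₀ hr.ne']

theorem circleIntegrable_log_norm (c : ℂ) (r : ℝ) :
    CircleIntegrable (fun z => Real.log ‖z‖) c r := by
  simpa using circleIntegrable_log_norm_sub_const (a := 0) (c := c) r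

theorem circleIntegrable_of_continuous {f : ℂ → ℝ} (hf : Continuous f) (c : ℂ) (r : ℝ) :
    CircleIntegrable f c r :=
  (hf.comp (continuous_circleMap c r)).intervalIntegrable _ _

theorem continuous_log_max {r : ℝ} (hr : 0 < r) : Continuous fun z : ℂ => Real.log (max r ‖z‖) :=
  (continuous_const.max continuous_norm).log fun _ => (lt_max_of_lt_left hr).ne'

theorem logKernel_circleMap_ae {r ρ : ℝ} (hr : 0 < r) (hρ : 0 < ρ) (c : ℂ) :
    (fun θ => logKernel ρ (circleMap c r θ)) =ᵐ[angleMeasure]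
      fun θ => Real.log (max ρ ‖circleMap c r θ‖) - Real.log ‖circleMap c r θ‖ := by
  filter_upwards [ae_circleMap_ne hr c 0] with θ hθ
  exact logKernel_eq hρ hθ

theorem circleIntegrable_logKernel {r ρ : ℝ} (hr : 0 < r) (hρ : 0 < ρ) (c : ℂ) :
    CircleIntegrable (logKernel ρ) c r := by
  rw [circleIntegrable_iff_integrable, integrable_congr (logKernel_circleMap_ae hr hρ c)]
  exact (circleIntegrable_iff_integrable.1
    (circleIntegrable_of_continuous (continuous_log_max hρ) c r)).sub
    (circleIntegrable_iff_integrable.1 (circleIntegrable_log_norm c r))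

theorem circleAverage_logKernel {r ρ : ℝ} (hr : 0 < r) (hρ : 0 < ρ) (c : ℂ) :
    circleAverage (logKernel ρ) c r
      = circleAverage (fun z => Real.log (max ρ ‖z‖)) c r - Real.log (max r ‖c‖) := by
  rw [← circleAverage_log_norm hr, circleAverage_eq_integral, circleAverage_eq_integral,
    circleAverage_eq_integral, integral_congr_ae (logKernel_circleMap_ae hr hρ c)]
  exact integral_sub (circleIntegrable_iff_integrable.1
    (circleIntegrable_of_continuous (continuous_log_max hρ) c r))
    (circleIntegrable_iff_integrable.1 (circleIntegrable_log_norm c r))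

/-- Iterated means of `log |·|` commute. -/
theorem circleAverage_log_max_comm {r ρ : ℝ} (hr : 0 < r) (hρ : 0 < ρ) (c : ℂ) :
    circleAverage (fun z => Real.log (max ρ ‖z‖)) c r
      = circleAverage (fun z => Real.log (max r ‖z‖)) c ρ := by
  have hmeas : Measurable fun p : ℝ × ℝ =>
      Real.log ‖c + circleMap 0 r p.1 + circleMap 0 ρ p.2‖ := by
    have h1 : Continuous fun p : ℝ × ℝ => c + circleMap 0 r p.1 + circleMap 0 ρ p.2 := by
      unfold circleMap; fun_prop
    exact Real.measurable_log.comp h1.norm.measurable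
  have hslice : ∀ θ, Integrable
      (fun φ => Real.log ‖c + circleMap 0 r θ + circleMap 0 ρ φ‖) angleMeasure := fun θ => by
    have := circleIntegrable_iff_integrable.1 (circleIntegrable_log_norm (c + circleMap 0 r θ) ρ)
    simpa only [circleMap_eq_add (c + circleMap 0 r θ) ρ] using this
  have hval : ∀ θ, ∫ φ, Real.log ‖c + circleMap 0 r θ + circleMap 0 ρ φ‖ ∂angleMeasure
      = Real.log (max ρ ‖c + circleMap 0 r θ‖) := fun θ => by
    rw [← circleAverage_log_norm hρ, circleAverage_eq_integral]
    simp only [circleMap_eq_add (c + circleMap 0 r θ) ρ]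
  have hint : Integrable (fun p : ℝ × ℝ =>
      Real.log ‖c + circleMap 0 r p.1 + circleMap 0 ρ p.2‖) (angleMeasure.prod angleMeasure) := by
    rw [integrable_prod_iff hmeas.aestronglyMeasurable]
    refine ⟨ae_of_all _ hslice, ?_⟩
    -- Since the argument is at most M = |c| + r + ρ, |log x| ≤ 2 log⁺ M - log x, and the mean of
    -- log x over the inner circle is at least log ρ. So the inner integrals are bounded uniformly
    -- in θ and Fubini applies.
    have hb : ∀ θ, ∫ φ, ‖Real.log ‖c + circleMap 0 r θ + circleMap 0 ρ φ‖‖ ∂angleMeasure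
        ≤ 2 * Real.posLog (‖c‖ + r + ρ) - Real.log ρ := fun θ => by
      calc _ ≤ ∫ φ, (2 * Real.posLog (‖c‖ + r + ρ)
              - Real.log ‖c + circleMap 0 r θ + circleMap 0 ρ φ‖) ∂angleMeasure := by
            refine integral_mono (hslice θ).norm ((integrable_const _).sub (hslice θ)) fun φ => ?_
            have h1 : ‖c + circleMap 0 r θ + circleMap 0 ρ φ‖ ≤ ‖c‖ + r + ρ := by
              refine (norm_add₃_le).trans ?_
              rw [norm_circleMap_zero_of_pos hr, norm_circleMap_zero_of_pos hρ]
            have h2 := Real.posLog_le_posLog (norm_nonneg _) h1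
            have h3 : Real.log ‖c + circleMap 0 r θ + circleMap 0 ρ φ‖
              ≤ Real.posLog ‖c + circleMap 0 r θ + circleMap 0 ρ φ‖ := le_max_right _ _
            have h4 : 0 ≤ Real.posLog ‖c + circleMap 0 r θ + circleMap 0 ρ φ‖ :=
              Real.posLog_nonneg
            rw [Real.norm_eq_abs]
            exact abs_le.2 ⟨by linarith, by linarith⟩
        _ = 2 * Real.posLog (‖c‖ + r + ρ) - Real.log (max ρ ‖c + circleMap 0 r θ‖) := by
            rw [integral_sub (integrable_const _) (hslice θ), hval]; simp
        _ ≤ _ := by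
            have := Real.log_le_log hρ (le_max_left ρ ‖c + circleMap 0 r θ‖)
            linarith
    refine Integrable.of_bound (hmeas.norm.aestronglyMeasurable.integral_prod_right')
      (2 * Real.posLog (‖c‖ + r + ρ) - Real.log ρ) (ae_of_all _ fun θ => ?_)
    rw [Real.norm_of_nonneg (integral_nonneg fun _ => norm_nonneg _)]
    exact hb θ
  have hswap := integral_integral_swap (f := fun θ φ =>
      Real.log ‖c + circleMap 0 r θ + circleMap 0 ρ φ‖) hint
  have hval' : ∀ φ, ∫ θ, Real.log ‖c + circleMap 0 r θ + circleMap 0 ρ φ‖ ∂angleMeasure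
      = Real.log (max r ‖c + circleMap 0 ρ φ‖) := fun φ => by
    rw [← circleAverage_log_norm hr, circleAverage_eq_integral]
    simp only [circleMap_eq_add (c + circleMap 0 ρ φ) r]
    refine integral_congr_ae (ae_of_all _ fun θ => ?_)
    simp only
    rw [add_right_comm]
  simp only [hval, hval'] at hswap
  rw [circleAverage_eq_integral, circleAverage_eq_integral]
  simpa only [circleMap_eq_add c] using hswap

/-- The mean of the annular kernel in terms of means of the logarithmic kernel. -/
theorem circleAverage_annularKernel_sub {r₀ r ρ : ℝ} (h₀ : 0 < r₀) (hr : 0 < r) (hρ : 0 < ρ)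
    (z : ℂ) : circleAverage (annularKernel r₀ r) z ρ - annularKernel r₀ r z
      = circleAverage (logKernel ρ) z r - circleAverage (logKernel ρ) z r₀ := by
  rw [circleAverage_logKernel hr hρ, circleAverage_logKernel h₀ hρ,
    circleAverage_log_max_comm hr hρ, circleAverage_log_max_comm h₀ hρ]
  have : circleAverage (annularKernel r₀ r) z ρ
      = circleAverage (fun z => Real.log (max r ‖z‖)) z ρ
        - circleAverage (fun z => Real.log (max r₀ ‖z‖)) z ρ :=
    Real.circleAverage_fun_sub (circleIntegrable_of_continuous (continuous_log_max hr) _ _)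
      (circleIntegrable_of_continuous (continuous_log_max h₀) _ _)
  rw [this, annularKernel]; ring

theorem continuous_circleAverage {f : ℂ → ℝ} (hf : Continuous f) (r : ℝ) :
    Continuous fun z => circleAverage f z r := by
  simp only [circleAverage_eq_integral]
  have h1 : Continuous (Function.uncurry fun (z : ℂ) (θ : ℝ) => f (circleMap z r θ)) :=
    hf.comp (continuous_circleMap_uncurry r)
  have h2 := intervalIntegral.continuous_parametric_intervalIntegral_of_continuous' (μ := volume)
    h1 0 (2 * Real.pi)
  simp only [integral_angleMeasure]
  exact continuous_const.mul h2

theorem continuous_circleAverage_logKernel {r ρ : ℝ} (hr : 0 < r) (hρ : 0 < ρ) :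
    Continuous fun z => circleAverage (logKernel ρ) z r := by
  simp only [circleAverage_logKernel hr hρ]
  exact (continuous_circleAverage (continuous_log_max hρ) r).sub (continuous_log_max hr)

theorem circleAverage_eq_zero_of_norm {f : ℂ → ℝ} {R r : ℝ} (hr : 0 < r)
    (hf : ∀ z, R ≤ ‖z‖ → f z = 0) {z : ℂ} (hz : R + r ≤ ‖z‖) : circleAverage f z r = 0 := by
  rw [circleAverage_eq_integral]
  have : ∀ θ, f (circleMap z r θ) = 0 := fun θ => hf _ (by
    rw [circleMap_eq_add]
    have := norm_sub_norm_le z (-circleMap 0 r θ)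
    rw [sub_neg_eq_add, norm_neg, norm_circleMap_zero_of_pos hr] at this
    linarith)
  simp [this]

theorem hasCompactSupport_circleAverage_logKernel {r ρ : ℝ} (hr : 0 < r) (hρ : 0 < ρ) :
    HasCompactSupport fun z => circleAverage (logKernel ρ) z r :=
  HasCompactSupport.intro (isCompact_closedBall 0 (ρ + r)) fun z hz =>
    circleAverage_eq_zero_of_norm hr (fun w hw => logKernel_of_le hρ hw)
      (by simpa using (not_le.1 (by simpa using hz)).le)

theorem integrableOn_mul_posLog {ρ : ℝ} (hρ : 0 < ρ) :
    IntegrableOn (fun y : ℝ => y * Real.posLog (ρ * y⁻¹)) (Ioi 0) ∧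
      ∫ y in Ioi (0 : ℝ), y * Real.posLog (ρ * y⁻¹) = ρ ^ 2 / 4 := by
  have h1 : ∀ y ∈ Ioc 0 ρ, y * Real.posLog (ρ * y⁻¹) = y * Real.log ρ - y * Real.log y := by
    intro y hy
    have := logKernel_eq hρ (z := (y : ℂ)) (by exact_mod_cast hy.1.ne')
    rw [logKernel, Complex.norm_real, Real.norm_of_nonneg hy.1.le, max_eq_left hy.2] at this
    rw [this]; ring
  have h2 : ∀ y ∈ Ioi ρ, y * Real.posLog (ρ * y⁻¹) = 0 := by
    intro y hy
    have hy0 : 0 < y := hρ.trans hy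
    have := logKernel_of_le hρ (z := (y : ℂ))
      (by rw [Complex.norm_real, Real.norm_of_nonneg hy0.le]; exact le_of_lt hy)
    rw [logKernel, Complex.norm_real, Real.norm_of_nonneg hy0.le] at this
    rw [this, mul_zero]
  have hc : Continuous fun y : ℝ => y * Real.log ρ - y * Real.log y :=
    (continuous_id.mul continuous_const).sub Real.continuous_mul_log
  have hu : Ioi (0 : ℝ) = Ioc 0 ρ ∪ Ioi ρ := (Ioc_union_Ioi_eq_Ioi hρ.le).symm
  have i1 : IntegrableOn (fun y : ℝ => y * Real.posLog (ρ * y⁻¹)) (Ioc 0 ρ) :=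
    (integrableOn_congr_fun h1 measurableSet_Ioc).2 (hc.integrableOn_Ioc)
  have i2 : IntegrableOn (fun y : ℝ => y * Real.posLog (ρ * y⁻¹)) (Ioi ρ) :=
    (integrableOn_congr_fun h2 measurableSet_Ioi).2 integrableOn_zero
  refine ⟨hu ▸ i1.union i2, ?_⟩
  rw [hu, setIntegral_union (Ioc_disjoint_Ioi le_rfl) measurableSet_Ioi i1 i2,
    setIntegral_congr_fun measurableSet_Ioc h1, setIntegral_congr_fun measurableSet_Ioi h2,
    integral_zero, add_zero, ← intervalIntegral.integral_of_le hρ.le]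
  -- The antiderivative is written through y log y, which is continuous at 0, so the fundamental
  -- theorem of calculus covers the endpoint.
  have hd : ∀ y ∈ Ioo 0 ρ, HasDerivAt
      (fun y : ℝ => y ^ 2 / 2 * Real.log ρ - y * (y * Real.log y) / 2 + y ^ 2 / 4)
      (y * Real.log ρ - y * Real.log y) y := by
    intro y hy
    have hy0 : y ≠ 0 := hy.1.ne'
    have d1 := ((hasDerivAt_pow 2 y).div_const 2).mul_const (Real.log ρ)
    have d2 := ((hasDerivAt_id y).mul ((hasDerivAt_id y).mul (Real.hasDerivAt_log hy0))).div_const 2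
    have d3 := (hasDerivAt_pow 2 y).div_const 4
    refine ((d1.sub d2).add d3).congr_deriv ?_
    simp only [id, Pi.mul_apply]
    field_simp
    ring
  have hcont : ContinuousOn
      (fun y : ℝ => y ^ 2 / 2 * Real.log ρ - y * (y * Real.log y) / 2 + y ^ 2 / 4) (Icc 0 ρ) := by
    have := Real.continuous_mul_log
    exact Continuous.continuousOn (by fun_prop)
  rw [intervalIntegral.integral_eq_sub_of_hasDerivAt_of_le hρ.le hcont hd
    (hc.intervalIntegrable _ _)]
  ring

theorem integrable_logKernel {ρ : ℝ} (hρ : 0 < ρ) : Integrable (logKernel ρ) volume := by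
  have := (integrable_fun_norm_addHaar (volume : Measure ℂ)
    (f := fun y : ℝ => Real.posLog (ρ * y⁻¹))).2 (by
      simpa [Complex.finrank_real_complex] using (integrableOn_mul_posLog hρ).1)
  exact this

/-- This total mass makes 2/(πρ²) times the kernel a probability density, the mollifier used for
means of subharmonic functions. -/
theorem integral_logKernel {ρ : ℝ} (hρ : 0 < ρ) :
    ∫ z, logKernel ρ z = Real.pi * ρ ^ 2 / 2 := by
  have := integral_fun_norm_addHaar (volume : Measure ℂ)
    (fun y : ℝ => Real.posLog (ρ * y⁻¹))
  simp only [Complex.finrank_real_complex, smul_eq_mul, Nat.add_one_sub_one, pow_one,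
    (integrableOn_mul_posLog hρ).2] at this
  have hb : (volume : Measure ℂ).real (Metric.ball 0 1) = Real.pi := by
    simp [Measure.real]
  rw [hb] at this
  simp only [logKernel]
  rw [this, nsmul_eq_mul]
  push_cast
  ring

/-! ### Functions with subharmonic means -/

/-- At `z` the function `v` is at most its mean over every circle around `z`, and it is the limit of
these means. -/
def IsMeanPoint (v : ℂ → ℝ) (z : ℂ) : Prop :=
  (∀ t : ℝ, 0 < t → v z ≤ circleAverage v z t) ∧
    Tendsto (circleAverage v z) (𝓝[>] 0) (𝓝 (v z))

/-- The properties of the (real values of a) subharmonic function on which its Riesz measure rests. -/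
structure HasSubharmonicMeans (v : ℂ → ℝ) : Prop where
  measurable : Measurable v
  locallyIntegrable : LocallyIntegrable v volume
  circleIntegrable : ∀ c : ℂ, ∀ r : ℝ, 0 < r → CircleIntegrable v c r
  exists_le : ∀ R : ℝ, ∃ C, ∀ z, ‖z‖ ≤ R → v z ≤ C
  ae_isMeanPoint : ∀ᵐ z, IsMeanPoint v z
  ae_isMeanPoint_circleMap : ∀ c : ℂ, ∀ r : ℝ, 0 < r →
    ∀ᵐ θ ∂angleMeasure, IsMeanPoint v (circleMap c r θ)

theorem integrable_circle {v : ℂ → ℝ} (hv : HasSubharmonicMeans v) (c : ℂ) {r : ℝ} (hr : 0 < r) :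
    Integrable (fun θ => v (circleMap c r θ)) angleMeasure :=
  circleIntegrable_iff_integrable.1 (hv.circleIntegrable c r hr)

theorem circleAverage_eq_integral_add_angle (f : ℂ → ℝ) (c : ℂ) (r η : ℝ) :
    circleAverage f c r = ∫ θ, f (circleMap c r (θ + η)) ∂angleMeasure := by
  rw [Real.circleAverage_eq_integral_add η, integral_angleMeasure, smul_eq_mul]

theorem circleMap_add_arg (a z : ℂ) (θ : ℝ) :
    circleMap a ‖z‖ (θ + z.arg) = a + rotation (Circle.exp θ) z := by
  have h : rotation (Circle.exp θ) z = Complex.exp (θ * Complex.I) * z := by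
    simp [rotation_apply, Circle.coe_exp]
  rw [circleMap, h]
  conv_rhs => rw [← Complex.norm_mul_exp_arg_mul_I z]
  push_cast
  rw [add_mul, Complex.exp_add]
  ring

/-- Integrals against radial functions are integrals of circle means. -/
theorem integral_radial_mul {k v : ℂ → ℝ} (hk : Measurable k) (hv : Measurable v)
    (hrad : ∀ z w : ℂ, ‖z‖ = ‖w‖ → k z = k w) {a : ℂ}
    (hint : Integrable fun z => k z * v (a + z)) :
    Integrable (fun z => k z * circleAverage v a ‖z‖) ∧
      ∫ z, k z * v (a + z) = ∫ z, k z * circleAverage v a ‖z‖ := by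
  have hinv : ∀ θ z, k z * v (a + rotation (Circle.exp θ) z)
      = (fun z => k z * v (a + z)) (rotation (Circle.exp θ) z) := fun θ z => by
    simp only
    rw [hrad (rotation (Circle.exp θ) z) z (LinearIsometryEquiv.norm_map _ _)]
  have hmp : ∀ θ, MeasurePreserving (rotation (Circle.exp θ)) volume volume := fun θ =>
    (rotation (Circle.exp θ)).measurePreserving
  have hme : ∀ θ, MeasurableEmbedding (rotation (Circle.exp θ)) := fun θ =>
    (rotation (Circle.exp θ)).toHomeomorph.measurableEmbedding
  have hcont : Continuous fun p : ℝ × ℂ => a + rotation (Circle.exp p.1) p.2 := by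
    simp only [rotation_apply]
    fun_prop
  -- In place of polar coordinates, the integral is averaged over all rotations of the plane; each
  -- preserves area and the radial weight k, and the average over angles of v(a + ·) is a circle
  -- mean.
  have hmeas : Measurable fun p : ℝ × ℂ => k p.2 * v (a + rotation (Circle.exp p.1) p.2) :=
    (hk.comp measurable_snd).mul (hv.comp hcont.measurable)
  have hslice : ∀ θ, Integrable fun z => k z * v (a + rotation (Circle.exp θ) z) := fun θ => by
    simp only [hinv]
    exact ((hmp θ).integrable_comp_emb (hme θ)).2 hint
  have hprod : Integrable (fun p : ℝ × ℂ => k p.2 * v (a + rotation (Circle.exp p.1) p.2))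
      (angleMeasure.prod volume) := by
    rw [integrable_prod_iff hmeas.aestronglyMeasurable]
    refine ⟨ae_of_all _ hslice, ?_⟩
    have : ∀ θ, ∫ z, ‖k z * v (a + rotation (Circle.exp θ) z)‖ = ∫ z, ‖k z * v (a + z)‖ :=
      fun θ => by
        simp only [hinv]
        exact (hmp θ).integral_comp (hme θ) (fun z => ‖k z * v (a + z)‖)
    simp only [this]
    exact integrable_const _
  have hinner : ∀ z, ∫ θ, k z * v (a + rotation (Circle.exp θ) z) ∂angleMeasure
      = k z * circleAverage v a ‖z‖ := fun z => by
    rw [integral_const_mul, circleAverage_eq_integral_add_angle v a ‖z‖ z.arg]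
    simp only [circleMap_add_arg]
  refine ⟨by simpa only [hinner] using hprod.integral_prod_right, ?_⟩
  have hswap := integral_integral_swap
    (f := fun (θ : ℝ) (z : ℂ) => k z * v (a + rotation (Circle.exp θ) z)) hprod
  simp only [hinner] at hswap
  rw [← hswap]
  have : ∀ θ, ∫ z, k z * v (a + rotation (Circle.exp θ) z) = ∫ z, k z * v (a + z) := fun θ => by
    simp only [hinv]
    exact (hmp θ).integral_comp (hme θ) (fun z => k z * v (a + z))
  simp only [this, integral_const, probReal_univ, one_smul]

/-! ### Mollification by the logarithmic kernel -/

section mollify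

variable {v : ℂ → ℝ} {ζ : ℂ}

theorem integrable_logKernel_mul (hv : Measurable v)
    (h1 : Integrable fun x => logKernel 1 x * v (ζ + x)) {ρ : ℝ} (hρ : 0 < ρ) (hρ1 : ρ ≤ 1) :
    Integrable fun x => logKernel ρ x * v (ζ + x) := by
  refine h1.mono ((measurable_logKernel ρ).mul
    (hv.comp (measurable_const.add measurable_id))).aestronglyMeasurable (ae_of_all _ fun x => ?_)
  rw [norm_mul, norm_mul, Real.norm_of_nonneg (logKernel_nonneg _ _),
    Real.norm_of_nonneg (logKernel_nonneg _ _)]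
  exact mul_le_mul_of_nonneg_right (logKernel_mono hρ hρ1 x) (norm_nonneg _)

/-- The mollified value is a weighted average of circle means about ζ, each at least v(ζ). This
lower bound, with a constant upper bound, supplies the domination needed for ρ → 0. -/
theorem le_integral_logKernel_mul (hv : Measurable v) (hζ : IsMeanPoint v ζ) {ρ : ℝ} (hρ : 0 < ρ)
    (h1 : Integrable fun x => logKernel ρ x * v (ζ + x)) :
    v ζ ≤ 2 / (Real.pi * ρ ^ 2) * ∫ x, logKernel ρ x * v (ζ + x) := by
  obtain ⟨hi, he⟩ := integral_radial_mul (measurable_logKernel ρ) hv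
    (fun z w h => logKernel_radial ρ h) h1
  have hpi := Real.pi_pos
  have h2 : ∫ x, logKernel ρ x * v ζ ≤ ∫ x, logKernel ρ x * circleAverage v ζ ‖x‖ := by
    refine integral_mono_ae ((integrable_logKernel hρ).mul_const _) hi ?_
    filter_upwards [compl_mem_ae_iff.2 (measure_singleton (μ := (volume : Measure ℂ)) 0)] with x hx
    exact mul_le_mul_of_nonneg_left (hζ.1 _ (norm_pos_iff.2 hx)) (logKernel_nonneg _ _)
  rw [integral_mul_const, integral_logKernel hρ, ← he] at h2
  rw [div_mul_eq_mul_div, le_div_iff₀ (by positivity)]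
  linarith

theorem integral_logKernel_mul_le {ρ C : ℝ} (hρ : 0 < ρ) (hC : ∀ x, ‖x‖ ≤ ρ → v (ζ + x) ≤ C)
    (h1 : Integrable fun x => logKernel ρ x * v (ζ + x)) :
    2 / (Real.pi * ρ ^ 2) * ∫ x, logKernel ρ x * v (ζ + x) ≤ C := by
  have hpi := Real.pi_pos
  have h2 : ∫ x, logKernel ρ x * v (ζ + x) ≤ ∫ x, logKernel ρ x * C := by
    refine integral_mono h1 ((integrable_logKernel hρ).mul_const _) fun x => ?_
    rcases le_total ‖x‖ ρ with h | h
    · exact mul_le_mul_of_nonneg_left (hC x h) (logKernel_nonneg _ _)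
    · simp [logKernel_of_le hρ h]
  rw [integral_mul_const, integral_logKernel hρ] at h2
  rw [div_mul_eq_mul_div, div_le_iff₀ (by positivity)]
  linarith

theorem tendsto_integral_logKernel_mul (hv : Measurable v) (hζ : IsMeanPoint v ζ)
    (h1 : Integrable fun x => logKernel 1 x * v (ζ + x)) :
    Tendsto (fun ρ => 2 / (Real.pi * ρ ^ 2) * ∫ x, logKernel ρ x * v (ζ + x)) (𝓝[>] 0)
      (𝓝 (v ζ)) := by
  have hpi := Real.pi_pos
  refine tendsto_order.2 ⟨fun b hb => ?_, fun b hb => ?_⟩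
  · filter_upwards [Ioc_mem_nhdsGT (zero_lt_one (α := ℝ))] with ρ hρ
    exact hb.trans_le (le_integral_logKernel_mul hv hζ hρ.1
      (integrable_logKernel_mul hv h1 hρ.1 hρ.2))
  · obtain ⟨b', hb', hb'b⟩ := exists_between hb
    obtain ⟨δ, hδ, hδb⟩ := mem_nhdsGT_iff_exists_Ioo_subset.1 ((tendsto_order.1 hζ.2).2 b' hb')
    filter_upwards [Ioc_mem_nhdsGT (zero_lt_one (α := ℝ)), Ioo_mem_nhdsGT hδ] with ρ hρ hρδ
    have hρ0 := hρ.1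
    refine lt_of_le_of_lt ?_ hb'b
    obtain ⟨hi, he⟩ := integral_radial_mul (measurable_logKernel ρ) hv
      (fun z w h => logKernel_radial ρ h) (integrable_logKernel_mul hv h1 hρ.1 hρ.2)
    have h2 : ∫ x, logKernel ρ x * circleAverage v ζ ‖x‖ ≤ ∫ x, logKernel ρ x * b' := by
      refine integral_mono_ae hi ((integrable_logKernel hρ.1).mul_const _) ?_
      filter_upwards [compl_mem_ae_iff.2 (measure_singleton (μ := (volume : Measure ℂ)) 0)]
        with x hx
      rcases le_or_gt ρ ‖x‖ with h | h
      · simp [logKernel_of_le hρ.1 h]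
      · exact mul_le_mul_of_nonneg_left (le_of_lt (hδb ⟨norm_pos_iff.2 hx, h.trans hρδ.2⟩))
          (logKernel_nonneg _ _)
    rw [integral_mul_const, integral_logKernel hρ.1, ← he] at h2
    rw [div_mul_eq_mul_div, div_le_iff₀ (by positivity)]
    linarith

end mollify

/-! ### Convolutions and circle means -/

theorem circleAverage_comp_sub_left (f : ℂ → ℝ) (c z : ℂ) (ρ : ℝ) :
    circleAverage (fun x => f (c - x)) z ρ = circleAverage f (c - z) ρ := by
  rw [← Real.circleAverage_neg_radius, circleAverage_eq_integral, circleAverage_eq_integral]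
  congr 1
  ext θ
  simp only [circleMap]
  push_cast
  congr 1
  ring

theorem circleMap_sub_add (c z : ℂ) (r θ : ℝ) :
    circleMap (c - (circleMap c r θ + z)) r θ = -z := by
  simp [circleMap]; ring

/-- Fubini for the mean over a circle of a convolution. -/
theorem integral_convolution_circle {k v : ℂ → ℝ} (hk : Measurable k) (hv : Measurable v) {r : ℝ}
    (hkc : ∀ x, CircleIntegrable k x r) (c : ℂ)
    (hkv : Integrable fun z => circleAverage (fun x => ‖k x‖) (c - z) r * ‖v z‖) :
    Integrable (fun p : ℝ × ℂ => k (-p.2) * v (circleMap c r p.1 + p.2))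
        (angleMeasure.prod volume) ∧
      ∫ θ, (∫ x, k (-x) * v (circleMap c r θ + x)) ∂angleMeasure
        = ∫ z, circleAverage k (c - z) r * v z := by
  have hcont : Continuous fun p : ℝ × ℂ => circleMap (c - p.2) r p.1 := by
    unfold circleMap; fun_prop
  have hmeas : Measurable fun p : ℝ × ℂ => k (circleMap (c - p.2) r p.1) * v p.2 :=
    (hk.comp hcont.measurable).mul (hv.comp measurable_snd)
  have hprod : Integrable (fun p : ℝ × ℂ => k (circleMap (c - p.2) r p.1) * v p.2)
      (angleMeasure.prod volume) := by
    rw [integrable_prod_iff' hmeas.aestronglyMeasurable]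
    refine ⟨ae_of_all _ fun z =>
      by
        have := (circleIntegrable_iff_integrable.1 (hkc (c - z))).mul_const (v z)
        exact this, ?_⟩
    refine hkv.congr (ae_of_all _ fun z => ?_)
    simp only [norm_mul]
    rw [integral_mul_const, circleAverage_eq_integral]
  -- Translating the plane variable by the point of the circle at angle θ is a measure-preserving
  -- shear of the product space; it exchanges the two forms of the integrand.
  have hshear : MeasurePreserving (fun p : ℝ × ℂ => (p.1, circleMap c r p.1 + p.2))
      (angleMeasure.prod volume) (angleMeasure.prod volume) := by
    refine (MeasurePreserving.id angleMeasure).skew_product (g := fun θ x => circleMap c r θ + x)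
      ?_ (ae_of_all _ fun θ => (measurePreserving_add_left volume _).map_eq)
    have : Continuous fun p : ℝ × ℂ => circleMap c r p.1 + p.2 := by
      unfold circleMap; fun_prop
    exact this.measurable
  have hcomp : ∀ p : ℝ × ℂ, k (-p.2) * v (circleMap c r p.1 + p.2)
      = (fun p : ℝ × ℂ => k (circleMap (c - p.2) r p.1) * v p.2)
        (p.1, circleMap c r p.1 + p.2) := fun p => by
    simp only [circleMap_sub_add]
  have hG : Integrable (fun p : ℝ × ℂ => k (-p.2) * v (circleMap c r p.1 + p.2))
      (angleMeasure.prod volume) := by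
    simp only [hcomp]
    exact hshear.integrable_comp_of_integrable hprod
  refine ⟨hG, ?_⟩
  have h1 : ∀ θ, ∫ x, k (-x) * v (circleMap c r θ + x) = ∫ z, k (circleMap (c - z) r θ) * v z :=
    fun θ => by
      rw [← integral_add_left_eq_self (fun z => k (circleMap (c - z) r θ) * v z)
        (circleMap c r θ)]
      simp only [circleMap_sub_add]
  simp only [h1]
  rw [integral_integral_swap (f := fun (θ : ℝ) (z : ℂ) => k (circleMap (c - z) r θ) * v z) hprod]
  simp only [integral_mul_const, circleAverage_eq_integral]

theorem integrable_mul_norm_of_hasCompactSupport {v g : ℂ → ℝ} (hv : LocallyIntegrable v volume)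
    (hg : Continuous g) (hgs : HasCompactSupport g) : Integrable fun z => g z * ‖v z‖ :=
  LocallyIntegrable.integrable_smul_left_of_hasCompactSupport (fun x => (hv x).norm) hg hgs

theorem hasCompactSupport_circleAverage {f : ℂ → ℝ} (hf : HasCompactSupport f) {r : ℝ}
    (hr : 0 < r) : HasCompactSupport fun z => circleAverage f z r := by
  obtain ⟨R, hR⟩ := hf.isBounded.subset_closedBall 0
  refine HasCompactSupport.intro (isCompact_closedBall 0 (R + 1 + r)) fun z hz => ?_
  refine circleAverage_eq_zero_of_norm hr (R := R + 1) (fun w hw => ?_)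
    (by simpa using (not_le.1 (by simpa using hz)).le)
  by_contra hne
  have := hR (subset_tsupport f hne)
  rw [mem_closedBall_zero_iff] at this
  linarith

/-- Averaging over circles is self-adjoint. -/
theorem integral_mul_circleAverage {v Φ : ℂ → ℝ} (hvm : Measurable v)
    (hv : LocallyIntegrable v volume) (hΦ : Continuous Φ) (hΦs : HasCompactSupport Φ) {ρ : ℝ}
    (hρ : 0 < ρ) :
    Integrable (fun z => Φ z * circleAverage v z ρ) ∧
      ∫ z, Φ z * circleAverage v z ρ = ∫ z, circleAverage Φ z ρ * v z := by
  have hk : Continuous fun x => Φ (-x) := hΦ.comp continuous_neg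
  have hks : HasCompactSupport fun x => Φ (-x) := hΦs.comp_homeomorph (Homeomorph.neg ℂ)
  obtain ⟨h1, h2⟩ := integral_convolution_circle hk.measurable hvm
    (fun x => circleIntegrable_of_continuous hk x ρ) 0
    (integrable_mul_norm_of_hasCompactSupport hv
      ((continuous_circleAverage hk.norm ρ).comp (continuous_const.sub continuous_id))
      ((hasCompactSupport_circleAverage hks.norm hρ).comp_homeomorph (Homeomorph.subLeft 0)))
  simp only [neg_neg] at h1 h2
  have h3 : ∀ x, ∫ θ, Φ x * v (circleMap 0 ρ θ + x) ∂angleMeasure = Φ x * circleAverage v x ρ :=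
    fun x => by
      rw [integral_const_mul, circleAverage_eq_integral]
      simp only [circleMap_eq_add x, add_comm x]
  refine ⟨by simpa only [h3] using h1.integral_prod_right, ?_⟩
  rw [integral_integral_swap (f := fun (θ : ℝ) (x : ℂ) => Φ x * v (circleMap 0 ρ θ + x)) h1] at h2
  simp only [h3] at h2
  rw [h2]
  congr 1
  ext z
  have := circleAverage_comp_sub_left Φ 0 (0 - z) ρ
  simp only [zero_sub, neg_neg] at this
  rw [zero_sub, this]

/-- The pole of the kernel is smoothed by averaging over a circle: the averaged kernel is continuous
with compact support, so it is integrable against the locally integrable v. -/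
theorem integrable_logKernel_convolution {v : ℂ → ℝ} (hv : HasSubharmonicMeans v) (c : ℂ)
    {r ρ : ℝ} (hr : 0 < r) (hρ : 0 < ρ) :
    Integrable (fun p : ℝ × ℂ => logKernel ρ p.2 * v (circleMap c r p.1 + p.2))
        (angleMeasure.prod volume) ∧
      ∫ θ, (∫ x, logKernel ρ x * v (circleMap c r θ + x)) ∂angleMeasure
        = ∫ z, circleAverage (logKernel ρ) (c - z) r * v z := by
  have h := integral_convolution_circle (measurable_logKernel ρ) hv.measurable
    (fun x => circleIntegrable_logKernel hr hρ x) c (by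
      simp only [Real.norm_of_nonneg (logKernel_nonneg _ _)]
      exact integrable_mul_norm_of_hasCompactSupport hv.locallyIntegrable
        ((continuous_circleAverage_logKernel hr hρ).comp (continuous_const.sub continuous_id))
        ((hasCompactSupport_circleAverage_logKernel hr hρ).comp_homeomorph
          (Homeomorph.subLeft c)))
  have he : ∀ x, logKernel ρ (-x) = logKernel ρ x := fun x => logKernel_radial ρ (norm_neg x)
  simpa only [he] using h

/-- By Fubini the integral is the mean over the circle of mollifications of v. At almost every point
of the circle these lie between v and a constant and tend to v, so dominated convergence applies. -/
theorem tendsto_circle_integral_logKernel {v : ℂ → ℝ} (hv : HasSubharmonicMeans v) (c : ℂ) {r : ℝ}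
    (hr : 0 < r) :
    Tendsto (fun ρ => 2 / (Real.pi * ρ ^ 2) *
        ∫ z, circleAverage (logKernel ρ) (c - z) r * v z) (𝓝[>] 0)
      (𝓝 (circleAverage v c r)) := by
  have hmem : ∀ᶠ ρ : ℝ in 𝓝[>] 0, ρ ∈ Ioc (0 : ℝ) 1 := Ioc_mem_nhdsGT zero_lt_one
  have h1 : ∀ᵐ θ ∂angleMeasure,
      Integrable fun x => logKernel 1 x * v (circleMap c r θ + x) :=
    (integrable_logKernel_convolution hv c hr one_pos).1.prod_right_ae
  obtain ⟨C, hC⟩ := hv.exists_le (‖c‖ + r + 1)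
  have hCle : ∀ θ x, ‖x‖ ≤ 1 → v (circleMap c r θ + x) ≤ C := fun θ x hx => hC _ (by
    refine (norm_add_le _ _).trans ?_
    linarith [norm_circleMap_le hr c θ])
  rw [circleAverage_eq_integral]
  have key : Tendsto (fun ρ => ∫ θ, (2 / (Real.pi * ρ ^ 2) *
      ∫ x, logKernel ρ x * v (circleMap c r θ + x)) ∂angleMeasure) (𝓝[>] 0)
      (𝓝 (∫ θ, v (circleMap c r θ) ∂angleMeasure)) := by
    refine tendsto_integral_filter_of_dominated_convergence
      (fun θ => |v (circleMap c r θ)| + |C|) ?_ ?_ ?_ ?_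
    · filter_upwards [hmem] with ρ hρ
      exact ((integrable_logKernel_convolution hv c hr hρ.1).1.integral_prod_left.const_mul
        _).aestronglyMeasurable
    · filter_upwards [hmem] with ρ hρ
      filter_upwards [h1, hv.ae_isMeanPoint_circleMap c r hr] with θ hθ1 hθ2
      have hi := integrable_logKernel_mul hv.measurable hθ1 hρ.1 hρ.2
      have l1 := le_integral_logKernel_mul hv.measurable hθ2 hρ.1 hi
      have l2 := integral_logKernel_mul_le hρ.1 (fun x hx => hCle θ x (hx.trans hρ.2)) hi
      rw [Real.norm_eq_abs]
      refine abs_le.2 ⟨?_, ?_⟩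
      · linarith [neg_abs_le (v (circleMap c r θ)), abs_nonneg C]
      · linarith [le_abs_self C, abs_nonneg (v (circleMap c r θ))]
    · exact (integrable_circle hv c hr).abs.add (integrable_const _)
    · filter_upwards [h1, hv.ae_isMeanPoint_circleMap c r hr] with θ hθ1 hθ2
      exact tendsto_integral_logKernel_mul hv.measurable hθ2 hθ1
  refine key.congr' ?_
  filter_upwards [hmem] with ρ hρ
  rw [integral_const_mul, (integrable_logKernel_convolution hv c hr hρ.1).2]

theorem integrable_mul_of_hasCompactSupport {v g : ℂ → ℝ} (hv : LocallyIntegrable v volume)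
    (hg : Continuous g) (hgs : HasCompactSupport g) : Integrable fun z => g z * v z :=
  hv.integrable_smul_left_of_hasCompactSupport hg hgs

theorem integral_mul_circleAverage_sub {v Φ : ℂ → ℝ} (hv : HasSubharmonicMeans v)
    (hΦ : Continuous Φ) (hΦs : HasCompactSupport Φ) {ρ : ℝ} (hρ : 0 < ρ) :
    Integrable (fun z => Φ z * (circleAverage v z ρ - v z)) ∧
    ∫ z, Φ z * (circleAverage v z ρ - v z) = ∫ z, (circleAverage Φ z ρ - Φ z) * v z := by
  obtain ⟨h1, h2⟩ := integral_mul_circleAverage hv.measurable hv.locallyIntegrable hΦ hΦs hρ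
  have h3 := integrable_mul_of_hasCompactSupport hv.locallyIntegrable hΦ hΦs
  have h4 := integrable_mul_of_hasCompactSupport hv.locallyIntegrable
    (continuous_circleAverage hΦ ρ) (hasCompactSupport_circleAverage hΦs hρ)
  simp only [mul_sub, sub_mul]
  exact ⟨h1.sub h3, by rw [integral_sub h1 h3, integral_sub h4 h3, h2]⟩

/-- The weak form of Jensen's formula. -/
theorem tendsto_integral_annularKernel {v : ℂ → ℝ} (hv : HasSubharmonicMeans v) (c : ℂ)
    {r₀ r : ℝ} (h₀ : 0 < r₀) (h : r₀ ≤ r) :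
    Tendsto (fun ρ => 2 / (Real.pi * ρ ^ 2) *
        ∫ z, annularKernel r₀ r (z - c) * (circleAverage v z ρ - v z)) (𝓝[>] 0)
      (𝓝 (circleAverage v c r - circleAverage v c r₀)) := by
  have hr := h₀.trans_le h
  refine ((tendsto_circle_integral_logKernel hv c hr).sub
    (tendsto_circle_integral_logKernel hv c h₀)).congr' ?_
  filter_upwards [eventually_mem_nhdsWithin] with ρ (hρ : 0 < ρ)
  -- Self-adjointness moves A_ρ - 1 from v to the annular kernel. By the commutation of iterated
  -- means it becomes a difference of circle means of the logarithmic kernel at the radii r and r₀,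
  -- both of which have known limits.
  rw [(integral_mul_circleAverage_sub hv (continuous_annularKernel_sub h₀ hr c)
    (hasCompactSupport_annularKernel_sub h c) hρ).2, ← mul_sub]
  have hi : ∀ t, 0 < t → Integrable fun z => circleAverage (logKernel ρ) (c - z) t * v z :=
    fun t ht => integrable_mul_of_hasCompactSupport hv.locallyIntegrable
      ((continuous_circleAverage_logKernel ht hρ).comp (continuous_const.sub continuous_id))
      ((hasCompactSupport_circleAverage_logKernel ht hρ).comp_homeomorph (Homeomorph.subLeft c))
  rw [← integral_sub (hi r hr) (hi r₀ h₀)]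
  congr 2
  ext z
  rw [← sub_mul, ← circleAverage_annularKernel_sub h₀ hr hρ]
  have e : ∀ x, annularKernel r₀ r (x - c) = annularKernel r₀ r (c - x) := fun x => by
    simp only [annularKernel, norm_sub_rev]
  simp only [e]
  rw [circleAverage_comp_sub_left]

/-! ### Means of subharmonic functions -/

theorem setIntegral_ball_eq {v : ℂ → ℝ} (hv : Measurable v) {a : ℂ} {R : ℝ}
    (hint : IntegrableOn v (Metric.ball a R)) :
    IntegrableOn (fun z : ℂ => circleAverage v a ‖z‖) (Metric.ball 0 R) ∧
      ∫ z in Metric.ball a R, v z = ∫ z in Metric.ball (0 : ℂ) R, circleAverage v a ‖z‖ := by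
  set k : ℂ → ℝ := (Metric.ball (0 : ℂ) R).indicator 1 with hk
  have hkm : Measurable k := measurable_one.indicator Metric.isOpen_ball.measurableSet
  have hrad : ∀ z w : ℂ, ‖z‖ = ‖w‖ → k z = k w := fun z w h => by
    simp [hk, indicator, h]
  have h1 : ∀ g : ℂ → ℝ, (fun z => k z * g z) = (Metric.ball (0 : ℂ) R).indicator g := fun g => by
    ext z; by_cases hz : z ∈ Metric.ball (0 : ℂ) R <;> simp [hk, hz]
  have h2 : ((Metric.ball (0 : ℂ) R).indicator fun z => v (a + z))
      = fun z => (Metric.ball a R).indicator v (a + z) := by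
    ext z
    by_cases hz : ‖z‖ < R <;> simp [indicator, hz]
  have hi : Integrable fun z => k z * v (a + z) := by
    rw [h1, h2]
    exact ((integrable_indicator_iff Metric.isOpen_ball.measurableSet).2 hint).comp_add_left a
  obtain ⟨h3, h4⟩ := integral_radial_mul hkm hv hrad hi
  rw [h1] at h3
  refine ⟨(integrable_indicator_iff Metric.isOpen_ball.measurableSet).1 h3, ?_⟩
  rw [h1, h1, h2, integral_add_left_eq_self (fun z => (Metric.ball a R).indicator v z),
    integral_indicator Metric.isOpen_ball.measurableSet,
    integral_indicator Metric.isOpen_ball.measurableSet] at h4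
  exact h4

theorem volume_ball_real (a : ℂ) {R : ℝ} (hR : 0 ≤ R) :
    (volume : Measure ℂ).real (Metric.ball a R) = Real.pi * R ^ 2 := by
  simp [Measure.real, ENNReal.toReal_ofReal hR]
  ring

section bounded

variable {w : ℂ → ℝ}

theorem integrable_of_abs_le {w : ℂ → ℝ} (hm : Measurable w)
    (hb : ∀ R : ℝ, ∃ C, ∀ z, ‖z‖ ≤ R → |w z| ≤ C) (a : ℂ) (R : ℝ) :
    IntegrableOn w (Metric.ball a R) := by
  obtain ⟨C, hC⟩ := hb (‖a‖ + R)
  refine Measure.integrableOn_of_bounded (M := C) measure_ball_lt_top.ne hm.aestronglyMeasurable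
    ((ae_restrict_iff' Metric.isOpen_ball.measurableSet).2 (ae_of_all _ fun z hz => hC z ?_))
  have h1 : ‖z - a‖ < R := by simpa [dist_eq_norm] using hz
  have h2 := norm_add_le a (z - a)
  rw [add_sub_cancel] at h2
  linarith

theorem circleIntegrable_of_abs_le (hm : Measurable w)
    (hb : ∀ R : ℝ, ∃ C, ∀ z, ‖z‖ ≤ R → |w z| ≤ C) (c : ℂ) {r : ℝ} (hr : 0 < r) :
    CircleIntegrable w c r := by
  obtain ⟨C, hC⟩ := hb (‖c‖ + r)
  rw [circleIntegrable_iff_integrable]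
  exact Integrable.of_bound (hm.comp (continuous_circleMap c r).measurable).aestronglyMeasurable C
    (ae_of_all _ fun θ => hC _ (norm_circleMap_le hr c θ))

theorem tendsto_circleAverage_of_le {v : ℂ → ℝ} {z : ℂ}
    (hint : ∀ t, 0 < t → CircleIntegrable v z t)
    (hle : ∀ t, 0 < t → v z ≤ circleAverage v z t)
    (hup : ∀ b, v z < b → ∃ δ > 0, ∀ t, 0 < t → t < δ →
      ∀ᵐ θ ∂angleMeasure, v (circleMap z t θ) ≤ b) :
    Tendsto (circleAverage v z) (𝓝[>] 0) (𝓝 (v z)) := by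
  refine tendsto_order.2 ⟨fun b hb => ?_, fun b hb => ?_⟩
  · filter_upwards [eventually_mem_nhdsWithin] with t ht using hb.trans_le (hle t ht)
  · obtain ⟨b', hb', hb'b⟩ := exists_between hb
    obtain ⟨δ, hδ, h⟩ := hup b' hb'
    filter_upwards [Ioo_mem_nhdsGT hδ] with t ht
    refine lt_of_le_of_lt ?_ hb'b
    rw [circleAverage_eq_integral]
    calc ∫ θ, v (circleMap z t θ) ∂angleMeasure ≤ ∫ _, b' ∂angleMeasure :=
          integral_mono_ae (circleIntegrable_iff_integrable.1 (hint t ht.1)) (integrable_const _)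
            (h t ht.1 ht.2)
      _ = b' := by simp

/-- Serves the truncations of a subharmonic function: with local bounds on both sides, integrability
is automatic and every point is a mean point. -/
theorem hasSubharmonicMeans_of_bounded (husc : UpperSemicontinuous w)
    (hb : ∀ R : ℝ, ∃ C, ∀ z, ‖z‖ ≤ R → |w z| ≤ C)
    (hsub : ∀ z t, 0 < t → w z ≤ circleAverage w z t) : HasSubharmonicMeans w := by
  have hm := husc.measurable
  have hp : ∀ z, IsMeanPoint w z := fun z => by
    refine ⟨hsub z, tendsto_circleAverage_of_le
      (fun t ht => circleIntegrable_of_abs_le hm hb z ht) (hsub z) fun b hbz => ?_⟩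
    obtain ⟨δ, hδ, hball⟩ := Metric.eventually_nhds_iff.1 (husc z b hbz)
    refine ⟨δ, hδ, fun t ht htδ => ae_of_all _ fun θ => (hball ?_).le⟩
    rw [circleMap_eq_add, dist_eq_norm, add_sub_cancel_left, norm_circleMap_zero_of_pos ht]
    exact htδ
  exact ⟨hm, fun z => ⟨Metric.ball z 1, Metric.ball_mem_nhds z one_pos,
      integrable_of_abs_le hm hb z 1⟩, fun c r hr => circleIntegrable_of_abs_le hm hb c hr,
    fun R => (hb R).imp fun C hC z hz => (le_abs_self _).trans (hC z hz), ae_of_all _ hp,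
    fun c r hr => ae_of_all _ fun θ => hp _⟩

end bounded

theorem HasSubharmonicMeans.ae_sub_nonneg {v : ℂ → ℝ} (hv : HasSubharmonicMeans v) {ρ : ℝ}
    (hρ : 0 < ρ) : ∀ᵐ z, 0 ≤ circleAverage v z ρ - v z := by
  filter_upwards [hv.ae_isMeanPoint] with z hz using sub_nonneg.2 (hz.1 ρ hρ)

/-- The weak Jensen formula exhibits the increment as a limit of integrals of nonnegative functions,
so monotonicity is available before any Riesz measure is constructed. -/
theorem HasSubharmonicMeans.circleAverage_mono {v : ℂ → ℝ} (hv : HasSubharmonicMeans v) (c : ℂ)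
    {r₀ r : ℝ} (h₀ : 0 < r₀) (h : r₀ ≤ r) : circleAverage v c r₀ ≤ circleAverage v c r := by
  refine sub_nonneg.1 (ge_of_tendsto (tendsto_integral_annularKernel hv c h₀ h) ?_)
  filter_upwards [eventually_mem_nhdsWithin] with ρ (hρ : 0 < ρ)
  have hpi := Real.pi_pos
  refine mul_nonneg (by positivity) (integral_nonneg_of_ae ?_)
  filter_upwards [hv.ae_sub_nonneg hρ] with z hz
  exact mul_nonneg (annularKernel_nonneg h₀ h _) hz

/-! ### Truncation from below -/

/-- The real number `max (x, -k)`, for `x < ∞`. -/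
noncomputable def truncBelow (k : ℕ) (x : EReal) : ℝ := (max x ((-(k : ℝ) : ℝ) : EReal)).toReal

theorem truncBelow_bot (k : ℕ) : truncBelow k ⊥ = -(k : ℝ) := by
  rw [truncBelow, bot_sup_eq, EReal.toReal_coe]

theorem truncBelow_coe (k : ℕ) (x : ℝ) : truncBelow k (x : EReal) = max x (-(k : ℝ)) := by
  rw [truncBelow, ← EReal.coe_strictMono.monotone.map_max, EReal.toReal_coe]

theorem coe_truncBelow (k : ℕ) {x : EReal} (hx : x ≠ ⊤) :
    (truncBelow k x : EReal) = max x ((-(k : ℝ) : ℝ) : EReal) := by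
  induction x with
  | bot => rw [truncBelow_bot, bot_sup_eq]
  | coe x => rw [truncBelow_coe, EReal.coe_strictMono.monotone.map_max]
  | top => exact absurd rfl hx

theorem neg_le_truncBelow (k : ℕ) {x : EReal} (hx : x ≠ ⊤) : -(k : ℝ) ≤ truncBelow k x := by
  rw [← EReal.coe_le_coe_iff, coe_truncBelow k hx]
  exact le_max_right _ _

theorem truncBelow_le (k : ℕ) {x : EReal} (hx : x ≠ ⊤) {C : ℝ} (hC : 0 ≤ C) (h : x ≤ C) :
    truncBelow k x ≤ C := by
  rw [← EReal.coe_le_coe_iff, coe_truncBelow k hx]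
  refine max_le h (EReal.coe_le_coe_iff.2 ?_)
  have : (0 : ℝ) ≤ k := k.cast_nonneg
  linarith

theorem truncBelow_antitone {x : EReal} (hx : x ≠ ⊤) : Antitone fun k => truncBelow k x := by
  intro k l h
  simp only
  rw [← EReal.coe_le_coe_iff, coe_truncBelow k hx, coe_truncBelow l hx]
  refine max_le_max_left _ (EReal.coe_le_coe_iff.2 (neg_le_neg ?_))
  exact_mod_cast h

theorem measurable_truncBelow (k : ℕ) : Measurable (truncBelow k) :=
  (measurable_id.max measurable_const).ereal_toReal

theorem truncBelow_eventually_eq (x : ℝ) : ∀ᶠ k : ℕ in atTop, truncBelow k (x : EReal) = x := by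
  filter_upwards [tendsto_natCast_atTop_atTop.eventually_ge_atTop (-x)] with k hk
  rw [truncBelow_coe, max_eq_left (by linarith)]

theorem abs_truncBelow_coe_le (k : ℕ) (x : ℝ) : |truncBelow k (x : EReal)| ≤ |x| := by
  rw [truncBelow_coe]
  have hk : (0 : ℝ) ≤ k := k.cast_nonneg
  rcases le_total x (-(k : ℝ)) with h | h
  · rw [max_eq_right h, abs_neg, abs_of_nonneg hk, abs_of_nonpos (by linarith)]; linarith
  · rw [max_eq_left h]

/-- A function bounded above whose truncations have bounded integrals is integrable. -/
theorem integrable_toReal_of_truncBelow {α : Type*} [MeasurableSpace α] {μ : Measure α}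
    [IsFiniteMeasure μ] {U : α → EReal} (hU : Measurable U) (htop : ∀ x, U x ≠ ⊤) {C M : ℝ}
    (hC : 0 ≤ C) (hUC : ∀ᵐ x ∂μ, U x ≤ C)
    (hM : ∀ k : ℕ, ∫ x, (C - truncBelow k (U x)) ∂μ ≤ M) :
    (∀ᵐ x ∂μ, U x ≠ ⊥) ∧ Integrable (fun x => (U x).toReal) μ := by
  set g : ℕ → α → ℝ≥0∞ := fun k x => ENNReal.ofReal (C - truncBelow k (U x)) with hg
  have htm : ∀ k, Measurable fun x => truncBelow k (U x) := fun k =>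
    (measurable_truncBelow k).comp hU
  have hgm : ∀ k, Measurable (g k) := fun k => (measurable_const.sub (htm k)).ennreal_ofReal
  have hmono : Monotone g := fun k l h x =>
    ENNReal.ofReal_le_ofReal (sub_le_sub_left (truncBelow_antitone (htop x) h) _)
  have hgM : ∀ k, ∫⁻ x, g k x ∂μ ≤ ENNReal.ofReal M := fun k => by
    have hi : Integrable (fun x => C - truncBelow k (U x)) μ := by
      refine Integrable.of_bound (measurable_const.sub (htm k)).aestronglyMeasurable (C + k) ?_
      filter_upwards [hUC] with x hx
      have h1 := truncBelow_le k (htop x) hC hx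
      have h2 := neg_le_truncBelow k (htop x)
      rw [Real.norm_of_nonneg (by linarith)]
      linarith
    rw [hg, ← ofReal_integral_eq_lintegral_ofReal hi]
    · exact ENNReal.ofReal_le_ofReal (hM k)
    · filter_upwards [hUC] with x hx
      exact sub_nonneg.2 (truncBelow_le k (htop x) hC hx)
  have hsup : ∫⁻ x, ⨆ k, g k x ∂μ ≤ ENNReal.ofReal M := by
    rw [lintegral_iSup hgm hmono]
    exact iSup_le hgM
  have hsupm : Measurable fun x => ⨆ k, g k x := Measurable.iSup hgm
  have hfin : ∀ᵐ x ∂μ, ⨆ k, g k x < ⊤ :=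
    ae_lt_top hsupm (hsup.trans_lt ENNReal.ofReal_lt_top).ne
  -- Where U = -∞ the k-th function is at least k, so the supremum is infinite; by monotone
  -- convergence this happens only on a null set.
  have hbot : ∀ᵐ x ∂μ, U x ≠ ⊥ := by
    filter_upwards [hfin] with x hx hb
    have : ⨆ k, g k x = ⊤ := by
      rw [eq_top_iff, ← ENNReal.iSup_natCast]
      refine iSup_mono fun k => ?_
      simp only [hg]
      rw [hb, truncBelow_bot, ← ENNReal.ofReal_natCast]
      exact ENNReal.ofReal_le_ofReal (by linarith)
    exact absurd this hx.ne
  refine ⟨hbot, ?_⟩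
  have hint : Integrable (fun x => (⨆ k, g k x).toReal) μ :=
    integrable_toReal_of_lintegral_ne_top hsupm.aemeasurable
      (hsup.trans_lt ENNReal.ofReal_lt_top).ne
  refine ((integrable_const C).add hint).mono' hU.ereal_toReal.aestronglyMeasurable ?_
  filter_upwards [hbot, hUC, hfin] with x hx hxC hxf
  lift U x to ℝ using ⟨htop x, hx⟩ with y hy
  obtain ⟨k, hk⟩ := (truncBelow_eventually_eq y).exists
  have h1 : ENNReal.ofReal (C - y) ≤ ⨆ k, g k x := by
    refine le_iSup_of_le k ?_
    simp only [hg]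
    rw [← hy, hk]
  have h2 : C - y ≤ (⨆ k, g k x).toReal := (ENNReal.ofReal_le_iff_le_toReal hxf.ne).1 h1
  have hyC : y ≤ C := by exact_mod_cast hxC
  rw [EReal.toReal_coe, Real.norm_eq_abs, Pi.add_apply]
  exact abs_le.2 ⟨by linarith, by linarith⟩

theorem circleMean_eq (u : ℂ → EReal) (z : ℂ) (r : ℝ) :
    circleMean u z r =
      ((∫⁻ θ, (u (circleMap z r θ)).toENNReal ∂angleMeasure : ℝ≥0∞) : EReal)
        - ((∫⁻ θ, (-u (circleMap z r θ)).toENNReal ∂angleMeasure : ℝ≥0∞) : EReal) := by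
  have h : (volume (Ioc 0 (2 * Real.pi)))⁻¹ • volume.restrict (Ioc 0 (2 * Real.pi))
      = angleMeasure := by
    rw [angleMeasure, Real.volume_Ioc, sub_zero]
  simp only [circleMean, setLAverage_eq', h]

namespace IsSubharmonic

variable {u : ℂ → EReal} (hu : IsSubharmonic u)

include hu

theorem measurable : Measurable u := hu.upperSemicontinuous.measurable

theorem exists_le (R : ℝ) : ∃ C : ℝ, 0 ≤ C ∧ ∀ z, ‖z‖ ≤ R → u z ≤ C := by
  rcases lt_or_ge R 0 with hR | hR
  · exact ⟨0, le_rfl, fun z hz => absurd (norm_nonneg z) (by linarith)⟩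
  obtain ⟨a, ha, hmax⟩ := (hu.upperSemicontinuous.upperSemicontinuousOn
    (Metric.closedBall 0 R)).exists_isMaxOn ⟨0, by simpa using hR⟩ (isCompact_closedBall 0 R)
  refine ⟨max 0 (u a).toReal, le_max_left _ _, fun z hz => ?_⟩
  have h1 : u z ≤ u a := hmax (by simpa using hz)
  refine h1.trans ((EReal.le_coe_toReal (hu.ne_top a)).trans ?_)
  exact_mod_cast le_max_right _ _

theorem upperSemicontinuous_truncBelow (k : ℕ) :
    UpperSemicontinuous fun z => truncBelow k (u z) := by
  intro z b hb
  have hb' : max (u z) ((-(k : ℝ) : ℝ) : EReal) < (b : EReal) := by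
    rw [← coe_truncBelow k (hu.ne_top z)]; exact_mod_cast hb
  filter_upwards [hu.upperSemicontinuous z b (max_lt_iff.1 hb').1] with x hx
  rw [← EReal.coe_lt_coe_iff, coe_truncBelow k (hu.ne_top x)]
  exact max_lt hx (max_lt_iff.1 hb').2

theorem abs_truncBelow_le (k : ℕ) (R : ℝ) : ∃ C, ∀ z, ‖z‖ ≤ R → |truncBelow k (u z)| ≤ C := by
  obtain ⟨C, hC, h⟩ := hu.exists_le R
  refine ⟨C + k, fun z hz => abs_le.2 ⟨?_, ?_⟩⟩
  · linarith [neg_le_truncBelow k (hu.ne_top z)]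
  · have : (0 : ℝ) ≤ k := k.cast_nonneg
    linarith [truncBelow_le k (hu.ne_top z) hC (h z hz)]

/-- As -k ≤ 0, truncation leaves the positive part of u unchanged and can only reduce the negative
part. The mean of the truncation therefore dominates the extended-real mean of u, and it also
dominates -k. -/
theorem truncBelow_le_circleAverage (k : ℕ) (z : ℂ) {t : ℝ} (ht : 0 < t) :
    truncBelow k (u z) ≤ circleAverage (fun z => truncBelow k (u z)) z t := by
  set w : ℂ → ℝ := fun z => truncBelow k (u z) with hw
  have hwm : Measurable w := (measurable_truncBelow k).comp hu.measurable
  have hint := circleIntegrable_iff_integrable.1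
    (circleIntegrable_of_abs_le hwm (hu.abs_truncBelow_le k) z ht)
  have h1 : -(k : ℝ) ≤ circleAverage w z t := by
    rw [circleAverage_eq_integral]
    calc -(k : ℝ) = ∫ _, -(k : ℝ) ∂angleMeasure := by simp
      _ ≤ _ := integral_mono (integrable_const _) hint
        fun θ => neg_le_truncBelow k (hu.ne_top _)
  rw [← EReal.coe_le_coe_iff, coe_truncBelow k (hu.ne_top z)]
  refine max_le ?_ (EReal.coe_le_coe_iff.2 h1)
  refine (hu.le_circleMean z t ht).trans ?_
  rw [circleMean_eq, circleAverage_eq_integral,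
    integral_eq_lintegral_pos_part_sub_lintegral_neg_part hint]
  set P := ∫⁻ θ, (u (circleMap z t θ)).toENNReal ∂angleMeasure
  set N := ∫⁻ θ, (-u (circleMap z t θ)).toENNReal ∂angleMeasure
  have hP : ∫⁻ θ, ENNReal.ofReal (w (circleMap z t θ)) ∂angleMeasure = P := by
    refine lintegral_congr fun θ => ?_
    have hx := hu.ne_top (circleMap z t θ)
    simp only [hw]
    have hk : (0 : ℝ) ≤ k := k.cast_nonneg
    generalize u (circleMap z t θ) = x at hx ⊢
    induction x with
    | bot => simp [truncBelow_bot]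
    | coe x =>
      rw [truncBelow_coe, EReal.toENNReal_of_ne_top (by simp), EReal.toReal_coe]
      rcases le_total x (-(k : ℝ)) with h | h
      · rw [max_eq_right h, ENNReal.ofReal_of_nonpos (by linarith),
          ENNReal.ofReal_of_nonpos (by linarith)]
      · rw [max_eq_left h]
    | top => exact absurd rfl hx
  have hN : ∫⁻ θ, ENNReal.ofReal (-w (circleMap z t θ)) ∂angleMeasure ≤ N := by
    refine lintegral_mono fun θ => ?_
    have hx := hu.ne_top (circleMap z t θ)
    simp only [hw]
    generalize u (circleMap z t θ) = x at hx ⊢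
    induction x with
    | bot => simp
    | coe x =>
      rw [truncBelow_coe, ← EReal.coe_neg, EReal.toENNReal_of_ne_top (by simp), EReal.toReal_coe]
      exact ENNReal.ofReal_le_ofReal (neg_le_neg (le_max_left _ _))
    | top => exact absurd rfl hx
  have hPfin : P ≠ ⊤ := by
    rw [← hP]
    exact (lt_of_le_of_lt (lintegral_mono fun θ => ENNReal.ofReal_le_ofReal (le_abs_self _))
      (by simpa [hasFiniteIntegral_iff_norm] using hint.hasFiniteIntegral)).ne
  have hNfin : ∫⁻ θ, ENNReal.ofReal (-w (circleMap z t θ)) ∂angleMeasure ≠ ⊤ :=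
    (lt_of_le_of_lt (lintegral_mono fun θ => ENNReal.ofReal_le_ofReal (neg_le_abs _))
      (by simpa [hasFiniteIntegral_iff_norm] using hint.hasFiniteIntegral)).ne
  rw [hP, EReal.coe_sub, EReal.coe_ennreal_toReal hPfin, EReal.coe_ennreal_toReal hNfin]
  exact EReal.sub_le_sub le_rfl (by exact_mod_cast hN)

theorem hasSubharmonicMeans_truncBelow (k : ℕ) :
    HasSubharmonicMeans fun z => truncBelow k (u z) :=
  hasSubharmonicMeans_of_bounded (hu.upperSemicontinuous_truncBelow k) (hu.abs_truncBelow_le k)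
    fun z _ ht => hu.truncBelow_le_circleAverage k z ht

theorem measurable_truncBelow_comp (k : ℕ) : Measurable fun z => truncBelow k (u z) :=
  (measurable_truncBelow k).comp hu.measurable

theorem integrableOn_ball_truncBelow (k : ℕ) (a : ℂ) (R : ℝ) :
    IntegrableOn (fun z => truncBelow k (u z)) (Metric.ball a R) :=
  integrable_of_abs_le (hu.measurable_truncBelow_comp k) (hu.abs_truncBelow_le k) a R

/-- The integrals of the truncations over a disc are bounded below. -/
theorem exists_integral_ball_le (c : ℂ) (R : ℝ) {C : ℝ} (hC : 0 ≤ C) :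
    ∃ M, ∀ k : ℕ, ∫ z in Metric.ball c R, (C - truncBelow k (u z)) ≤ M := by
  obtain ⟨z₀, hz₀⟩ := hu.exists_ne_bot
  -- The disc is enlarged to one centred at a point z₀ with u(z₀) ≠ -∞, where the sub-mean value
  -- property bounds the integrals below by u(z₀) uniformly in k.
  set R' := |R| + ‖c - z₀‖ with hR'
  have hR'0 : 0 ≤ R' := by positivity
  have hsub : Metric.ball c R ⊆ Metric.ball z₀ R' := fun z hz => by
    have h1 : ‖z - c‖ < R := by simpa [dist_eq_norm] using hz
    rw [Metric.mem_ball, dist_eq_norm]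
    have h2 := norm_add_le (z - c) (c - z₀)
    rw [sub_add_sub_cancel] at h2
    linarith [le_abs_self R]
  obtain ⟨C', hC', hCu'⟩ := hu.exists_le (‖z₀‖ + R')
  -- D is at least u on the larger disc, so the integrand D - u is nonnegative there after
  -- truncation and its integral increases with the domain.
  set D := max C C' with hD
  have hD0 : 0 ≤ D := hC.trans (le_max_left _ _)
  have hDu : ∀ z ∈ Metric.ball z₀ R', u z ≤ D := fun z hz => by
    refine (hCu' z ?_).trans (EReal.coe_le_coe_iff.2 (le_max_right _ _))
    have h1 : ‖z - z₀‖ < R' := by simpa [dist_eq_norm] using hz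
    have h2 := norm_add_le z₀ (z - z₀)
    rw [add_sub_cancel] at h2
    linarith
  refine ⟨(D - (u z₀).toReal) * (Real.pi * R' ^ 2), fun k => ?_⟩
  have hi1 := hu.integrableOn_ball_truncBelow k c R
  have hi2 := hu.integrableOn_ball_truncBelow k z₀ R'
  have hfin : ∀ a S, IntegrableOn (fun _ : ℂ => D) (Metric.ball a S) := fun a S =>
    integrableOn_const measure_ball_lt_top.ne
  have hfin' : ∀ (E : ℝ) a S, IntegrableOn (fun _ : ℂ => E) (Metric.ball a S) := fun E a S =>
    integrableOn_const measure_ball_lt_top.ne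
  obtain ⟨hA, hB⟩ := setIntegral_ball_eq (hu.measurable_truncBelow_comp k) hi2
  have hmean : (u z₀).toReal * (Real.pi * R' ^ 2)
      ≤ ∫ z in Metric.ball z₀ R', truncBelow k (u z) := by
    rw [hB]
    calc (u z₀).toReal * (Real.pi * R' ^ 2)
        = ∫ _ in Metric.ball (0 : ℂ) R', (u z₀).toReal := by
          rw [setIntegral_const, volume_ball_real _ hR'0, smul_eq_mul, mul_comm]
      _ ≤ _ := by
          refine setIntegral_mono_on_ae (hfin' _ _ _) hA Metric.isOpen_ball.measurableSet ?_
          filter_upwards [compl_mem_ae_iff.2 (measure_singleton (μ := (volume : Measure ℂ)) 0)]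
            with x hx _
          refine le_trans ?_ (hu.truncBelow_le_circleAverage k z₀ (norm_pos_iff.2 hx))
          rw [← EReal.coe_le_coe_iff, coe_truncBelow k (hu.ne_top _),
            EReal.coe_toReal (hu.ne_top _) hz₀]
          exact le_max_left _ _
  calc ∫ z in Metric.ball c R, (C - truncBelow k (u z))
      ≤ ∫ z in Metric.ball c R, (D - truncBelow k (u z)) :=
        setIntegral_mono ((hfin' C c R).sub hi1) ((hfin c R).sub hi1)
          fun z => sub_le_sub_right (le_max_left _ _) _
    _ ≤ ∫ z in Metric.ball z₀ R', (D - truncBelow k (u z)) := by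
        refine setIntegral_mono_set ((hfin z₀ R').sub hi2) ?_ (LE.le.eventuallyLE hsub)
        filter_upwards [ae_restrict_mem Metric.isOpen_ball.measurableSet] with z hz
        exact sub_nonneg.2 (truncBelow_le k (hu.ne_top z) hD0 (hDu z hz))
    _ ≤ _ := by
        rw [integral_sub (hfin z₀ R') hi2, setIntegral_const, volume_ball_real _ hR'0,
          smul_eq_mul]
        linarith

theorem ball_integrable (c : ℂ) (R : ℝ) :
    (∀ᵐ z ∂volume.restrict (Metric.ball c R), u z ≠ ⊥) ∧
      IntegrableOn (fun z => (u z).toReal) (Metric.ball c R) := by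
  obtain ⟨C, hC, hCu⟩ := hu.exists_le (‖c‖ + R)
  have hCu' : ∀ z ∈ Metric.ball c R, u z ≤ C := fun z hz => hCu z (by
    have h1 : ‖z - c‖ < R := by simpa [dist_eq_norm] using hz
    have h2 := norm_add_le c (z - c)
    rw [add_sub_cancel] at h2
    linarith)
  obtain ⟨M, hM⟩ := hu.exists_integral_ball_le c R hC
  have : IsFiniteMeasure (volume.restrict (Metric.ball c R)) := ⟨by
    rw [Measure.restrict_apply_univ]; exact measure_ball_lt_top⟩
  refine integrable_toReal_of_truncBelow hu.measurable hu.ne_top hC ?_ hM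
  filter_upwards [ae_restrict_mem Metric.isOpen_ball.measurableSet] with z hz using hCu' z hz

theorem ae_ne_bot : ∀ᵐ z, u z ≠ ⊥ := by
  have h : (volume : Measure ℂ).restrict (⋃ n : ℕ, Metric.ball 0 (n : ℝ)) = volume := by
    rw [Metric.iUnion_ball_nat, Measure.restrict_univ]
  rw [← h, ae_restrict_iUnion_iff]
  exact fun n => (hu.ball_integrable 0 n).1

/-- Circle means of the truncations increase with the radius, so the mean over the disc is at most
the mean over its boundary. The uniform lower bound for integrals over discs thus passes to the
circle, and the truncation can be removed. -/
theorem circle_integrable (c : ℂ) {r : ℝ} (hr : 0 < r) :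
    (∀ᵐ θ ∂angleMeasure, u (circleMap c r θ) ≠ ⊥) ∧
      CircleIntegrable (fun z => (u z).toReal) c r := by
  obtain ⟨C, hC, hCu⟩ := hu.exists_le (‖c‖ + r)
  have hCu' : ∀ z ∈ Metric.ball c r, u z ≤ C := fun z hz => hCu z (by
    have h1 : ‖z - c‖ < r := by simpa [dist_eq_norm] using hz
    have h2 := norm_add_le c (z - c)
    rw [add_sub_cancel] at h2
    linarith)
  obtain ⟨M, hM⟩ := hu.exists_integral_ball_le c r hC
  rw [circleIntegrable_iff_integrable]
  have hpi := Real.pi_pos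
  refine integrable_toReal_of_truncBelow (M := M / (Real.pi * r ^ 2))
    (hu.measurable.comp (continuous_circleMap c r).measurable)
    (fun θ => hu.ne_top _) hC (ae_of_all _ fun θ => hCu _ (norm_circleMap_le hr c θ)) fun k => ?_
  have hw := hu.hasSubharmonicMeans_truncBelow k
  have hi := hu.integrableOn_ball_truncBelow k c r
  have hconst : ∀ (E : ℝ) (a : ℂ), IntegrableOn (fun _ : ℂ => E) (Metric.ball a r) := fun E a =>
    integrableOn_const measure_ball_lt_top.ne
  obtain ⟨hA, hB⟩ := setIntegral_ball_eq (hu.measurable_truncBelow_comp k) hi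
  have h1 : ∫ z in Metric.ball c r, truncBelow k (u z)
      ≤ circleAverage (fun z => truncBelow k (u z)) c r * (Real.pi * r ^ 2) := by
    rw [hB]
    calc _ ≤ ∫ _ in Metric.ball (0 : ℂ) r, circleAverage (fun z => truncBelow k (u z)) c r := by
          refine setIntegral_mono_on_ae hA (hconst _ _) Metric.isOpen_ball.measurableSet ?_
          filter_upwards [compl_mem_ae_iff.2 (measure_singleton (μ := (volume : Measure ℂ)) 0)]
            with x hx hxr
          exact hw.circleAverage_mono c (norm_pos_iff.2 hx) (mem_ball_zero_iff.1 hxr).le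
      _ = _ := by rw [setIntegral_const, volume_ball_real _ hr.le, smul_eq_mul, mul_comm]
  have h2 := hM k
  rw [integral_sub (hconst _ _) hi, setIntegral_const, volume_ball_real _ hr.le,
    smul_eq_mul] at h2
  rw [integral_sub (integrable_const _) (integrable_circle hw c hr),
    ← circleAverage_eq_integral (fun z => truncBelow k (u z)), le_div_iff₀ (by positivity)]
  simp only [integral_const, probReal_univ, one_smul]
  linarith

theorem tendsto_circleAverage_truncBelow (c : ℂ) {r : ℝ} (hr : 0 < r) :
    Tendsto (fun k => circleAverage (fun z => truncBelow k (u z)) c r) atTop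
      (𝓝 (circleAverage (fun z => (u z).toReal) c r)) := by
  obtain ⟨hb, hi⟩ := hu.circle_integrable c hr
  simp only [circleAverage_eq_integral]
  refine tendsto_integral_of_dominated_convergence (fun θ => |(u (circleMap c r θ)).toReal|)
    (fun k => ((hu.measurable_truncBelow_comp k).comp
      (continuous_circleMap c r).measurable).aestronglyMeasurable)
    (circleIntegrable_iff_integrable.1 hi).abs (fun k => ?_) ?_
  · filter_upwards [hb] with θ hθ
    have hx := hu.ne_top (circleMap c r θ)
    lift u (circleMap c r θ) to ℝ using ⟨hx, hθ⟩ with y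
    exact abs_truncBelow_coe_le k y
  · filter_upwards [hb] with θ hθ
    have hx := hu.ne_top (circleMap c r θ)
    lift u (circleMap c r θ) to ℝ using ⟨hx, hθ⟩ with y
    exact tendsto_const_nhds.congr' ((truncBelow_eventually_eq y).mono fun k hk => hk.symm)

/-- The sub-mean inequality passes to the limit from the truncations; convergence of small circle
means combines it with upper semicontinuity. -/
theorem isMeanPoint {z : ℂ} (hz : u z ≠ ⊥) : IsMeanPoint (fun z => (u z).toReal) z := by
  have hle : ∀ t, 0 < t → (u z).toReal ≤ circleAverage (fun z => (u z).toReal) z t :=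
    fun t ht => by
      refine ge_of_tendsto' (hu.tendsto_circleAverage_truncBelow z ht) fun k => ?_
      refine le_trans ?_ (hu.truncBelow_le_circleAverage k z ht)
      rw [← EReal.coe_le_coe_iff, coe_truncBelow k (hu.ne_top _),
        EReal.coe_toReal (hu.ne_top _) hz]
      exact le_max_left _ _
  refine ⟨hle, tendsto_circleAverage_of_le (fun t ht => (hu.circle_integrable z ht).2) hle
    fun b hb => ?_⟩
  have hb' : u z < (b : EReal) := by
    rw [← EReal.coe_toReal (hu.ne_top _) hz]; exact_mod_cast hb
  obtain ⟨δ, hδ, hball⟩ := Metric.eventually_nhds_iff.1 (hu.upperSemicontinuous z b hb')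
  refine ⟨δ, hδ, fun t ht htδ => ?_⟩
  filter_upwards [(hu.circle_integrable z ht).1] with θ hθ
  have h1 : u (circleMap z t θ) < (b : EReal) := hball (by
    rw [circleMap_eq_add, dist_eq_norm, add_sub_cancel_left, norm_circleMap_zero_of_pos ht]
    exact htδ)
  rw [← EReal.coe_toReal (hu.ne_top _) hθ] at h1
  exact_mod_cast h1.le

/-- A subharmonic function has finite, increasing means over circles. -/
theorem hasSubharmonicMeans : HasSubharmonicMeans fun z => (u z).toReal where
  measurable := hu.measurable.ereal_toReal
  locallyIntegrable := fun z => ⟨Metric.ball z 1, Metric.ball_mem_nhds z one_pos,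
    (hu.ball_integrable z 1).2⟩
  circleIntegrable := fun c _ hr => (hu.circle_integrable c hr).2
  exists_le := fun R => by
    obtain ⟨C, hC, h⟩ := hu.exists_le R
    refine ⟨C, fun z hz => ?_⟩
    rcases eq_or_ne (u z) ⊥ with hb | hb
    · simpa [hb] using hC
    · rw [← EReal.coe_le_coe_iff, EReal.coe_toReal (hu.ne_top _) hb]
      exact h z hz
  ae_isMeanPoint := hu.ae_ne_bot.mono fun _ hz => hu.isMeanPoint hz
  ae_isMeanPoint_circleMap := fun c _ hr =>
    (hu.circle_integrable c hr).1.mono fun _ hθ => hu.isMeanPoint hθ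

end IsSubharmonic

/-! ### Circle means and the Laplacian of smooth functions -/

section taylor

variable {φ : ℂ → ℝ}

theorem abs_taylor_sub_le_of_hasDerivAt {g g' g'' : ℝ → ℝ} {K ρ : ℝ}
    (h1 : ∀ t, HasDerivAt g (g' t) t) (h2 : ∀ t, HasDerivAt g' (g'' t) t) (hρ : 0 ≤ ρ) (hK : 0 ≤ K)
    (h : ∀ t ∈ Icc 0 ρ, |g'' t - g'' 0| ≤ K * ρ) :
    |g ρ - g 0 - ρ * g' 0 - ρ ^ 2 / 2 * g'' 0| ≤ K * ρ ^ 3 := by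
  set D := g'' 0
  have e1 : ∀ t ∈ Icc 0 ρ, |g' t - g' 0 - t * D| ≤ K * ρ ^ 2 := fun t ht => by
    have := norm_image_sub_le_of_norm_deriv_le_segment' (a := 0) (b := ρ)
      (f := fun t : ℝ => g' t - t * D) (f' := fun t => g'' t - D)
      (fun x _ => (((h2 x).sub ((hasDerivAt_id x).mul_const D)).congr_deriv
        (by ring)).hasDerivWithinAt) (C := K * ρ)
      (fun x hx => h x (Ico_subset_Icc_self hx)) t ht
    simp only [zero_mul, sub_zero, Real.norm_eq_abs] at this
    rw [show g' t - g' 0 - t * D = g' t - t * D - g' 0 by ring]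
    refine this.trans ?_
    rw [sq, ← mul_assoc]
    exact mul_le_mul_of_nonneg_left ht.2 (mul_nonneg hK hρ)
  have := norm_image_sub_le_of_norm_deriv_le_segment' (a := 0) (b := ρ)
    (f := fun t : ℝ => g t - t * g' 0 - t ^ 2 / 2 * D)
    (f' := fun t : ℝ => g' t - g' 0 - t * D)
    (fun x _ => ((((h1 x).sub ((hasDerivAt_id x).mul_const (g' 0))).sub
      (((hasDerivAt_pow 2 x).div_const 2).mul_const D)).congr_deriv
        (by push_cast; ring)).hasDerivWithinAt) (C := K * ρ ^ 2)
    (fun x hx => e1 x (Ico_subset_Icc_self hx)) ρ (right_mem_Icc.2 hρ)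
  simp only [zero_mul, sub_zero, Real.norm_eq_abs, ne_eq,
    OfNat.ofNat_ne_zero, not_false_eq_true, zero_pow, zero_div] at this
  rw [show g ρ - g 0 - ρ * g' 0 - ρ ^ 2 / 2 * D
    = g ρ - ρ * g' 0 - ρ ^ 2 / 2 * D - g 0 by ring]
  refine this.trans (le_of_eq ?_)
  ring

theorem hasDerivAt_line {F : Type*} [NormedAddCommGroup F] [NormedSpace ℝ F] {f : ℂ → F}
    (hf : Differentiable ℝ f) (z e : ℂ) (t : ℝ) :
    HasDerivAt (fun t : ℝ => f (z + t * e)) (fderiv ℝ f (z + t * e) e) t := by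
  have hline : HasDerivAt (fun t : ℝ => z + t * e) e t := by
    have := ((Complex.ofRealCLM.hasDerivAt (x := t)).mul_const e).const_add z
    simpa using this
  exact (hf _).hasFDerivAt.comp_hasDerivAt t hline

theorem hasDerivAt_line_apply {f : ℂ → ℂ →L[ℝ] ℝ} (hf : Differentiable ℝ f) (z e : ℂ) (t : ℝ) :
    HasDerivAt (fun t : ℝ => f (z + t * e) e) (fderiv ℝ f (z + t * e) e e) t := by
  simpa using (hasDerivAt_line hf z e t).clm_apply (hasDerivAt_const t e)

theorem abs_bilin_sub_le {B : ℂ → ℂ →L[ℝ] ℂ →L[ℝ] ℝ} {K : NNReal} (hK : LipschitzWith K B)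
    {z e : ℂ} (he : ‖e‖ = 1) {t : ℝ} (ht : 0 ≤ t) :
    |B (z + t * e) e e - B z e e| ≤ K * t := by
  have h3 := hK.dist_le_mul (z + t * e) z
  rw [dist_eq_norm, dist_eq_norm, add_sub_cancel_left, norm_mul, he, mul_one, Complex.norm_real,
    Real.norm_of_nonneg ht] at h3
  have h4 := (B (z + t * e) - B z).le_opNorm₂ e e
  rw [he, mul_one, mul_one, sub_apply, sub_apply] at h4
  exact h4.trans h3

theorem exists_lipschitzWith_fderiv_fderiv (hφ : ContDiff ℝ ∞ φ) (hs : HasCompactSupport φ) :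
    ∃ K, LipschitzWith K (fderiv ℝ (fderiv ℝ φ)) :=
  ContDiff.lipschitzWith_of_hasCompactSupport (𝕂 := ℝ) (n := ∞) ((hs.fderiv ℝ).fderiv ℝ)
    ((hφ.fderiv_right (m := ∞) (by simp)).fderiv_right (m := ∞) (by simp)) (by simp)

theorem abs_taylor_sub_le (hφ : ContDiff ℝ ∞ φ) (hs : HasCompactSupport φ) :
    ∃ M, 0 ≤ M ∧ ∀ z e : ℂ, ‖e‖ = 1 → ∀ ρ : ℝ, 0 ≤ ρ →
      |φ (z + ρ * e) - φ z - ρ * fderiv ℝ φ z e - ρ ^ 2 / 2 * fderiv ℝ (fderiv ℝ φ) z e e|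
        ≤ M * ρ ^ 3 := by
  obtain ⟨K, hK⟩ := exists_lipschitzWith_fderiv_fderiv hφ hs
  have h1 : Differentiable ℝ φ := hφ.differentiable (by simp)
  have h2 : Differentiable ℝ (fderiv ℝ φ) :=
    (hφ.fderiv_right (m := ∞) (by simp)).differentiable (by simp)
  refine ⟨K, K.2, fun z e he ρ hρ => ?_⟩
  have := abs_taylor_sub_le_of_hasDerivAt (hasDerivAt_line h1 z e) (hasDerivAt_line_apply h2 z e)
    hρ K.2 fun t ht => by
      rw [Complex.ofReal_zero, zero_mul, add_zero]
      exact (abs_bilin_sub_le hK he ht.1).trans (mul_le_mul_of_nonneg_left ht.2 K.2)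
  rwa [Complex.ofReal_zero, zero_mul, add_zero] at this

theorem laplacian_eq_fderiv (z : ℂ) : (Δ φ) z = fderiv ℝ (fderiv ℝ φ) z 1 1
    + fderiv ℝ (fderiv ℝ φ) z Complex.I Complex.I := by
  rw [InnerProductSpace.laplacian_eq_iteratedFDeriv_complexPlane]
  simp [iteratedFDeriv_two_apply]

/-- The trace of a bilinear form is the same in every orthonormal basis: the cross terms of e and of
its quarter turn cancel. -/
theorem bilin_add_bilin_rotate (B : ℂ →L[ℝ] ℂ →L[ℝ] ℝ) (e : ℂ) :
    B e e + B (Complex.I * e) (Complex.I * e)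
      = ‖e‖ ^ 2 * (B 1 1 + B Complex.I Complex.I) := by
  have h1 : e = e.re • (1 : ℂ) + e.im • Complex.I := by
    apply Complex.ext <;> simp
  have h2 : Complex.I * e = (-e.im) • (1 : ℂ) + e.re • Complex.I := by
    apply Complex.ext <;> simp
  have h3 : ‖e‖ ^ 2 = e.re ^ 2 + e.im ^ 2 := by
    rw [← Complex.normSq_eq_norm_sq, Complex.normSq_apply]; ring
  rw [h2, h3]
  conv_lhs => rw [h1]
  simp only [Complex.add_re, Complex.add_im, Complex.real_smul, Complex.mul_re, Complex.mul_im,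
    Complex.ofReal_re, Complex.ofReal_im, Complex.one_re, Complex.one_im, Complex.I_re,
    Complex.I_im, map_add, add_apply, map_neg, neg_apply, neg_smul]
  have h4 : ∀ a : ℝ, ∀ w : ℂ, B ((a : ℂ) * w) = a • B w := fun a w => by
    rw [← Complex.real_smul, map_smul]
  have h5 : ∀ a : ℝ, ∀ w x : ℂ, B x ((a : ℂ) * w) = a • B x w := fun a w x => by
    rw [← Complex.real_smul, map_smul]
  simp only [h4, h5, smul_apply, smul_eq_mul]
  ring

theorem continuous_laplacian (hφ : ContDiff ℝ ∞ φ) : Continuous (Δ φ) := by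
  have h1 : ContDiff ℝ ∞ (fderiv ℝ φ) := hφ.fderiv_right (by simp)
  have h2 : ContDiff ℝ ∞ (fderiv ℝ (fderiv ℝ φ)) := h1.fderiv_right (by simp)
  have hΔ : Δ φ = fun z => fderiv ℝ (fderiv ℝ φ) z 1 1
    + fderiv ℝ (fderiv ℝ φ) z Complex.I Complex.I := funext laplacian_eq_fderiv
  rw [hΔ]
  have := h2.continuous
  fun_prop

theorem laplacian_eq_zero_of_notMem_tsupport {z : ℂ} (hz : z ∉ tsupport φ) : (Δ φ) z = 0 := by
  have hz2 : z ∉ tsupport (fderiv ℝ (fderiv ℝ φ)) := fun hmem =>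
    hz (tsupport_fderiv_subset ℝ (tsupport_fderiv_subset ℝ hmem))
  rw [laplacian_eq_fderiv, image_eq_zero_of_notMem_tsupport hz2]
  simp

theorem hasCompactSupport_laplacian (hs : HasCompactSupport φ) : HasCompactSupport (Δ φ) :=
  HasCompactSupport.intro hs fun _ => laplacian_eq_zero_of_notMem_tsupport

/-- The second order expansion of the circle mean of a smooth function. -/
theorem abs_circleAverage_sub_laplacian_le (hφ : ContDiff ℝ ∞ φ) (hs : HasCompactSupport φ) :
    ∃ M, 0 ≤ M ∧ ∀ z : ℂ, ∀ ρ : ℝ, 0 ≤ ρ →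
      |circleAverage φ z ρ - φ z - ρ ^ 2 / 4 * (Δ φ) z| ≤ M * ρ ^ 3 := by
  obtain ⟨M, hM, h⟩ := abs_taylor_sub_le hφ hs
  refine ⟨M, hM, fun z ρ hρ => ?_⟩
  set e : ℝ → ℂ := fun θ => Complex.exp (θ * Complex.I) with he
  have hen : ∀ θ, ‖e θ‖ = 1 := fun θ => Complex.norm_exp_ofReal_mul_I θ
  have hcm : ∀ θ, circleMap z ρ θ = z + ρ * e θ := fun θ => rfl
  have hadd : ∀ θ η, e (θ + η) = e η * e θ := fun θ η => by
    simp only [he]; rw [← Complex.exp_add]; push_cast; ring_nf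
  have q1 : e (Real.pi / 2) = Complex.I := by
    simp only [he]; push_cast; exact Complex.exp_pi_div_two_mul_I
  have q2 : e Real.pi = -1 := Complex.exp_pi_mul_I
  have q3 : e (-(Real.pi / 2)) = -Complex.I := by
    simp only [he]; push_cast; rw [← neg_div]; exact Complex.exp_neg_pi_div_two_mul_I
  have hc : ∀ η, Integrable (fun θ => φ (circleMap z ρ (θ + η))) angleMeasure := fun η => by
    rw [integrable_angleMeasure_iff]
    refine Continuous.intervalIntegrable ?_ _ _
    exact hφ.continuous.comp ((continuous_circleMap z ρ).comp (by fun_prop))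
  -- The circle mean is averaged with its three quarter turns. In the resulting integrand the
  -- first-order Taylor terms cancel in opposite pairs and the second-order terms form the Laplacian
  -- at every angle, so the estimate is pointwise in θ.
  have hF : circleAverage φ z ρ - φ z - ρ ^ 2 / 4 * (Δ φ) z
      = ∫ θ, ((φ (circleMap z ρ (θ + 0)) + φ (circleMap z ρ (θ + Real.pi / 2))
        + φ (circleMap z ρ (θ + Real.pi)) + φ (circleMap z ρ (θ + -(Real.pi / 2)))) / 4
        - (φ z + ρ ^ 2 / 4 * (Δ φ) z)) ∂angleMeasure := by
    have i2 : Integrable (fun θ => φ (circleMap z ρ (θ + 0)) + φ (circleMap z ρ (θ + Real.pi / 2)))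
      angleMeasure := (hc _).add (hc _)
    have i3 : Integrable (fun θ => φ (circleMap z ρ (θ + 0)) + φ (circleMap z ρ (θ + Real.pi / 2))
      + φ (circleMap z ρ (θ + Real.pi))) angleMeasure := i2.add (hc _)
    have i4 : Integrable (fun θ => φ (circleMap z ρ (θ + 0)) + φ (circleMap z ρ (θ + Real.pi / 2))
      + φ (circleMap z ρ (θ + Real.pi)) + φ (circleMap z ρ (θ + -(Real.pi / 2)))) angleMeasure :=
      i3.add (hc _)
    rw [integral_sub (i4.div_const 4) (integrable_const _), integral_div,
      integral_add i3 (hc _), integral_add i2 (hc _), integral_add (hc _) (hc _)]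
    simp only [← circleAverage_eq_integral_add_angle, integral_const, probReal_univ, one_smul]
    ring
  rw [hF, ← Real.norm_eq_abs]
  refine (norm_integral_le_of_norm_le_const (C := M * ρ ^ 3) (ae_of_all _ fun θ => ?_)).trans
    (by simp)
  simp only [hcm, hadd, q1, q2, q3, add_zero]
  set ε := e θ
  have hε : ‖ε‖ = 1 := hen θ
  have b1 := h z ε hε ρ hρ
  have b2 := h z (Complex.I * ε) (by simp [hε]) ρ hρ
  have b3 := h z (-1 * ε) (by simp [hε]) ρ hρ
  have b4 := h z (-Complex.I * ε) (by simp [hε]) ρ hρ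
  have hB := bilin_add_bilin_rotate (fderiv ℝ (fderiv ℝ φ) z) ε
  rw [← laplacian_eq_fderiv, hε, one_pow, one_mul] at hB
  simp only [neg_mul, one_mul, map_neg, neg_apply, neg_neg] at b1 b2 b3 b4 ⊢
  rw [← hB, Real.norm_eq_abs]
  rw [abs_le] at b1 b2 b3 b4 ⊢
  constructor <;> nlinarith [b1.1, b1.2, b2.1, b2.2, b3.1, b3.2, b4.1, b4.2]

end taylor

/-! ### The Riesz measure -/

section riesz

variable {v : ℂ → ℝ} (hv : HasSubharmonicMeans v)

include hv

theorem integrable_mul_circleAverage_sub {Φ : ℂ → ℝ} (hΦ : Continuous Φ) (hΦs : HasCompactSupport Φ)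
    {ρ : ℝ} (hρ : 0 < ρ) : Integrable fun z => Φ z * (circleAverage v z ρ - v z) :=
  (integral_mul_circleAverage_sub hv hΦ hΦs hρ).1

/-- Self-adjointness moves A_ρ - 1 onto φ, where the expansion of circle means gives the Laplacian
with error O(ρ), uniformly and on a fixed compact set. -/
theorem tendsto_integral_smooth {φ : ℂ → ℝ} (hφ : ContDiff ℝ ∞ φ) (hs : HasCompactSupport φ) :
    Tendsto (fun ρ => 4 / ρ ^ 2 * ∫ z, φ z * (circleAverage v z ρ - v z)) (𝓝[>] 0)
      (𝓝 (∫ z, v z * (Δ φ) z)) := by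
  obtain ⟨M, hM, h⟩ := abs_circleAverage_sub_laplacian_le hφ hs
  obtain ⟨R, hR⟩ := hs.isBounded.subset_closedBall 0
  -- φ vanishes from radius R + 1 on and ρ ≤ 1, so its circle means vanish from radius R + 2 on.
  set B := Metric.closedBall (0 : ℂ) (R + 2) with hB
  have hvB : IntegrableOn v B := hv.locallyIntegrable.integrableOn_isCompact (isCompact_closedBall _ _)
  have hφ0 : ∀ z, R + 1 ≤ ‖z‖ → φ z = 0 := fun z hz => by
    by_contra hne
    have := hR (subset_tsupport φ hne)
    rw [mem_closedBall_zero_iff] at this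
    linarith
  have hΔ0 : ∀ z, R + 1 ≤ ‖z‖ → (Δ φ) z = 0 := fun z hz => by
    have hz' : z ∉ tsupport φ := fun hmem => by
      have := hR hmem
      rw [mem_closedBall_zero_iff] at this
      linarith
    exact laplacian_eq_zero_of_notMem_tsupport hz'
  rw [tendsto_iff_dist_tendsto_zero]
  have hlim : Tendsto (fun ρ : ℝ => 4 * M * ρ * ∫ z in B, |v z|) (𝓝[>] 0) (𝓝 0) := by
    have : Continuous fun ρ : ℝ => 4 * M * ρ * ∫ z in B, |v z| := by fun_prop
    simpa using (this.tendsto 0).mono_left nhdsWithin_le_nhds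
  refine squeeze_zero' (Eventually.of_forall fun _ => dist_nonneg) ?_ hlim
  filter_upwards [Ioc_mem_nhdsGT (zero_lt_one (α := ℝ))] with ρ hρ
  have hρ0 : 0 < ρ := hρ.1
  have hi1 : Integrable fun z => (circleAverage φ z ρ - φ z) * v z :=
    integrable_mul_of_hasCompactSupport hv.locallyIntegrable
    ((continuous_circleAverage hφ.continuous ρ).sub hφ.continuous)
    (HasCompactSupport.sub (hasCompactSupport_circleAverage hs hρ.1) hs)
  have hi2 := integrable_mul_of_hasCompactSupport hv.locallyIntegrable
    (continuous_laplacian hφ) (hasCompactSupport_laplacian hs)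
  rw [(integral_mul_circleAverage_sub hv hφ.continuous hs hρ.1).2, ← integral_const_mul]
  simp only [mul_comm (v _)]
  rw [Real.dist_eq, ← integral_sub (hi1.const_mul _) hi2, ← Real.norm_eq_abs,
    ← integral_const_mul, ← integral_indicator measurableSet_closedBall]
  refine norm_integral_le_of_norm_le
    ((integrable_indicator_iff measurableSet_closedBall).2 (hvB.abs.const_mul _))
    (ae_of_all _ fun z => ?_)
  by_cases hz : z ∈ B
  · rw [indicator_of_mem hz, ← mul_assoc, ← sub_mul, norm_mul, Real.norm_eq_abs (v z)]
    refine mul_le_mul_of_nonneg_right ?_ (abs_nonneg _)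
    have e1 : 4 / ρ ^ 2 * (circleAverage φ z ρ - φ z) - (Δ φ) z
        = 4 / ρ ^ 2 * (circleAverage φ z ρ - φ z - ρ ^ 2 / 4 * (Δ φ) z) := by
      field_simp
    rw [e1, norm_mul, Real.norm_of_nonneg (by positivity), Real.norm_eq_abs]
    calc 4 / ρ ^ 2 * _ ≤ 4 / ρ ^ 2 * (M * ρ ^ 3) := by
          gcongr; exact h z ρ hρ0.le
      _ = 4 * M * ρ := by field_simp
  · have hz' : R + 2 ≤ ‖z‖ := by simpa using (not_le.1 (by simpa [hB] using hz)).le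
    have a1 : circleAverage φ z ρ = 0 := circleAverage_eq_zero_of_norm hρ0 hφ0 (by linarith [hρ.2])
    rw [indicator_of_notMem hz, a1, hφ0 z (by linarith), hΔ0 z (by linarith)]
    simp

theorem tendsto_four_div_integral_annularKernel (c : ℂ) {r₀ r : ℝ} (h₀ : 0 < r₀) (h : r₀ ≤ r) :
    Tendsto (fun ρ => 4 / ρ ^ 2 *
        ∫ z, annularKernel r₀ r (z - c) * (circleAverage v z ρ - v z)) (𝓝[>] 0)
      (𝓝 (2 * Real.pi * (circleAverage v c r - circleAverage v c r₀))) := by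
  refine ((tendsto_integral_annularKernel hv c h₀ h).const_mul (2 * Real.pi)).congr fun ρ => ?_
  have := Real.pi_pos
  rcases eq_or_ne ρ 0 with rfl | hρ
  · simp
  · field_simp
    ring

/-- The densities A_ρ v - v are nonnegative almost everywhere, so a bound on test functions is a
bound on the functionals. -/
theorem abs_integral_mul_le {Φ χ : ℂ → ℝ}
    (hχ : Continuous χ) (hχs : HasCompactSupport χ) (h : ∀ z, |Φ z| ≤ χ z) {ρ : ℝ} (hρ : 0 < ρ) :
    |4 / ρ ^ 2 * ∫ z, Φ z * (circleAverage v z ρ - v z)|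
      ≤ 4 / ρ ^ 2 * ∫ z, χ z * (circleAverage v z ρ - v z) := by
  rw [abs_mul, abs_of_nonneg (by positivity)]
  refine mul_le_mul_of_nonneg_left ?_ (by positivity)
  rw [← Real.norm_eq_abs]
  refine norm_integral_le_of_norm_le (integrable_mul_circleAverage_sub hv hχ hχs hρ) ?_
  filter_upwards [hv.ae_sub_nonneg hρ] with z hz
  rw [norm_mul, Real.norm_of_nonneg hz]
  exact mul_le_mul_of_nonneg_right (h z) hz

/-- The limit is known for smooth test functions and for annular kernels. A continuous Φ is
approximated uniformly by smooth g with support inside that of Φ; the error is dominated by a small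
multiple of a cutoff χ that is itself an annular kernel, so its functionals stay bounded. The family
is therefore Cauchy. -/
theorem exists_tendsto_integral {Φ : ℂ → ℝ} (hΦ : Continuous Φ) (hΦs : HasCompactSupport Φ) :
    ∃ L, Tendsto (fun ρ => 4 / ρ ^ 2 * ∫ z, Φ z * (circleAverage v z ρ - v z)) (𝓝[>] 0)
      (𝓝 L) := by
  set I : (ℂ → ℝ) → ℝ → ℝ := fun Φ ρ => 4 / ρ ^ 2 * ∫ z, Φ z * (circleAverage v z ρ - v z) with hI
  obtain ⟨R₀, hR₀⟩ := hΦs.isBounded.subset_closedBall 0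
  set R := max R₀ 1 with hR
  have hR1 : 0 < R := lt_max_of_lt_right one_pos
  have he1 : 1 ≤ Real.exp 1 := Real.one_le_exp (by norm_num)
  have hRe : R ≤ R * Real.exp 1 := le_mul_of_one_le_right hR1.le he1
  -- The ratio e of the radii makes the kernel equal to log e = 1 on the disc of radius R.
  set χ : ℂ → ℝ := fun z => annularKernel R (R * Real.exp 1) (z - 0) with hχ
  have hχc : Continuous χ := continuous_annularKernel_sub hR1 (hR1.trans_le hRe) 0
  have hχs : HasCompactSupport χ := hasCompactSupport_annularKernel_sub hRe 0
  have hχ0 : ∀ z, 0 ≤ χ z := fun z => annularKernel_nonneg hR1 hRe _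
  have hχ1 : ∀ z, ‖z‖ ≤ R → χ z = 1 := fun z hz => by
    simp only [hχ, annularKernel, sub_zero]
    rw [max_eq_left hz, max_eq_left (hz.trans hRe), Real.log_mul hR1.ne' (Real.exp_pos _).ne',
      Real.log_exp]
    ring
  have hχlim := tendsto_four_div_integral_annularKernel hv 0 hR1 hRe
  set B := 2 * Real.pi * (circleAverage v 0 (R * Real.exp 1) - circleAverage v 0 R) with hBdef
  have hB0 : 0 ≤ B := mul_nonneg (by positivity)
    (sub_nonneg.2 (hv.circleAverage_mono 0 hR1 hRe))
  have hBev : ∀ᶠ ρ in 𝓝[>] 0, I χ ρ ≤ B + 1 :=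
    (hχlim.eventually_lt_const (by linarith : B < B + 1)).mono fun ρ h => h.le
  have hcauchy : Cauchy (map (I Φ) (𝓝[>] 0)) := by
    rw [Metric.cauchy_iff]
    refine ⟨inferInstance, fun ε hε => ?_⟩
    set η := ε / (4 * (B + 1)) with hη
    have hηpos : 0 < η := by positivity
    obtain ⟨g, hg, hgd, hgs⟩ := hΦ.exists_contDiff_approx ⊤ (ε := fun _ => η) continuous_const
      (fun _ => hηpos)
    have hgsup : HasCompactSupport g := hΦs.mono hgs
    have hlim := tendsto_integral_smooth hv hg hgsup
    have hd : ∀ᶠ ρ in 𝓝[>] 0, |I Φ ρ - I g ρ| ≤ η * (B + 1) := by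
      filter_upwards [hBev, eventually_mem_nhdsWithin] with ρ h1 (hρ : 0 < ρ)
      have hle : ∀ z, |(Φ - g) z| ≤ η * χ z := fun z => by
        by_cases hz : z ∈ tsupport Φ
        · have h2 := hR₀ hz
          rw [mem_closedBall_zero_iff] at h2
          rw [hχ1 z (h2.trans (le_max_left _ _)), mul_one, Pi.sub_apply, abs_sub_comm]
          exact (hgd z).le
        · have h2 : Φ z = 0 := image_eq_zero_of_notMem_tsupport hz
          have h3 : g z = 0 := by
            by_contra hne
            exact (hgs hne) h2
          rw [Pi.sub_apply, h2, h3, sub_zero, abs_zero]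
          exact mul_nonneg hηpos.le (hχ0 z)
      have hηχ : HasCompactSupport fun z => η * χ z := hχs.mul_left (f := fun _ => η)
      have h4 := abs_integral_mul_le hv (hχc.const_mul η) hηχ hle hρ
      have e1 : 4 / ρ ^ 2 * ∫ z, (Φ - g) z * (circleAverage v z ρ - v z) = I Φ ρ - I g ρ := by
        simp only [hI, Pi.sub_apply, sub_mul]
        rw [integral_sub (integrable_mul_circleAverage_sub hv hΦ hΦs hρ)
          (integrable_mul_circleAverage_sub hv hg.continuous hgsup hρ), mul_sub]
      have e2 : 4 / ρ ^ 2 * ∫ z, η * χ z * (circleAverage v z ρ - v z) = η * I χ ρ := by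
        simp only [hI, mul_assoc]
        rw [integral_const_mul]
        ring
      rw [e1, e2] at h4
      exact h4.trans (mul_le_mul_of_nonneg_left h1 hηpos.le)
    have hηB : η * (B + 1) = ε / 4 := by
      rw [hη]; field_simp
    obtain ⟨s, hs, hs'⟩ := Metric.cauchy_iff.1 hlim.cauchy_map |>.2 (ε / 4) (by linarith)
    have hS : ∀ᶠ ρ in 𝓝[>] 0, I Φ ρ ∈ I Φ '' {ρ | I g ρ ∈ s ∧ |I Φ ρ - I g ρ| ≤ ε / 4} := by
      filter_upwards [hs, hd] with ρ h1 h2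
      exact ⟨ρ, ⟨h1, by rw [← hηB]; exact h2⟩, rfl⟩
    refine ⟨_, hS, ?_⟩
    rintro _ ⟨x, ⟨hx1, hx2⟩, rfl⟩ _ ⟨y, ⟨hy1, hy2⟩, rfl⟩
    have := hs' _ hx1 _ hy1
    rw [Real.dist_eq] at this ⊢
    rw [abs_le] at hx2 hy2
    rw [abs_lt] at this ⊢
    constructor <;> linarith [hx2.1, hx2.2, hy2.1, hy2.2, this.1, this.2]
  exact cauchy_map_iff_exists_tendsto.1 hcauchy

/-- The **Riesz measure** of a function with subharmonic means. -/
theorem exists_rieszMeasure : ∃ μ : Measure ℂ, IsLocallyFiniteMeasure μ ∧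
    ∀ Φ : ℂ → ℝ, Continuous Φ → HasCompactSupport Φ →
      Tendsto (fun ρ => 4 / ρ ^ 2 * ∫ z, Φ z * (circleAverage v z ρ - v z)) (𝓝[>] 0)
        (𝓝 (∫ z, Φ z ∂μ)) := by
  choose L hL using fun Φ : C_c(ℂ, ℝ) => exists_tendsto_integral hv Φ.continuous Φ.hasCompactSupport
  let Λ₀ : C_c(ℂ, ℝ) →ₗ[ℝ] ℝ :=
    { toFun := L
      map_add' := fun f g => by
        refine tendsto_nhds_unique (hL (f + g)) (((hL f).add (hL g)).congr' ?_)
        filter_upwards [eventually_mem_nhdsWithin] with ρ (hρ : 0 < ρ)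
        rw [← mul_add, ← integral_add
          (integrable_mul_circleAverage_sub hv f.continuous f.hasCompactSupport hρ)
          (integrable_mul_circleAverage_sub hv g.continuous g.hasCompactSupport hρ)]
        refine congrArg _ (integral_congr_ae (ae_of_all _ fun z => ?_))
        exact (add_mul (f z) (g z) _).symm
      map_smul' := fun a f => by
        refine tendsto_nhds_unique (hL (a • f)) (((hL f).const_mul a).congr fun ρ => ?_)
        have : ∫ z, (a • f) z * (circleAverage v z ρ - v z)
            = a * ∫ z, f z * (circleAverage v z ρ - v z) := by
          rw [← integral_const_mul]
          exact integral_congr_ae (ae_of_all _ fun z => mul_assoc a (f z) _)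
        exact (mul_left_comm _ _ _).trans (congrArg (4 / ρ ^ 2 * ·) this.symm) }
  -- The limit functional is positive because A_ρ v ≥ v almost everywhere; the Riesz–Markov–Kakutani
  -- theorem then represents it by a measure.
  let Λ : C_c(ℂ, ℝ) →ₚ[ℝ] ℝ := PositiveLinearMap.mk₀ Λ₀ fun f hf => by
    refine ge_of_tendsto (hL f) ?_
    filter_upwards [eventually_mem_nhdsWithin] with ρ (hρ : 0 < ρ)
    refine mul_nonneg (by positivity) (integral_nonneg_of_ae ?_)
    filter_upwards [hv.ae_sub_nonneg hρ] with z hz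
    exact mul_nonneg (hf z) hz
  refine ⟨RealRMK.rieszMeasure Λ, inferInstance, fun Φ hΦ hΦs => ?_⟩
  have := RealRMK.integral_rieszMeasure Λ ⟨⟨Φ, hΦ⟩, hΦs⟩
  have h2 : ∫ z, Φ z ∂(RealRMK.rieszMeasure Λ) = L ⟨⟨Φ, hΦ⟩, hΦs⟩ := this
  rw [h2]
  exact hL ⟨⟨Φ, hΦ⟩, hΦs⟩

end riesz

/-- `μ` is the Riesz measure of `v`, the weak limit of `4 ρ⁻² (A_ρ v - v)` as `ρ → 0`, where `A_ρ`
is the mean over circles of radius `ρ`. -/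
structure IsRieszMeasure (v : ℂ → ℝ) (μ : Measure ℂ) : Prop where
  locallyFinite : IsLocallyFiniteMeasure μ
  tendsto : ∀ Φ : ℂ → ℝ, Continuous Φ → HasCompactSupport Φ →
      Tendsto (fun ρ => 4 / ρ ^ 2 * ∫ z, Φ z * (circleAverage v z ρ - v z)) (𝓝[>] 0)
        (𝓝 (∫ z, Φ z ∂μ))

namespace IsRieszMeasure

variable {v : ℂ → ℝ} {μ : Measure ℂ} (hμ : IsRieszMeasure v μ) (hv : HasSubharmonicMeans v)

include hμ hv

theorem integral_smooth {φ : ℂ → ℝ} (hφ : ContDiff ℝ ∞ φ) (hs : HasCompactSupport φ) :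
    ∫ z, φ z ∂μ = ∫ z, v z * (Δ φ) z :=
  tendsto_nhds_unique (hμ.tendsto φ hφ.continuous hs) (tendsto_integral_smooth hv hφ hs)

/-- **Jensen's formula**. -/
theorem integral_annularKernel (c : ℂ) {r₀ r : ℝ} (h₀ : 0 < r₀) (h : r₀ ≤ r) :
    ∫ z, annularKernel r₀ r (z - c) ∂μ
      = 2 * Real.pi * (circleAverage v c r - circleAverage v c r₀) :=
  tendsto_nhds_unique (hμ.tendsto _ (continuous_annularKernel_sub h₀ (h₀.trans_le h) c)
    (hasCompactSupport_annularKernel_sub h c)) (tendsto_four_div_integral_annularKernel hv c h₀ h)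

end IsRieszMeasure

/-! ### Increments given by a measure: the degenerate case -/

section degenerate

variable {μ : Measure ℂ} [IsLocallyFiniteMeasure μ] {F G : ℝ → ℝ} {c : ℂ}

theorem annularKernel_exp_eq_one {R : ℝ} (hR : 0 < R) {z : ℂ} (hz : ‖z‖ ≤ R) :
    annularKernel R (R * Real.exp 1) z = 1 := by
  have hRe : R ≤ R * Real.exp 1 := le_mul_of_one_le_right hR.le (Real.one_le_exp (by norm_num))
  rw [annularKernel, max_eq_left hz, max_eq_left (hz.trans hRe),
    Real.log_mul hR.ne' (Real.exp_pos _).ne', Real.log_exp]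
  ring

/-- The kernel is nonnegative and, for radii R and eR, equal to 1 on the disc of radius R; so all
discs are null. -/
theorem measure_eq_zero_of_integral_annularKernel
    (h : ∀ r₀ r : ℝ, 0 < r₀ → r₀ ≤ r → ∫ z, annularKernel r₀ r z ∂μ = 0) : μ = 0 := by
  have key : ∀ n : ℕ, μ (Metric.closedBall 0 (n + 1)) = 0 := fun n => by
    have hR : (0 : ℝ) < n + 1 := by positivity
    have hRe : (n + 1 : ℝ) ≤ (n + 1) * Real.exp 1 :=
      le_mul_of_one_le_right hR.le (Real.one_le_exp (by norm_num))
    have hint : Integrable (annularKernel (n + 1) ((n + 1) * Real.exp 1)) μ := by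
      simpa using integrable_annularKernel_sub μ hR hRe 0
    have h1 := (integral_eq_zero_iff_of_nonneg (fun z => annularKernel_nonneg hR hRe z) hint).1
      (h _ _ hR hRe)
    rw [← nonpos_iff_eq_zero, ← ae_iff.1 h1]
    refine measure_mono fun z hz => ?_
    rw [mem_ofPred_eq, annularKernel_exp_eq_one hR (by simpa using hz)]
    exact one_ne_zero
  rw [← Measure.measure_univ_eq_zero, ← nonpos_iff_eq_zero]
  have : (univ : Set ℂ) ⊆ ⋃ n : ℕ, Metric.closedBall 0 (n + 1) := fun z _ => by
    obtain ⟨n, hn⟩ := exists_nat_ge ‖z‖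
    exact mem_iUnion.2 ⟨n, by rw [mem_closedBall_zero_iff]; linarith⟩
  exact (measure_mono this).trans (by rw [measure_iUnion_null key])

/-- A characteristic that does not tend to infinity is constant, which forces μ = 0. Only in that
case must equality be checked separately. -/
theorem equivOutsideSmallSet_of_eq_integral_or
    (hF : ∀ r₀ r : ℝ, 0 < r₀ → r₀ ≤ r → F r - F r₀ = ∫ z, annularKernel r₀ r z ∂μ)
    (hG : ∀ r₀ r : ℝ, 0 < r₀ → r₀ ≤ r → G r - G r₀ = ∫ z, annularKernel r₀ r (z - c) ∂μ)
    (h0 : μ = 0 → G =ᶠ[atTop] F) : EquivOutsideSmallSet G F := by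
  have hF' : ∀ r₀ r : ℝ, 0 < r₀ → r₀ ≤ r →
      F r - F r₀ = ∫ z, annularKernel r₀ r (z - 0) ∂μ := by simpa using hF
  rcases (isLogConvexGrowth_of_eq_integral hF').const_or_tendsto with h | h
  · refine equivOutsideSmallSet_of_eventuallyEq (h0 ?_)
    refine measure_eq_zero_of_integral_annularKernel fun r₀ r h₀ hr => ?_
    rw [← hF _ _ h₀ hr, h r r₀ (h₀.trans_le hr) h₀, sub_self]
  · exact equivOutsideSmallSet_of_eq_integral hF hG h

end degenerate

/-! ### Jordan decompositions -/

/-- Continuous test functions are approximated uniformly by smooth ones with no larger support, with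
an error proportional to the finite mass of that support. -/
theorem measure_ext_of_integral_smooth {μ ν : Measure ℂ} [IsLocallyFiniteMeasure μ]
    [IsLocallyFiniteMeasure ν]
    (h : ∀ φ : ℂ → ℝ, ContDiff ℝ ∞ φ → HasCompactSupport φ → ∫ z, φ z ∂μ = ∫ z, φ z ∂ν) :
    μ = ν := by
  refine Measure.ext_of_integral_eq_on_compactlySupported fun Φ => ?_
  have hc : Continuous Φ := Φ.continuous
  have hs : HasCompactSupport Φ := Φ.hasCompactSupport
  set K := tsupport Φ with hK
  have hKc : IsCompact K := hs
  have key : ∀ (m : Measure ℂ) [IsLocallyFiniteMeasure m] (η : ℝ) (g : ℂ → ℝ), Continuous g →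
      (∀ z, dist (g z) (Φ z) < η) → Function.support g ⊆ Function.support Φ →
      |∫ z, Φ z ∂m - ∫ z, g z ∂m| ≤ η * m.real K := fun m _ η g hg hgd hgs => by
    have hgsup : HasCompactSupport g := hs.mono hgs
    rw [← integral_sub (hc.integrable_of_hasCompactSupport hs)
      (hg.integrable_of_hasCompactSupport hgsup), ← setIntegral_eq_integral_of_forall_compl_eq_zero
      (s := K), ← Real.norm_eq_abs]
    · refine norm_setIntegral_le_of_norm_le_const hKc.measure_lt_top fun z _ => ?_
      rw [← dist_eq_norm, dist_comm]
      exact (hgd z).le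
    · intro z hz
      have h2 : Φ z = 0 := image_eq_zero_of_notMem_tsupport hz
      have h3 : g z = 0 := by
        by_contra hne
        exact (hgs hne) h2
      rw [h2, h3, sub_zero]
  refine eq_of_forall_dist_le fun ε hε => ?_
  set C := μ.real K + ν.real K + 1
  have hC : 0 < C := by positivity
  obtain ⟨g, hg, hgd, hgs⟩ := hc.exists_contDiff_approx ⊤ (ε := fun _ => ε / C) continuous_const
    (fun _ => by positivity)
  have h1 := key μ _ g hg.continuous hgd hgs
  have h2 := key ν _ g hg.continuous hgd hgs
  rw [h g hg (hs.mono hgs)] at h1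
  have h3 : ε / C * μ.real K + ε / C * ν.real K ≤ ε := by
    rw [← mul_add, div_mul_eq_mul_div, div_le_iff₀ hC]
    exact mul_le_mul_of_nonneg_left (by simp [C]) hε.le
  rw [Real.dist_eq]
  rw [abs_le] at h1 h2 ⊢
  constructor <;> linarith [h1.1, h1.2, h2.1, h2.2]

theorem isLocallyFiniteMeasure_add (μ ν : Measure ℂ) [IsLocallyFiniteMeasure μ]
    [IsLocallyFiniteMeasure ν] : IsLocallyFiniteMeasure (μ + ν) := by
  refine ⟨fun z => ⟨Metric.closedBall z 1, Metric.closedBall_mem_nhds z one_pos, ?_⟩⟩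
  have hc := isCompact_closedBall z (1 : ℝ)
  exact ENNReal.add_lt_top.2 ⟨hc.measure_lt_top, hc.measure_lt_top⟩

theorem isLocallyFiniteMeasure_map_sub (μ : Measure ℂ) [IsLocallyFiniteMeasure μ] (c : ℂ) :
    IsLocallyFiniteMeasure (μ.map fun z => z - c) := by
  refine ⟨fun z => ⟨Metric.closedBall z 1, Metric.closedBall_mem_nhds z one_pos, ?_⟩⟩
  rw [Measure.map_apply (by fun_prop) measurableSet_closedBall]
  refine (measure_mono fun w hw => ?_).trans_lt
    (isCompact_closedBall (z + c) (1 : ℝ)).measure_lt_top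
  rw [mem_preimage, Metric.mem_closedBall, dist_eq_norm] at hw
  rw [Metric.mem_closedBall, dist_eq_norm]
  rwa [show w - (z + c) = w - c - z by ring]

/-- With densities f₁, f₂ relative to m₁ + m₂, the common part has density min(f₁, f₂), and the
truncated differences live on the disjoint sets where one density exceeds the other. -/
theorem exists_eq_add_mutuallySingular (m₁ m₂ : Measure ℂ) [SigmaFinite m₁] [SigmaFinite m₂] :
    ∃ μ ν σ : Measure ℂ, m₁ = μ + σ ∧ m₂ = ν + σ ∧ μ ⟂ₘ ν := by
  set l := m₁ + m₂
  set f₁ := m₁.rnDeriv l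
  set f₂ := m₂.rnDeriv l
  have hf₁ : Measurable f₁ := Measure.measurable_rnDeriv _ _
  have hf₂ : Measurable f₂ := Measure.measurable_rnDeriv _ _
  have e₁ : l.withDensity f₁ = m₁ := Measure.withDensity_rnDeriv_eq _ _
    (Measure.AbsolutelyContinuous.rfl.add_right _)
  have e₂ : l.withDensity f₂ = m₂ := Measure.withDensity_rnDeriv_eq _ _
    (by rw [show l = m₂ + m₁ from add_comm _ _]; exact Measure.AbsolutelyContinuous.rfl.add_right _)
  refine ⟨l.withDensity (f₁ - f₂), l.withDensity (f₂ - f₁), l.withDensity (fun z => min (f₁ z) (f₂ z)),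
    ?_, ?_, ?_⟩
  · rw [← withDensity_add_left (hf₁.sub hf₂), ← e₁]
    congr 1
    ext z
    exact (tsub_add_min (a := f₁ z) (b := f₂ z)).symm
  · rw [← withDensity_add_left (hf₂.sub hf₁), ← e₂]
    congr 1
    ext z
    simp only [Pi.add_apply, Pi.sub_apply]
    rw [min_comm]
    exact (tsub_add_min (a := f₂ z) (b := f₁ z)).symm
  · have hS : MeasurableSet {z | f₁ z ≤ f₂ z} := measurableSet_le hf₁ hf₂
    refine ⟨_, hS, ?_, ?_⟩
    · rw [withDensity_apply _ hS]
      refine (setLIntegral_congr_fun hS fun z hz => ?_).trans lintegral_zero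
      exact tsub_eq_zero_of_le hz
    · rw [withDensity_apply _ hS.compl]
      refine (setLIntegral_congr_fun hS.compl fun z hz => ?_).trans lintegral_zero
      exact tsub_eq_zero_of_le (not_le.1 (show ¬ f₁ z ≤ f₂ z from hz)).le

/-- Minimality of the Jordan decomposition: ν is carried by a set S that μ does not charge, and on S
the equation reads ν' = μ' + ν. -/
theorem le_of_add_eq_add_of_mutuallySingular {μ ν μ' ν' : Measure ℂ} (h : μ ⟂ₘ ν)
    (heq : μ + ν' = μ' + ν) : ν ≤ ν' := by
  obtain ⟨S, hS, h1, h2⟩ := h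
  refine Measure.le_iff.2 fun A hA => ?_
  calc ν A ≤ ν (A ∩ S) + ν (A ∩ Sᶜ) := measure_le_inter_add_sdiff _ _ _
    _ = ν (A ∩ S) := by rw [measure_mono_null inter_subset_right h2, add_zero]
    _ ≤ (μ' + ν) (A ∩ S) := by rw [Measure.add_apply]; exact le_add_self
    _ = ν' (A ∩ S) := by
      rw [← heq, Measure.add_apply, measure_mono_null inter_subset_right h1, zero_add]
    _ ≤ ν' A := measure_mono inter_subset_left

namespace IsLaplacianJordan

variable {u : ℂ → EReal} {μ ν μ' ν' : Measure ℂ}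

theorem neg_unique (h : IsLaplacianJordan u μ ν) (h' : IsLaplacianJordan u μ' ν') : ν = ν' := by
  have := h.locallyFinite_pos
  have := h.locallyFinite_neg
  have := h'.locallyFinite_pos
  have := h'.locallyFinite_neg
  have := isLocallyFiniteMeasure_add μ ν'
  have := isLocallyFiniteMeasure_add μ' ν
  have heq : μ + ν' = μ' + ν := by
    refine measure_ext_of_integral_smooth fun φ hφ hs => ?_
    have hi : ∀ (m : Measure ℂ) [IsLocallyFiniteMeasure m], Integrable φ m := fun m _ =>
      hφ.continuous.integrable_of_hasCompactSupport hs
    rw [integral_add_measure (hi _) (hi _), integral_add_measure (hi _) (hi _)]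
    linarith [h.integral_laplacian φ hφ hs, h'.integral_laplacian φ hφ hs]
  exact le_antisymm (le_of_add_eq_add_of_mutuallySingular h.mutuallySingular heq)
    (le_of_add_eq_add_of_mutuallySingular h'.mutuallySingular heq.symm)

theorem laplacianNeg_eq (h : IsLaplacianJordan u μ ν) : laplacianNeg u = ν := by
  have hex : ∃ ν, ∃ μ, IsLaplacianJordan u μ ν := ⟨ν, μ, h⟩
  rw [laplacianNeg, dif_pos hex]
  exact hex.choose_spec.choose_spec.neg_unique h

theorem _root_.ShiftInvariance.laplacian_comp_sub (φ : ℂ → ℝ) (c z : ℂ) :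
    (Δ fun w => φ (w - c)) z = (Δ φ) (z - c) := by
  have h1 : fderiv ℝ (fun w => φ (w - c)) = fun w => fderiv ℝ φ (w - c) :=
    funext fun w => fderiv_comp_sub c
  rw [laplacian_eq_fderiv, laplacian_eq_fderiv, h1, fderiv_comp_sub c]

theorem shift (h : IsLaplacianJordan u μ ν) (c : ℂ) :
    IsLaplacianJordan (ShiftInvariance.shift c u) (μ.map fun z => z - c) (ν.map fun z => z - c) := by
  have := h.locallyFinite_pos
  have := h.locallyFinite_neg
  have he : MeasurableEmbedding fun z : ℂ => z - c := (Homeomorph.subRight c).measurableEmbedding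
  refine ⟨isLocallyFiniteMeasure_map_sub μ c, isLocallyFiniteMeasure_map_sub ν c, ?_, ?_⟩
  · obtain ⟨S, hS, h1, h2⟩ := h.mutuallySingular
    refine ⟨(fun z => z - c) '' S, he.measurableSet_image.2 hS, ?_, ?_⟩
    · rw [he.map_apply, preimage_image_eq _ he.injective, h1]
    · rw [he.map_apply, preimage_compl, preimage_image_eq _ he.injective, h2]
  · intro φ hφ hs
    have h1 := h.integral_laplacian (fun z => φ (z - c)) (hφ.comp (contDiff_id.sub contDiff_const))
      (hs.comp_homeomorph (Homeomorph.subRight c))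
    rw [he.integral_map, he.integral_map, ← h1]
    simp only [laplacian_comp_sub]
    rw [← integral_sub_right_eq_self _ c]
    simp [ShiftInvariance.shift]

end IsLaplacianJordan

theorem isLaplacianJordan_of_sub {u u₁ u₂ : ℂ → EReal} (hu₁ : IsSubharmonic u₁)
    (hu₂ : IsSubharmonic u₂) (hu : ∀ z, ¬ (u₁ z = ⊥ ∧ u₂ z = ⊥) → u z = u₁ z - u₂ z)
    {μ ν σ : Measure ℂ} (h₁ : IsRieszMeasure (fun z => (u₁ z).toReal) (μ + σ))
    (h₂ : IsRieszMeasure (fun z => (u₂ z).toReal) (ν + σ)) (hs : μ ⟂ₘ ν) :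
    IsLaplacianJordan u μ ν := by
  have := h₁.locallyFinite
  have := h₂.locallyFinite
  have i1 : IsLocallyFiniteMeasure μ :=
    Measure.isLocallyFiniteMeasure_of_le (μ := μ + σ) (Measure.le_add_right le_rfl)
  have i2 : IsLocallyFiniteMeasure ν :=
    Measure.isLocallyFiniteMeasure_of_le (μ := ν + σ) (Measure.le_add_right le_rfl)
  have i3 : IsLocallyFiniteMeasure σ := Measure.isLocallyFiniteMeasure_of_le
    (μ := ν + σ) (Measure.le_add_left le_rfl)
  refine ⟨i1, i2, hs, fun φ hφ hφs => ?_⟩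
  have hi : ∀ (m : Measure ℂ) [IsLocallyFiniteMeasure m], Integrable φ m := fun m _ =>
    hφ.continuous.integrable_of_hasCompactSupport hφs
  have e1 := h₁.integral_smooth hu₁.hasSubharmonicMeans hφ hφs
  have e2 := h₂.integral_smooth hu₂.hasSubharmonicMeans hφ hφs
  rw [integral_add_measure (hi _) (hi _)] at e1 e2
  -- The values of u where both u₁ and u₂ are -∞ do not matter, as this set has measure zero. The
  -- common part σ cancels in the difference of the two Riesz measures.
  have e3 : ∫ z, (u z).toReal * (Δ φ) z
      = ∫ z, ((u₁ z).toReal * (Δ φ) z - (u₂ z).toReal * (Δ φ) z) := by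
    refine integral_congr_ae ?_
    filter_upwards [hu₁.ae_ne_bot, hu₂.ae_ne_bot] with z h1 h2
    rw [hu z fun h => h1 h.1, EReal.toReal_sub (hu₁.ne_top z) h1 (hu₂.ne_top z) h2, sub_mul]
  rw [e3, integral_sub]
  · linarith
  all_goals simp only [mul_comm _ ((Δ φ) _)]
  · exact integrable_mul_of_hasCompactSupport hu₁.hasSubharmonicMeans.locallyIntegrable
      (continuous_laplacian hφ) (hasCompactSupport_laplacian hφs)
  · exact integrable_mul_of_hasCompactSupport hu₂.hasSubharmonicMeans.locallyIntegrable
      (continuous_laplacian hφ) (hasCompactSupport_laplacian hφs)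

/-- A `δ`-subharmonic function, with the Riesz measures of the two subharmonic functions written as
the two variations of the Laplacian plus a common part. -/
theorem IsDeltaSubharmonic.exists_isLaplacianJordan {u : ℂ → EReal} (hu : IsDeltaSubharmonic u) :
    ∃ (u₁ u₂ : ℂ → EReal) (μ ν σ : Measure ℂ), IsSubharmonic u₁ ∧ IsSubharmonic u₂ ∧
      (∀ z, ¬ (u₁ z = ⊥ ∧ u₂ z = ⊥) → u z = u₁ z - u₂ z) ∧
      IsRieszMeasure (fun z => (u₁ z).toReal) (μ + σ) ∧
      IsRieszMeasure (fun z => (u₂ z).toReal) (ν + σ) ∧ IsLaplacianJordan u μ ν := by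
  obtain ⟨u₁, u₂, hu₁, hu₂, h⟩ := hu
  obtain ⟨m₁, i₁, h₁⟩ := exists_rieszMeasure hu₁.hasSubharmonicMeans
  obtain ⟨m₂, i₂, h₂⟩ := exists_rieszMeasure hu₂.hasSubharmonicMeans
  obtain ⟨μ, ν, σ, rfl, rfl, hs⟩ := exists_eq_add_mutuallySingular m₁ m₂
  exact ⟨u₁, u₂, μ, ν, σ, hu₁, hu₂, h, ⟨i₁, h₁⟩, ⟨i₂, h₂⟩,
    isLaplacianJordan_of_sub hu₁ hu₂ h ⟨i₁, h₁⟩ ⟨i₂, h₂⟩ hs⟩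

/-! ### The counting function -/

section counting

/-- The kernel is the integral of dt/t over those t in (r₀, r] with |z| < t; Fubini turns its
integral into one of the masses of discs. -/
theorem integral_annularKernel_eq (ν : Measure ℂ) [IsLocallyFiniteMeasure ν] {r₀ r : ℝ}
    (h₀ : 0 < r₀) (h : r₀ ≤ r) :
    ∫ z, annularKernel r₀ r z ∂ν = ∫ t in r₀..r, ν.real (Metric.ball 0 t) * t⁻¹ := by
  set B := Metric.ball (0 : ℂ) r with hB
  set f : ℂ → ℝ → ℝ := fun z => (Ioi ‖z‖).indicator fun t => t⁻¹ with hf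
  have hBfin : IsFiniteMeasure (ν.restrict B) := ⟨by
    rw [Measure.restrict_apply_univ]; exact Metric.isBounded_ball.measure_lt_top⟩
  have hmeas : Measurable (Function.uncurry f) := by
    have : Function.uncurry f = {p : ℂ × ℝ | ‖p.1‖ < p.2}.indicator fun p => p.2⁻¹ := by
      ext p
      simp only [hf, Function.uncurry, indicator, mem_Ioi, mem_ofPred_eq]
    rw [this]
    exact (measurable_snd.inv).indicator (measurableSet_lt measurable_fst.norm measurable_snd)
  have hint : Integrable (Function.uncurry f)
      ((ν.restrict B).prod (volume.restrict (Ioc r₀ r))) := by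
    refine Integrable.of_bound hmeas.aestronglyMeasurable r₀⁻¹ ?_
    refine (Measure.ae_prod_iff_ae_ae ?_).2 ?_
    · exact measurableSet_le hmeas.norm measurable_const
    refine ae_of_all _ fun z => ?_
    filter_upwards [ae_restrict_mem measurableSet_Ioc] with t ht
    have ht0 : 0 < t := h₀.trans ht.1
    simp only [hf, Function.uncurry]
    refine (norm_indicator_le_norm_self _ _).trans ?_
    rw [norm_inv, Real.norm_of_nonneg ht0.le]
    exact inv_anti₀ h₀ ht.1.le
  have e1 : ∫ z, annularKernel r₀ r z ∂ν = ∫ z in B, (∫ t in Ioc r₀ r, f z t) ∂ν := by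
    rw [← setIntegral_eq_integral_of_forall_compl_eq_zero (s := B)]
    · refine integral_congr_ae (ae_of_all _ fun z => ?_)
      simp only [hf]
      rw [← intervalIntegral.integral_of_le h, integral_indicator_div_eq_annularKernel h₀ h]
    · intro z hz
      exact annularKernel_of_le h (by simpa [hB] using hz)
  rw [e1, integral_integral_swap hint, intervalIntegral.integral_of_le h]
  refine setIntegral_congr_fun measurableSet_Ioc fun t ht => ?_
  have e2 : ∀ z, f z t = (Metric.ball (0 : ℂ) t).indicator (fun _ => t⁻¹) z := fun z => by
    simp only [hf, indicator, mem_Ioi, mem_ball_zero_iff]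
  simp only [e2]
  rw [integral_indicator_const _ Metric.isOpen_ball.measurableSet, smul_eq_mul,
    measureReal_restrict_apply Metric.isOpen_ball.measurableSet,
    inter_eq_left.2 (Metric.ball_subset_ball ht.2)]

theorem intervalIntegrable_real_ball_mul_inv (ν : Measure ℂ) [IsLocallyFiniteMeasure ν] {r₀ r : ℝ}
    (h₀ : 0 < r₀) (h : r₀ ≤ r) :
    IntervalIntegrable (fun t => ν.real (Metric.ball 0 t) * t⁻¹) volume r₀ r := by
  refine IntervalIntegrable.mul_continuousOn ?_ ?_
  · refine Monotone.intervalIntegrable fun s t hst => ?_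
    exact measureReal_mono (Metric.ball_subset_ball hst) Metric.isBounded_ball.measure_lt_top.ne
  · rw [uIcc_of_le h]
    exact continuousOn_inv₀.mono fun t ht => (h₀.trans_le ht.1).ne'

/-- Away from 0 the subtraction of n_s(0, u) is compensated by the logarithmic term, so the
increment is the integral of n_s(t, u)/t. Finiteness is used to split the integral that starts at 0.
-/
theorem NS_sub_NS {u : ℂ → EReal} {ν : Measure ℂ} [IsLocallyFiniteMeasure ν]
    (hν : laplacianNeg u = ν) (hu : NSFinite u) {r₀ r : ℝ} (h₀ : 0 < r₀) (h : r₀ ≤ r) :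
    NS r u - NS r₀ u = (2 * Real.pi)⁻¹ * ∫ z, annularKernel r₀ r z ∂ν := by
  have hi : ∀ {a b : ℝ}, 0 < a → a ≤ b →
      IntervalIntegrable (fun t => nS t u / t) volume a b := fun ha hab => by
    have := (intervalIntegrable_real_ball_mul_inv ν ha hab).const_mul (2 * Real.pi)⁻¹
    refine this.congr fun t _ => ?_
    simp only [nS, hν]
    ring
  have hinv : ∀ {a b : ℝ}, 0 < a → a ≤ b →
      IntervalIntegrable (fun t => nSZero u / t) volume a b := fun {a b} ha hab => by
    refine ContinuousOn.intervalIntegrable ?_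
    rw [uIcc_of_le hab]
    exact continuousOn_const.div continuousOn_id fun t ht => (ha.trans_le ht.1).ne'
  have hi' : ∀ {a b : ℝ}, 0 < a → a ≤ b →
      IntervalIntegrable (fun t => (nS t u - nSZero u) / t) volume a b := fun ha hab => by
    simp only [sub_div]
    exact (hi ha hab).sub (hinv ha hab)
  have h01 : ∀ {b : ℝ}, 0 < b →
      IntervalIntegrable (fun t => (nS t u - nSZero u) / t) volume 0 b := fun {b} hb => by
    rcases le_total 1 b with h1 | h1
    · exact hu.trans (hi' one_pos h1)
    · refine hu.mono_set ?_
      rw [uIcc_of_le hb.le, uIcc_of_le zero_le_one]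
      exact Icc_subset_Icc_right h1
  have e1 : (∫ t in (0 : ℝ)..r, (nS t u - nSZero u) / t)
      - ∫ t in (0 : ℝ)..r₀, (nS t u - nSZero u) / t
      = ∫ t in r₀..r, (nS t u - nSZero u) / t :=
    intervalIntegral.integral_interval_sub_left (h01 (h₀.trans_le h)) (h01 h₀)
  have e2 : ∫ t in r₀..r, (nS t u - nSZero u) / t
      = (∫ t in r₀..r, nS t u / t) - nSZero u * (Real.log r - Real.log r₀) := by
    simp only [sub_div]
    rw [intervalIntegral.integral_sub (hi h₀ h) (hinv h₀ h)]
    congr 1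
    simp only [div_eq_mul_inv]
    rw [intervalIntegral.integral_const_mul, integral_inv_of_pos h₀ (h₀.trans_le h),
      Real.log_div (h₀.trans_le h).ne' h₀.ne']
  have e3 : ∫ t in r₀..r, nS t u / t = (2 * Real.pi)⁻¹ * ∫ z, annularKernel r₀ r z ∂ν := by
    rw [integral_annularKernel_eq ν h₀ h, ← intervalIntegral.integral_const_mul]
    refine intervalIntegral.integral_congr fun t _ => ?_
    simp only [nS, hν]
    ring
  rw [NS, NS, ← e3]
  linarith

theorem integral_annularKernel_map_sub (ν : Measure ℂ) (c : ℂ) (r₀ r : ℝ) :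
    ∫ z, annularKernel r₀ r z ∂(ν.map fun z => z - c) = ∫ z, annularKernel r₀ r (z - c) ∂ν :=
  MeasurableEmbedding.integral_map (Homeomorph.subRight c).measurableEmbedding _

theorem IsLaplacianJordan.NS_shift_sub_NS_shift {u : ℂ → EReal} {μ ν : Measure ℂ}
    (h : IsLaplacianJordan u μ ν) (c : ℂ) (hu : NSFinite (ShiftInvariance.shift c u)) {r₀ r : ℝ}
    (h₀ : 0 < r₀) (hr : r₀ ≤ r) :
    NS r (ShiftInvariance.shift c u) - NS r₀ (ShiftInvariance.shift c u)
      = (2 * Real.pi)⁻¹ * ∫ z, annularKernel r₀ r (z - c) ∂ν := by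
  have := h.locallyFinite_neg
  have := isLocallyFiniteMeasure_map_sub ν c
  rw [NS_sub_NS (h.shift c).laplacianNeg_eq hu h₀ hr, integral_annularKernel_map_sub]

theorem NS_eq_zero {u : ℂ → EReal} (hν : laplacianNeg u = 0) (r : ℝ) : NS r u = 0 := by
  simp [NS, nS, nSZero, hν]

/-- Absorbs the factor 1/2π into the measure, and keeps track of its vanishing for the degenerate
case. -/
theorem exists_smul_measure (ν : Measure ℂ) [IsLocallyFiniteMeasure ν] {a : ℝ} (ha : 0 < a) :
    ∃ ν' : Measure ℂ, IsLocallyFiniteMeasure ν' ∧ (ν' = 0 → ν = 0) ∧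
      ∀ f : ℂ → ℝ, ∫ z, f z ∂ν' = a * ∫ z, f z ∂ν := by
  refine ⟨Real.toNNReal a • ν, inferInstance, fun h => ?_, fun f => ?_⟩
  · have ha' : Real.toNNReal a ≠ 0 := (Real.toNNReal_pos.2 ha).ne'
    exact (smul_eq_zero.1 h).resolve_left ha'
  · rw [integral_smul_nnreal_measure, NNReal.smul_def, Real.coe_toNNReal _ ha.le, smul_eq_mul]

theorem equivOutsideSmallSet_NS (c : ℂ) {u : ℂ → EReal} (hu : IsDeltaSubharmonic u)
    (h0 : NSFinite u) (hc : NSFinite (shift c u)) :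
    EquivOutsideSmallSet (fun r => NS r (shift c u)) fun r => NS r u := by
  obtain ⟨-, -, μ, ν, -, -, -, -, -, -, hJ⟩ := hu.exists_isLaplacianJordan
  have := hJ.locallyFinite_neg
  obtain ⟨ν', _, h1, h2⟩ := exists_smul_measure ν (a := (2 * Real.pi)⁻¹) (by positivity)
  refine equivOutsideSmallSet_of_eq_integral_or (μ := ν') (c := c)
    (fun r₀ r h₀ hr => ?_) (fun r₀ r h₀ hr => ?_) fun h => Eventually.of_forall fun r => ?_
  · rw [NS_sub_NS hJ.laplacianNeg_eq h0 h₀ hr, h2]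
  · rw [hJ.NS_shift_sub_NS_shift c hc h₀ hr, h2 fun z => annularKernel r₀ r (z - c)]
  · have hz : ν = 0 := h1 h
    simp only
    rw [NS_eq_zero (by rw [(hJ.shift c).laplacianNeg_eq, hz, Measure.map_zero]),
      NS_eq_zero (by rw [hJ.laplacianNeg_eq, hz])]

end counting

/-! ### Maxima of subharmonic functions -/

theorem circleMean_mono {u v : ℂ → EReal} (h : ∀ z, u z ≤ v z) (z : ℂ) (r : ℝ) :
    circleMean u z r ≤ circleMean v z r := by
  rw [circleMean_eq, circleMean_eq]
  refine EReal.sub_le_sub ?_ ?_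
  · exact_mod_cast lintegral_mono fun θ => EReal.toENNReal_le_toENNReal (h _)
  · exact_mod_cast lintegral_mono fun θ => EReal.toENNReal_le_toENNReal
      (EReal.neg_le_neg_iff.2 (h _))

theorem circleMean_eq_circleAverage {u : ℂ → EReal} {z : ℂ} {r : ℝ} (ht : ∀ z, u z ≠ ⊤)
    (hb : ∀ᵐ θ ∂angleMeasure, u (circleMap z r θ) ≠ ⊥)
    (hi : CircleIntegrable (fun z => (u z).toReal) z r) :
    circleMean u z r = circleAverage (fun z => (u z).toReal) z r := by
  have hint := circleIntegrable_iff_integrable.1 hi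
  rw [circleMean_eq, circleAverage_eq_integral,
    integral_eq_lintegral_pos_part_sub_lintegral_neg_part hint]
  have hP : ∫⁻ θ, ENNReal.ofReal (u (circleMap z r θ)).toReal ∂angleMeasure
      = ∫⁻ θ, (u (circleMap z r θ)).toENNReal ∂angleMeasure :=
    lintegral_congr fun θ => (EReal.toENNReal_of_ne_top (ht _)).symm
  have hN : ∫⁻ θ, ENNReal.ofReal (-(u (circleMap z r θ)).toReal) ∂angleMeasure
      = ∫⁻ θ, (-u (circleMap z r θ)).toENNReal ∂angleMeasure := by
    refine lintegral_congr_ae (hb.mono fun θ hθ => ?_)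
    simp only
    rw [EReal.toENNReal_of_ne_top (by simpa using hθ), EReal.toReal_neg_eq]
  have hPfin : ∫⁻ θ, ENNReal.ofReal (u (circleMap z r θ)).toReal ∂angleMeasure ≠ ⊤ :=
    (lt_of_le_of_lt (lintegral_mono fun θ => ENNReal.ofReal_le_ofReal (le_abs_self _))
      (by simpa [hasFiniteIntegral_iff_norm] using hint.hasFiniteIntegral)).ne
  have hNfin : ∫⁻ θ, ENNReal.ofReal (-(u (circleMap z r θ)).toReal) ∂angleMeasure ≠ ⊤ :=
    (lt_of_le_of_lt (lintegral_mono fun θ => ENNReal.ofReal_le_ofReal (neg_le_abs _))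
      (by simpa [hasFiniteIntegral_iff_norm] using hint.hasFiniteIntegral)).ne
  rw [EReal.coe_sub, EReal.coe_ennreal_toReal hPfin, EReal.coe_ennreal_toReal hNfin, hP, hN]

theorem IsSubharmonic.sup {u v : ℂ → EReal} (hu : IsSubharmonic u) (hv : IsSubharmonic v) :
    IsSubharmonic fun z => max (u z) (v z) where
  ne_top z := by
    rcases max_choice (u z) (v z) with h | h <;> rw [h]
    · exact hu.ne_top z
    · exact hv.ne_top z
  exists_ne_bot := by
    obtain ⟨z, hz⟩ := hu.exists_ne_bot
    exact ⟨z, fun h => hz (le_bot_iff.1 ((le_max_left _ _).trans h.le))⟩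
  upperSemicontinuous := hu.upperSemicontinuous.sup hv.upperSemicontinuous
  le_circleMean z r hr := max_le
    ((hu.le_circleMean z r hr).trans (circleMean_mono (fun _ => le_max_left _ _) z r))
    ((hv.le_circleMean z r hr).trans (circleMean_mono (fun _ => le_max_right _ _) z r))

/-! ### Increments of the means of a subharmonic function -/

theorem circleAverage_shift {α : Type*} (g : α → ℝ) (u : ℂ → α) (c : ℂ) (r : ℝ) :
    circleAverage (fun z => g (shift c u z)) 0 r = circleAverage (fun z => g (u z)) c r :=
  Real.circleAverage_map_add_const (f := fun z => g (u z))

theorem IsSubharmonic.exists_measure {u : ℂ → EReal} (hu : IsSubharmonic u) :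
    ∃ μ : Measure ℂ, IsLocallyFiniteMeasure μ ∧ ∀ (c : ℂ) (r₀ r : ℝ), 0 < r₀ → r₀ ≤ r →
      circleAverage (fun z => (u z).toReal) c r - circleAverage (fun z => (u z).toReal) c r₀
        = ∫ z, annularKernel r₀ r (z - c) ∂μ := by
  have hv := hu.hasSubharmonicMeans
  obtain ⟨m, hm, h⟩ := exists_rieszMeasure hv
  obtain ⟨μ, h1, -, h2⟩ := exists_smul_measure m (a := (2 * Real.pi)⁻¹) (by positivity)
  refine ⟨μ, h1, fun c r₀ r h₀ hr => ?_⟩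
  rw [h2 fun z => annularKernel r₀ r (z - c),
    (IsRieszMeasure.mk hm h).integral_annularKernel hv c h₀ hr]
  have := Real.pi_pos
  field_simp

theorem cartanS_shift (u : ℂ → EReal) (c : ℂ) (r : ℝ) :
    cartanS r (shift c u) = circleAverage (fun z => (u z).toReal) c r :=
  circleAverage_shift EReal.toReal u c r

theorem equivOutsideSmallSet_cartanS (c : ℂ) {u : ℂ → EReal} (hu : IsSubharmonic u)
    (htop : Tendsto (fun r => cartanS r u) atTop atTop) :
    EquivOutsideSmallSet (fun r => cartanS r (shift c u)) fun r => cartanS r u := by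
  obtain ⟨μ, _, h⟩ := hu.exists_measure
  refine equivOutsideSmallSet_of_eq_integral (μ := μ) (c := c) (fun r₀ r h₀ hr => ?_)
    (fun r₀ r h₀ hr => ?_) htop
  · simpa [cartanS] using h 0 r₀ r h₀ hr
  · simpa only [cartanS_shift] using h c r₀ r h₀ hr

/-! ### Holomorphic curves -/

section curve

theorem ae_circleMap_apply_ne_zero {f : ℂ → ℂ} (hf : Differentiable ℂ f) {z : ℂ} (hz : f z ≠ 0)
    (c : ℂ) {r : ℝ} (hr : 0 < r) : ∀ᵐ θ ∂angleMeasure, f (circleMap c r θ) ≠ 0 := by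
  have ha : AnalyticOnNhd ℂ f univ := fun w _ => hf.analyticAt w
  have h1 : f ⁻¹' {0}ᶜ ∈ codiscreteWithin (Metric.sphere c |r|) :=
    codiscreteWithin_mono (subset_univ _) (ha.preimage_zero_mem_codiscrete hz)
  rw [ae_angleMeasure_iff]
  exact ae_restrict_le_codiscreteWithin measurableSet_Ioc
    (codiscreteWithin_mono (by tauto) (circleMap_preimage_codiscrete hr.ne' h1))

theorem log_enorm_toReal (w : ℂ) : (ENNReal.log ‖w‖ₑ).toReal = Real.log ‖w‖ := by
  rw [← ofReal_norm, ENNReal.log_ofReal]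
  split_ifs with h
  · rw [le_antisymm h (norm_nonneg w), Real.log_zero, EReal.toReal_bot]
  · rfl

/-- Jensen's formula for entire functions: where f(z) ≠ 0, the mean of log |f| exceeds log |f(z)| by
a sum over the zeros in the disc, with nonnegative terms. -/
theorem log_enorm_le_circleMean {f : ℂ → ℂ} (hf : Differentiable ℂ f) (z : ℂ) {r : ℝ}
    (hr : 0 < r) : ENNReal.log ‖f z‖ₑ ≤ circleMean (fun z => ENNReal.log ‖f z‖ₑ) z r := by
  rcases eq_or_ne (f z) 0 with h0 | h0
  · simp [h0]
  have htop : ∀ z, ENNReal.log ‖f z‖ₑ ≠ ⊤ := fun z => by simp [ENNReal.log_eq_top_iff]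
  have hcirc : CircleIntegrable (fun z => (ENNReal.log ‖f z‖ₑ).toReal) z r := by
    simp only [log_enorm_toReal]
    exact MeromorphicOn.circleIntegrable_log_norm fun w _ => (hf.analyticAt w).meromorphicAt
  rw [circleMean_eq_circleAverage htop _ hcirc]
  · have hne : ENNReal.log ‖f z‖ₑ ≠ ⊥ := by simpa [ENNReal.log_eq_bot_iff] using h0
    rw [← EReal.coe_toReal (htop z) hne, EReal.coe_le_coe_iff]
    simp only [log_enorm_toReal]
    have ha : AnalyticOnNhd ℂ f (Metric.closedBall z |r|) := fun w _ => hf.analyticAt w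
    rw [AnalyticOnNhd.circleAverage_log_norm hr.ne' ha h0, le_add_iff_nonneg_left]
    refine finsum_nonneg fun w => ?_
    by_cases hw : w ∈ Metric.closedBall z |r|
    · refine mul_nonneg ?_ ?_
      · exact_mod_cast (MeromorphicOn.AnalyticOnNhd.divisor_nonneg ha) w
      · rcases eq_or_ne w z with rfl | hne
        · simp
        · refine Real.log_nonneg ?_
          rw [← div_eq_mul_inv, one_le_div (norm_pos_iff.2 (sub_ne_zero.2 hne.symm))]
          rwa [Metric.mem_closedBall, abs_of_pos hr, dist_comm, dist_eq_norm] at hw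
    · rw [Function.locallyFinsuppWithin.apply_eq_zero_of_notMem _ hw]
      simp
  · filter_upwards [ae_circleMap_apply_ne_zero hf h0 z hr] with θ hθ
    simpa [ENNReal.log_eq_bot_iff] using hθ

variable {n : ℕ} {f : Fin (n + 1) → ℂ → ℂ}

theorem exists_curvePotential_eq (f : Fin (n + 1) → ℂ → ℂ) (z : ℂ) :
    ∃ j, curvePotential f z = ENNReal.log ‖f j z‖ₑ := by
  obtain ⟨j, hj⟩ := exists_eq_ciSup_of_finite (f := fun j => ENNReal.log ‖f j z‖ₑ)
  exact ⟨j, hj.symm⟩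

theorem IsReducedRepresentation.curvePotential_ne_bot (hf : IsReducedRepresentation f) (z : ℂ) :
    curvePotential f z ≠ ⊥ := by
  obtain ⟨j, hj⟩ := hf.no_common_zero z
  intro h
  have h1 : ENNReal.log ‖f j z‖ₑ ≤ ⊥ :=
    h ▸ le_iSup (fun j => ENNReal.log ‖f j z‖ₑ) j
  simp [ENNReal.log_eq_bot_iff, hj] at h1

theorem IsReducedRepresentation.isSubharmonic (hf : IsReducedRepresentation f) :
    IsSubharmonic (curvePotential f) where
  ne_top z := by
    obtain ⟨j, hj⟩ := exists_curvePotential_eq f z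
    rw [hj]
    simp [ENNReal.log_eq_top_iff]
  exists_ne_bot := ⟨0, hf.curvePotential_ne_bot 0⟩
  upperSemicontinuous := by
    have h : curvePotential f = fun z => Finset.univ.sup fun j => ENNReal.log ‖f j z‖ₑ := by
      ext z
      rw [Finset.sup_univ_eq_iSup, curvePotential]
    rw [h]
    refine Continuous.upperSemicontinuous (Continuous.finset_sup_apply fun j _ => ?_)
    exact ENNReal.continuous_log.comp (hf.entire j).continuous.enorm
  le_circleMean z r hr := by
    obtain ⟨j, hj⟩ := exists_curvePotential_eq f z
    rw [hj]
    exact (log_enorm_le_circleMean (hf.entire j) z hr).trans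
      (circleMean_mono (fun w => le_iSup (fun j => ENNReal.log ‖f j w‖ₑ) j) z r)

theorem circleAverage_eq_apply_of_forall_eq {v : ℂ → ℝ} {z : ℂ} (hz : IsMeanPoint v z)
    (h : ∀ r₀ r, 0 < r₀ → r₀ ≤ r → circleAverage v z r = circleAverage v z r₀) {r : ℝ}
    (hr : 0 < r) : circleAverage v z r = v z := by
  refine tendsto_nhds_unique (tendsto_const_nhds.congr' ?_) hz.2
  filter_upwards [Ioc_mem_nhdsGT hr] with s hs
  exact h s r hs.1 hs.2

theorem equivOutsideSmallSet_cartanCurve (c : ℂ) (hf : IsReducedRepresentation f) :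
    EquivOutsideSmallSet (fun r => cartanCurve r fun j => shift c (f j))
      fun r => cartanCurve r f := by
  set U := curvePotential f with hU
  have hUs : IsSubharmonic U := hf.isSubharmonic
  have hc : curvePotential (fun j => shift c (f j)) = shift c U := rfl
  obtain ⟨μ, _, h⟩ := hUs.exists_measure
  have e1 : ∀ r, cartanCurve r (fun j => shift c (f j))
      = circleAverage (fun z => (U z).toReal) c r - (U c).toReal := fun r => by
    rw [cartanCurve, hc, cartanS_shift, shift, zero_add]
  have e2 : ∀ r, cartanCurve r f
      = circleAverage (fun z => (U z).toReal) 0 r - (U 0).toReal := fun r => rfl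
  simp only [e1, e2]
  refine equivOutsideSmallSet_of_eq_integral_or (μ := μ) (c := c) (fun r₀ r h₀ hr => ?_)
    (fun r₀ r h₀ hr => ?_) fun hμ => ?_
  · rw [sub_sub_sub_cancel_right, h 0 r₀ r h₀ hr]
    simp
  · rw [sub_sub_sub_cancel_right, h c r₀ r h₀ hr]
  -- With zero Riesz measure every circle mean equals the value at its centre, so both
  -- characteristics vanish thanks to their normalisation.
  · have key : ∀ (a : ℂ) (r : ℝ), 0 < r →
        circleAverage (fun z => (U z).toReal) a r = (U a).toReal := fun a r hr =>
      circleAverage_eq_apply_of_forall_eq (hUs.isMeanPoint (hf.curvePotential_ne_bot a))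
        (fun r₀ r h₀ hr => by
          have := h a r₀ r h₀ hr
          rw [hμ, integral_zero_measure] at this
          linarith) hr
    filter_upwards [eventually_gt_atTop 0] with r hr
    rw [key c r hr, key 0 r hr, sub_self, sub_self]

end curve

/-! ### Common mass of two Riesz measures and the Riesz measure of the maximum -/

section max

theorem integral_annularKernel_volume {ε ρ : ℝ} (hε : 0 < ε) (hρ : 0 < ρ) :
    ∫ z, annularKernel ε ρ z = Real.pi / 2 * (ρ ^ 2 - ε ^ 2) := by
  have h : annularKernel ε ρ =ᵐ[volume] fun z => logKernel ρ z - logKernel ε z := by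
    filter_upwards [compl_mem_ae_iff.2 (measure_singleton (μ := (volume : Measure ℂ)) 0)]
      with z hz
    rw [logKernel_eq hρ hz, logKernel_eq hε hz, annularKernel]
    ring
  rw [integral_congr_ae h, integral_sub (integrable_logKernel hρ) (integrable_logKernel hε),
    integral_logKernel hρ, integral_logKernel hε]
  ring

variable {σ : Measure ℂ} [IsLocallyFiniteMeasure σ]

theorem le_integral_mul_annularKernel {Φ : ℂ → ℝ} (hΦ : Continuous Φ) (hΦs : HasCompactSupport Φ)
    {η ε ρ : ℝ} (hε : 0 < ε) (hερ : ε ≤ ρ) {a : ℂ} (h : ∀ z, ‖a - z‖ ≤ ρ → Φ a - η ≤ Φ z) :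
    Real.pi / 2 * (ρ ^ 2 - ε ^ 2) * (Φ a - η) ≤ ∫ z, Φ z * annularKernel ε ρ (a - z) := by
  have hρ : 0 < ρ := hε.trans_le hερ
  have hk : Integrable fun z => annularKernel ε ρ (a - z) :=
    (show Integrable (annularKernel ε ρ) volume by
      simpa using integrable_annularKernel_sub volume hε hερ 0).comp_sub_left a
  have hc : Continuous fun z => annularKernel ε ρ (a - z) :=
    (continuous_annularKernel hε hρ).comp (continuous_const.sub continuous_id)
  rw [← integral_annularKernel_volume hε hρ,
    ← integral_sub_left_eq_self (annularKernel ε ρ) volume a, ← integral_mul_const]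
  refine integral_mono (hk.mul_const _)
    ((hΦ.mul hc).integrable_of_hasCompactSupport hΦs.mul_right) fun z => ?_
  simp only
  rw [mul_comm]
  rcases le_total ρ ‖a - z‖ with hz | hz
  · rw [annularKernel_of_le hερ hz]; simp
  · exact mul_le_mul_of_nonneg_right (h z hz) (annularKernel_nonneg hε hερ _)

open scoped Pointwise in
theorem integral_mul_integral_annularKernel {Φ : ℂ → ℝ} (hΦ : Continuous Φ)
    (hΦs : HasCompactSupport Φ) {ε ρ : ℝ} (hε : 0 < ε) (hερ : ε ≤ ρ) :
    Integrable (fun z => Φ z * ∫ a, annularKernel ε ρ (a - z) ∂σ) ∧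
    Integrable (fun a => ∫ z, Φ z * annularKernel ε ρ (a - z)) σ ∧
    ∫ z, Φ z * ∫ a, annularKernel ε ρ (a - z) ∂σ
      = ∫ a, (∫ z, Φ z * annularKernel ε ρ (a - z)) ∂σ := by
  set F : ℂ × ℂ → ℝ := fun p => Φ p.1 * annularKernel ε ρ (p.2 - p.1) with hF
  have hFc : Continuous F := (hΦ.comp continuous_fst).mul
    ((continuous_annularKernel hε (hε.trans_le hερ)).comp (continuous_snd.sub continuous_fst))
  have hFs : HasCompactSupport F := by
    refine HasCompactSupport.intro (hΦs.isCompact.prod (hΦs.isCompact.add (isCompact_closedBall (0 : ℂ) ρ)))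
      fun p hp => ?_
    simp only [hF]
    by_cases h1 : p.1 ∈ tsupport Φ
    · have h2 : p.2 ∉ tsupport Φ + Metric.closedBall (0 : ℂ) ρ := fun h => hp ⟨h1, h⟩
      have h3 : ρ ≤ ‖p.2 - p.1‖ := by
        by_contra! hlt
        exact h2 ⟨p.1, h1, p.2 - p.1, by simpa using hlt.le, by simp⟩
      rw [annularKernel_of_le hερ h3, mul_zero]
    · rw [image_eq_zero_of_notMem_tsupport h1, zero_mul]
  have hFi : Integrable F ((volume : Measure ℂ).prod σ) := hFc.integrable_of_hasCompactSupport hFs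
  refine ⟨?_, hFi.integral_prod_right, ?_⟩
  · have := hFi.integral_prod_left
    simpa only [hF, integral_const_mul] using this
  · rw [← integral_integral_swap hFi]
    simp only [integral_const_mul]

/-- As ρ → 0 the suitably normalised kernel is an approximate identity. The inner radius must be
positive to keep the kernel continuous; with ρ² the mass is π/2 (ρ² - ρ⁴), which the factor 4/ρ² ·
1/2π turns into 1 - ρ² → 1. -/
theorem le_of_tendsto_integral_annularKernel {Φ : ℂ → ℝ} (hΦ : Continuous Φ)
    (hΦs : HasCompactSupport Φ) {L : ℝ} {J : ℝ → ℝ} (hJ : Tendsto J (𝓝[>] 0) (𝓝 L))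
    (h : ∀ ρ, 0 < ρ → ρ < 1 → 4 / ρ ^ 2 * ∫ z, Φ z * ((2 * Real.pi)⁻¹ *
      ∫ a, annularKernel (ρ ^ 2) ρ (a - z) ∂σ) ≤ J ρ) : ∫ z, Φ z ∂σ ≤ L := by
  have hΦi : Integrable Φ σ := hΦ.integrable_of_hasCompactSupport hΦs
  obtain ⟨R, hR⟩ := hΦs.isBounded.subset_closedBall 0
  set B := Metric.closedBall (0 : ℂ) (R + 1)
  have hBm : MeasurableSet B := measurableSet_closedBall
  have hBfin : σ B ≠ ⊤ := (isCompact_closedBall (0 : ℂ) (R + 1)).measure_lt_top.ne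
  have key : ∀ η, 0 < η → ∫ z, Φ z ∂σ - η * σ.real B ≤ L := fun η hη => by
    obtain ⟨δ, hδ, hunif⟩ := Metric.uniformContinuous_iff.1
      (hΦs.uniformContinuous_of_continuous hΦ) η hη
    have hlim : Tendsto (fun ρ : ℝ => (1 - ρ ^ 2) * (∫ z, Φ z ∂σ - η * σ.real B)) (𝓝[>] 0)
        (𝓝 (∫ z, Φ z ∂σ - η * σ.real B)) := by
      have : Continuous fun ρ : ℝ => (1 - ρ ^ 2) * (∫ z, Φ z ∂σ - η * σ.real B) := by fun_prop
      simpa using (this.tendsto 0).mono_left nhdsWithin_le_nhds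
    refine le_of_tendsto_of_tendsto hlim hJ ?_
    filter_upwards [Ioo_mem_nhdsGT (lt_min hδ one_pos)] with ρ hρ
    have hρ0 : 0 < ρ := hρ.1
    have hρδ : ρ < δ := hρ.2.trans_le (min_le_left _ _)
    have hρ1 : ρ < 1 := hρ.2.trans_le (min_le_right _ _)
    have hε : 0 < ρ ^ 2 := by positivity
    have hερ : ρ ^ 2 ≤ ρ := by nlinarith
    refine le_trans ?_ (h ρ hρ0 hρ1)
    obtain ⟨-, hi2, hsw⟩ := integral_mul_integral_annularKernel (σ := σ) hΦ hΦs hε hερ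
    have e1 : ∫ z, Φ z * ((2 * Real.pi)⁻¹ * ∫ a, annularKernel (ρ ^ 2) ρ (a - z) ∂σ)
        = (2 * Real.pi)⁻¹ * ∫ z, Φ z * ∫ a, annularKernel (ρ ^ 2) ρ (a - z) ∂σ := by
      rw [← integral_const_mul]
      congr 1
      ext z
      ring
    rw [e1, hsw]
    set κ := Real.pi / 2 * (ρ ^ 2 - (ρ ^ 2) ^ 2) with hκ
    have hle : κ * (∫ z, Φ z ∂σ - η * σ.real B)
        ≤ ∫ a, (∫ z, Φ z * annularKernel (ρ ^ 2) ρ (a - z)) ∂σ := by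
      have hi3 : Integrable (fun a => κ * (Φ a - B.indicator (fun _ => η) a)) σ :=
        (hΦi.sub ((integrable_indicator_iff hBm).2 (integrableOn_const hBfin))).const_mul _
      have e2 : ∫ a, κ * (Φ a - B.indicator (fun _ => η) a) ∂σ
          = κ * (∫ z, Φ z ∂σ - η * σ.real B) := by
        rw [integral_const_mul, integral_sub hΦi
          ((integrable_indicator_iff hBm).2 (integrableOn_const hBfin)),
          integral_indicator_const _ hBm, smul_eq_mul, mul_comm η]
      rw [← e2]
      refine integral_mono hi3 hi2 fun a => ?_
      refine le_integral_mul_annularKernel hΦ hΦs hε hερ fun z hz => ?_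
      by_cases ha : a ∈ B
      · rw [indicator_of_mem ha]
        have := hunif (a := a) (b := z) (by rw [dist_eq_norm]; exact hz.trans_lt hρδ)
        rw [Real.dist_eq, abs_lt] at this
        linarith [this.2]
      · rw [indicator_of_notMem ha, sub_zero]
        have ha' : R + 1 < ‖a‖ := by simpa [B] using ha
        have h1 : ∀ w, R < ‖w‖ → Φ w = 0 := fun w hw => by
          by_contra hne
          have := hR (subset_tsupport Φ hne)
          rw [mem_closedBall_zero_iff] at this
          linarith
        rw [h1 a (by linarith), h1 z]
        have := norm_add_le (a - z) z
        rw [sub_add_cancel] at this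
        linarith
    calc (1 - ρ ^ 2) * (∫ z, Φ z ∂σ - η * σ.real B)
        = 4 / ρ ^ 2 * ((2 * Real.pi)⁻¹ * (κ * (∫ z, Φ z ∂σ - η * σ.real B))) := by
          have := Real.pi_pos
          rw [hκ]
          field_simp
          ring
      _ ≤ _ := by gcongr
  refine le_of_forall_pos_le_add fun ε hε => ?_
  have := key (ε / (σ.real B + 1)) (by positivity)
  have h2 : ε / (σ.real B + 1) * σ.real B ≤ ε := by
    rw [div_mul_eq_mul_div, div_le_iff₀ (by positivity)]
    nlinarith [measureReal_nonneg (μ := σ) (s := B)]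
  linarith

end max

section sup

variable {u₁ u₂ : ℂ → EReal} {m₁ m₂ σ : Measure ℂ}

theorem toReal_le_toReal_sup {x y : EReal} (hx : x ≠ ⊥) (hx' : x ≠ ⊤) (hy : y ≠ ⊤) :
    x.toReal ≤ (max x y).toReal := by
  refine EReal.toReal_le_toReal (le_max_left _ _) hx ?_
  rcases max_choice x y with h | h <;> rw [h] <;> assumption

/-- By Jensen's formula the mass of σ ≤ m₁ near z bounds from below the growth of the means of u₁,
hence A_ρ u₁ - u₁ at z; a function w with the same value at z and no smaller mean inherits the
bound. -/
theorem integral_annularKernel_le_of_le (hu₁ : IsSubharmonic u₁)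
    (h₁ : IsRieszMeasure (fun z => (u₁ z).toReal) m₁) [IsLocallyFiniteMeasure σ] (hσ : σ ≤ m₁)
    {w : ℂ → ℝ} {z : ℂ} (hz : u₁ z ≠ ⊥) (hwz : w z = (u₁ z).toReal) {ε ρ : ℝ} (hε : 0 < ε)
    (hερ : ε ≤ ρ) (hwρ : circleAverage (fun z => (u₁ z).toReal) z ρ ≤ circleAverage w z ρ) :
    (2 * Real.pi)⁻¹ * ∫ a, annularKernel ε ρ (a - z) ∂σ ≤ circleAverage w z ρ - w z := by
  have := h₁.locallyFinite
  have h2 := h₁.integral_annularKernel hu₁.hasSubharmonicMeans z hε hερ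
  have h3 : ∫ a, annularKernel ε ρ (a - z) ∂σ ≤ ∫ a, annularKernel ε ρ (a - z) ∂m₁ :=
    integral_mono_measure hσ (ae_of_all _ fun a => annularKernel_nonneg hε hερ _)
      (integrable_annularKernel_sub m₁ hε hερ z)
  have h4 := (hu₁.isMeanPoint hz).1 ε hε
  have h5 : (2 * Real.pi)⁻¹ * ∫ a, annularKernel ε ρ (a - z) ∂σ
      ≤ (2 * Real.pi)⁻¹ * ∫ a, annularKernel ε ρ (a - z) ∂m₁ := by gcongr
  have h6 : (2 * Real.pi)⁻¹ * ∫ a, annularKernel ε ρ (a - z) ∂m₁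
      = circleAverage (fun z => (u₁ z).toReal) z ρ
        - circleAverage (fun z => (u₁ z).toReal) z ε := by
    rw [h2]
    have := Real.pi_pos
    field_simp
  rw [hwz]
  linarith

theorem circleAverage_le_circleAverage_sup (hu₁ : IsSubharmonic u₁) (hu₂ : IsSubharmonic u₂)
    (z : ℂ) {ρ : ℝ} (hρ : 0 < ρ) :
    circleAverage (fun z => (u₁ z).toReal) z ρ
      ≤ circleAverage (fun z => (max (u₁ z) (u₂ z)).toReal) z ρ := by
  rw [circleAverage_eq_integral, circleAverage_eq_integral]
  refine integral_mono_ae (integrable_circle hu₁.hasSubharmonicMeans z hρ)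
    (integrable_circle (hu₁.sup hu₂).hasSubharmonicMeans z hρ) ?_
  filter_upwards [(hu₁.circle_integrable z hρ).1] with θ hθ
  exact toReal_le_toReal_sup hθ (hu₁.ne_top _) (hu₂.ne_top _)

/-- The Riesz measure of `max u₁ u₂` is at least the common part of those of `u₁` and `u₂`. -/
theorem integral_le_integral_sup (hu₁ : IsSubharmonic u₁) (hu₂ : IsSubharmonic u₂)
    (h₁ : IsRieszMeasure (fun z => (u₁ z).toReal) m₁)
    (h₂ : IsRieszMeasure (fun z => (u₂ z).toReal) m₂) [IsLocallyFiniteMeasure σ] (hσ₁ : σ ≤ m₁)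
    (hσ₂ : σ ≤ m₂) {m : Measure ℂ}
    (h : IsRieszMeasure (fun z => (max (u₁ z) (u₂ z)).toReal) m) {Φ : ℂ → ℝ} (hΦ : Continuous Φ)
    (hΦs : HasCompactSupport Φ) (hΦ0 : ∀ z, 0 ≤ Φ z) : ∫ z, Φ z ∂σ ≤ ∫ z, Φ z ∂m := by
  refine le_of_tendsto_integral_annularKernel hΦ hΦs (h.tendsto Φ hΦ hΦs) fun ρ hρ hρ1 => ?_
  have hερ : ρ ^ 2 ≤ ρ := by nlinarith
  refine mul_le_mul_of_nonneg_left (integral_mono_ae ?_ (integrable_mul_circleAverage_sub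
    (hu₁.sup hu₂).hasSubharmonicMeans hΦ hΦs hρ) ?_) (by positivity)
  · have := (integral_mul_integral_annularKernel (σ := σ) hΦ hΦs (pow_pos hρ 2) hερ).1.const_mul
      (2 * Real.pi)⁻¹
    refine this.congr (ae_of_all _ fun z => ?_)
    simp only
    ring
  filter_upwards [hu₁.ae_ne_bot, hu₂.ae_ne_bot] with z hz₁ hz₂
  refine mul_le_mul_of_nonneg_left ?_ (hΦ0 z)
  -- At each point the maximum coincides with one of the two functions, and that one gives the bound
  -- since σ lies below both Riesz measures.
  rcases max_choice (u₁ z) (u₂ z) with hm | hm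
  · exact integral_annularKernel_le_of_le hu₁ h₁ hσ₁ hz₁ (by rw [hm]) (pow_pos hρ 2) hερ
      (circleAverage_le_circleAverage_sup hu₁ hu₂ z hρ)
  · refine integral_annularKernel_le_of_le hu₂ h₂ hσ₂ hz₂ (by rw [hm]) (pow_pos hρ 2) hερ ?_
    simp only [max_comm (u₁ _)]
    exact circleAverage_le_circleAverage_sup hu₂ hu₁ z hρ

/-- The difference of the two functionals is positive, so it is represented by a measure, again by
Riesz–Markov–Kakutani. -/
theorem exists_measure_sub {m σ : Measure ℂ} [IsLocallyFiniteMeasure m] [IsLocallyFiniteMeasure σ]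
    (h : ∀ Φ : ℂ → ℝ, Continuous Φ → HasCompactSupport Φ → (∀ z, 0 ≤ Φ z) →
      ∫ z, Φ z ∂σ ≤ ∫ z, Φ z ∂m) :
    ∃ τ : Measure ℂ, IsLocallyFiniteMeasure τ ∧ ∀ Φ : ℂ → ℝ, Continuous Φ → HasCompactSupport Φ →
      ∫ z, Φ z ∂τ = ∫ z, Φ z ∂m - ∫ z, Φ z ∂σ := by
  have hi : ∀ (μ : Measure ℂ) [IsLocallyFiniteMeasure μ] (f : C_c(ℂ, ℝ)),
      Integrable (fun z => f z) μ := fun μ _ f =>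
    f.continuous.integrable_of_hasCompactSupport f.hasCompactSupport
  let L : (μ : Measure ℂ) → [IsLocallyFiniteMeasure μ] → C_c(ℂ, ℝ) →ₗ[ℝ] ℝ := fun μ _ =>
    { toFun := fun f => ∫ z, f z ∂μ
      map_add' := fun f g => integral_add (hi μ f) (hi μ g)
      map_smul' := fun a f => integral_const_mul a _ }
  let Λ : C_c(ℂ, ℝ) →ₚ[ℝ] ℝ := PositiveLinearMap.mk₀ (L m - L σ) fun f hf =>
    sub_nonneg.2 (h f f.continuous f.hasCompactSupport hf)
  exact ⟨RealRMK.rieszMeasure Λ, inferInstance, fun Φ hΦ hΦs =>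
    RealRMK.integral_rieszMeasure Λ ⟨⟨Φ, hΦ⟩, hΦs⟩⟩

end sup

/-! ### The proximity function -/

/-- A Liouville-type argument. The means over discs are also A and B; the disc of radius R about b
lies in that of radius R + d about a, and for nonnegative q this gives B ≤ A((R + d)/R)², where the
ratio tends to 1 as R → ∞. -/
theorem circleAverage_const_le {q : ℂ → ℝ} (hq : Measurable q) (hqi : LocallyIntegrable q)
    (h0 : ∀ᵐ z, 0 ≤ q z) {a b : ℂ} {A B : ℝ} (ha : ∀ r, 0 < r → circleAverage q a r = A)
    (hb : ∀ r, 0 < r → circleAverage q b r = B) : B ≤ A := by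
  have hint : ∀ (c : ℂ) (R : ℝ), IntegrableOn q (Metric.ball c R) := fun c R =>
    (hqi.integrableOn_isCompact (isCompact_closedBall c R)).mono_set Metric.ball_subset_closedBall
  have key : ∀ (c : ℂ) (C : ℝ), (∀ r, 0 < r → circleAverage q c r = C) → ∀ R, 0 ≤ R →
      ∫ z in Metric.ball c R, q z = C * (Real.pi * R ^ 2) := fun c C hC R hR => by
    rw [(setIntegral_ball_eq hq (hint c R)).2]
    have : ∀ᵐ z ∂volume.restrict (Metric.ball (0 : ℂ) R), circleAverage q c ‖z‖ = C := by
      refine ae_restrict_of_ae ?_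
      filter_upwards [compl_mem_ae_iff.2 (measure_singleton (μ := (volume : Measure ℂ)) 0)]
        with z hz
      exact hC _ (norm_pos_iff.2 hz)
    rw [integral_congr_ae this, setIntegral_const, volume_ball_real _ hR, smul_eq_mul, mul_comm]
  set d := ‖b - a‖
  have hmono : ∀ R, 0 < R → B ≤ A * ((R + d) / R) ^ 2 := fun R hR => by
    have hd : 0 ≤ d := norm_nonneg _
    have hsub : Metric.ball b R ⊆ Metric.ball a (R + d) :=
      Metric.ball_subset_ball' (by rw [dist_eq_norm])
    have := setIntegral_mono_set (hint a (R + d)) (ae_restrict_of_ae h0) (LE.le.eventuallyLE hsub)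
    rw [key b B hb R hR.le, key a A ha (R + d) (by positivity)] at this
    rw [div_pow, ← mul_div_assoc, le_div_iff₀ (by positivity)]
    have hpi := Real.pi_pos
    nlinarith
  have hlim : Tendsto (fun R : ℝ => A * ((R + d) / R) ^ 2) atTop (𝓝 (A * (1 + 0) ^ 2)) := by
    refine Tendsto.const_mul _ (Tendsto.pow ?_ 2)
    refine (tendsto_const_nhds.add ((tendsto_const_nhds (x := d)).div_atTop tendsto_id)).congr' ?_
    filter_upwards [eventually_gt_atTop 0] with R hR
    simp only [id]
    field_simp
  rw [add_zero, one_pow, mul_one] at hlim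
  exact ge_of_tendsto hlim ((eventually_gt_atTop 0).mono hmono)

section nevanlinna

variable {u u₁ u₂ : ℂ → EReal}

theorem max_sub_zero_toReal {x y : EReal} (hx : x ≠ ⊥) (hx' : x ≠ ⊤) (hy : y ≠ ⊥) (hy' : y ≠ ⊤) :
    (max (x - y) 0).toReal = (max x y).toReal - y.toReal := by
  lift x to ℝ using ⟨hx', hx⟩
  lift y to ℝ using ⟨hy', hy⟩
  have hmax : ∀ a b : ℝ, max (a : EReal) b = (max a b : ℝ) := fun a b =>
    (EReal.coe_strictMono.monotone.map_max).symm
  rw [← EReal.coe_sub, ← EReal.coe_zero, hmax, hmax, EReal.toReal_coe, EReal.toReal_coe,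
    EReal.toReal_coe, ← sub_self y, max_sub_sub_right]

/-- Almost everywhere on the circle (u₁ - u₂)⁺ = max(u₁, u₂) - u₂ with finite terms. -/
theorem circleAverage_max_zero (hu₁ : IsSubharmonic u₁) (hu₂ : IsSubharmonic u₂)
    (hu : ∀ z, ¬ (u₁ z = ⊥ ∧ u₂ z = ⊥) → u z = u₁ z - u₂ z) (c : ℂ) {r : ℝ} (hr : 0 < r) :
    circleAverage (fun z => (max (u z) 0).toReal) c r
      = circleAverage (fun z => (max (u₁ z) (u₂ z)).toReal) c r
        - circleAverage (fun z => (u₂ z).toReal) c r := by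
  simp only [circleAverage_eq_integral]
  rw [← integral_sub (integrable_circle (hu₁.sup hu₂).hasSubharmonicMeans c hr)
    (integrable_circle hu₂.hasSubharmonicMeans c hr)]
  refine integral_congr_ae ?_
  filter_upwards [(hu₁.circle_integrable c hr).1, (hu₂.circle_integrable c hr).1] with θ h1 h2
  rw [hu _ fun h => h1 h.1, max_sub_zero_toReal h1 (hu₁.ne_top _) h2 (hu₂.ne_top _)]

theorem mS_shift (u : ℂ → EReal) (c : ℂ) (r : ℝ) :
    mS r (shift c u) = circleAverage (fun z => (max (u z) 0).toReal) c r :=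
  circleAverage_shift (fun x : EReal => (max x 0).toReal) u c r

/-- The increments of the proximity function belong to (m - ν - σ)/2π, with m the Riesz measure of
max(u₁, u₂). Adding the counting function restores ν, and what is left, m - σ, is positive. -/
theorem equivOutsideSmallSet_TS (c : ℂ) (hu : IsDeltaSubharmonic u) (h0 : NSFinite u)
    (hc : NSFinite (shift c u)) :
    EquivOutsideSmallSet (fun r => TS r (shift c u)) fun r => TS r u := by
  obtain ⟨u₁, u₂, μ, ν, σ, hu₁, hu₂, hsub, h₁, h₂, hJ⟩ := hu.exists_isLaplacianJordan
  have i1 := hJ.locallyFinite_pos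
  have i2 := hJ.locallyFinite_neg
  have i3 : IsLocallyFiniteMeasure σ :=
    have := h₂.locallyFinite
    Measure.isLocallyFiniteMeasure_of_le (μ := ν + σ) (Measure.le_add_left le_rfl)
  have hw := (hu₁.sup hu₂).hasSubharmonicMeans
  obtain ⟨m, im, hm⟩ := exists_rieszMeasure hw
  have hm' := IsRieszMeasure.mk im hm
  obtain ⟨τ, iτ, hτ⟩ := exists_measure_sub fun Φ hΦ hΦs hΦ0 =>
    integral_le_integral_sup hu₁ hu₂ h₁ h₂ (Measure.le_add_left le_rfl) (Measure.le_add_left le_rfl)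
      hm' hΦ hΦs hΦ0
  obtain ⟨τ', _, -, e2⟩ := exists_smul_measure τ (a := (2 * Real.pi)⁻¹) (by positivity)
  have hpi := Real.pi_pos
  have hm0 : ∀ {a : ℂ} {r : ℝ}, 0 < r → circleAverage (fun z => (max (u z) 0).toReal) a r
      = circleAverage (fun z => (max (u₁ z) (u₂ z)).toReal) a r
        - circleAverage (fun z => (u₂ z).toReal) a r := fun {a r} hr =>
    circleAverage_max_zero hu₁ hu₂ hsub a hr
  have hinc : ∀ (a : ℂ) {r₀ r : ℝ}, 0 < r₀ → r₀ ≤ r →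
      circleAverage (fun z => (max (u z) 0).toReal) a r
        - circleAverage (fun z => (max (u z) 0).toReal) a r₀
        + (2 * Real.pi)⁻¹ * ∫ z, annularKernel r₀ r (z - a) ∂ν
      = ∫ z, annularKernel r₀ r (z - a) ∂τ' := fun a r₀ r h₀ hr => by
    have k1 := hm'.integral_annularKernel hw a h₀ hr
    have k2 := h₂.integral_annularKernel hu₂.hasSubharmonicMeans a h₀ hr
    rw [integral_add_measure (integrable_annularKernel_sub ν h₀ hr a)
      (integrable_annularKernel_sub σ h₀ hr a)] at k2
    rw [e2 fun z => annularKernel r₀ r (z - a),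
      hτ _ (continuous_annularKernel_sub h₀ (h₀.trans_le hr) a)
      (hasCompactSupport_annularKernel_sub hr a), k1, hm0 h₀, hm0 (h₀.trans_le hr),
      eq_sub_of_add_eq k2]
    field_simp
    ring
  have hF : ∀ r₀ r : ℝ, 0 < r₀ → r₀ ≤ r →
      TS r u - TS r₀ u = ∫ z, annularKernel r₀ r z ∂τ' := fun r₀ r h₀ hr => by
    have k1 := NS_sub_NS hJ.laplacianNeg_eq h0 h₀ hr
    have k2 := hinc 0 h₀ hr
    simp only [sub_zero] at k2
    rw [TS, TS, mS, mS]
    linarith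
  have hG : ∀ r₀ r : ℝ, 0 < r₀ → r₀ ≤ r → TS r (shift c u) - TS r₀ (shift c u)
      = ∫ z, annularKernel r₀ r (z - c) ∂τ' := fun r₀ r h₀ hr => by
    have k1 := hJ.NS_shift_sub_NS_shift c hc h₀ hr
    have k2 := hinc c h₀ hr
    rw [TS, TS, mS_shift, mS_shift]
    linarith
  refine equivOutsideSmallSet_of_eq_integral_or hF hG fun hτ0 => ?_
  have hTS : ∀ r, 0 < r → TS r u = TS 1 u := fun r hr => by
    rcases le_total 1 r with h | h
    · have := hF 1 r one_pos h
      rw [hτ0, integral_zero_measure] at this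
      linarith
    · have := hF r 1 hr h
      rw [hτ0, integral_zero_measure] at this
      linarith
  have hNS_le : ∀ r, 0 < r → NS r u ≤ TS 1 u := fun r hr => by
    rw [← hTS r hr, TS, le_add_iff_nonneg_left]
    refine Real.circleAverage_nonneg_of_nonneg fun z _ => ?_
    exact EReal.toReal_nonneg (le_max_right _ _)
  -- N_s is bounded above by the constant value of T_s, so by the dichotomy it is constant and its
  -- measure vanishes.
  have hν : ν = 0 := by
    obtain ⟨ν', _, f1, f2⟩ := exists_smul_measure ν (a := (2 * Real.pi)⁻¹) (by positivity)
    have hN : ∀ r₀ r : ℝ, 0 < r₀ → r₀ ≤ r →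
        NS r u - NS r₀ u = ∫ z, annularKernel r₀ r (z - 0) ∂ν' := fun r₀ r h₀ hr => by
      simp only [sub_zero]
      rw [NS_sub_NS hJ.laplacianNeg_eq h0 h₀ hr, f2]
    rcases (isLogConvexGrowth_of_eq_integral hN).const_or_tendsto with h | h
    · refine f1 (measure_eq_zero_of_integral_annularKernel fun r₀ r h₀ hr => ?_)
      have := hN r₀ r h₀ hr
      simp only [sub_zero] at this
      rw [← this, h r r₀ (h₀.trans_le hr) h₀, sub_self]
    · obtain ⟨r, h1, h2⟩ := ((h.eventually_gt_atTop (TS 1 u)).and (eventually_gt_atTop 0)).exists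
      exact absurd (hNS_le r h2) (not_le.2 h1)
  have hN0 : ∀ r, NS r u = 0 := NS_eq_zero (by rw [hJ.laplacianNeg_eq, hν])
  have hNc : ∀ r, NS r (shift c u) = 0 :=
    NS_eq_zero (by rw [(hJ.shift c).laplacianNeg_eq, hν, Measure.map_zero])
  -- u is unconstrained where u₁ and u₂ are both -∞, so u⁺ need not be measurable; q is, and it has
  -- the same circle means.
  set q : ℂ → ℝ := fun z => (max (u₁ z) (u₂ z)).toReal - (u₂ z).toReal with hq
  have hqavg : ∀ {a : ℂ} {r : ℝ}, 0 < r → circleAverage q a r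
      = circleAverage (fun z => (max (u z) 0).toReal) a r := fun {a r} hr => by
    rw [hm0 hr]
    simp only [circleAverage_eq_integral]
    exact integral_sub (integrable_circle hw a hr) (integrable_circle hu₂.hasSubharmonicMeans a hr)
  have hconst : ∀ (a : ℂ) (r : ℝ), 0 < r → circleAverage q a r = circleAverage q a 1 :=
    fun a r hr => by
      rw [hqavg hr, hqavg one_pos]
      rcases le_total 1 r with h | h
      · have := hinc a one_pos h
        rw [hτ0, hν, integral_zero_measure, mul_zero] at this
        linarith
      · have := hinc a hr h
        rw [hτ0, hν, integral_zero_measure, mul_zero] at this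
        linarith
  have hqm : Measurable q := hw.measurable.sub hu₂.hasSubharmonicMeans.measurable
  have hqi : LocallyIntegrable q :=
    hw.locallyIntegrable.sub hu₂.hasSubharmonicMeans.locallyIntegrable
  have hq0 : ∀ᵐ z, 0 ≤ q z := by
    filter_upwards [hu₂.ae_ne_bot] with z hz
    rw [hq, sub_nonneg, max_comm]
    exact toReal_le_toReal_sup hz (hu₂.ne_top _) (hu₁.ne_top _)
  have heq : circleAverage q c 1 = circleAverage q 0 1 := le_antisymm
    (circleAverage_const_le hqm hqi hq0 (hconst 0) (hconst c))
    (circleAverage_const_le hqm hqi hq0 (hconst c) (hconst 0))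
  filter_upwards [eventually_gt_atTop 0] with r hr
  rw [TS, TS, hN0, hNc, mS_shift, mS, ← hqavg hr, ← hqavg hr, hconst c r hr, hconst 0 r hr, heq]

end nevanlinna

/-! ### Meromorphic functions -/

section divisor

open Function (locallyFinsupp locallyFinsuppWithin.logCounting locallyFinsuppWithin.toClosedBall
  locallyFinsuppWithin.toClosedBall_eval_within locallyFinsuppWithin.apply_eq_zero_of_notMem
  locallyFinsuppWithin.logCounting_mono)

variable {D D' : locallyFinsupp ℂ ℤ}

theorem finite_inter_support (D : locallyFinsupp ℂ ℤ) (r : ℝ) :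
    (Metric.closedBall (0 : ℂ) r ∩ Function.support D).Finite :=
  (Function.locallyFinsupp.locallyFiniteSupport D).finite_inter_support_of_isCompact
    (isCompact_closedBall 0 r)

/-- The index set depends on r only, so values at different t ≤ r can be subtracted term by term. At
z = 0 the convention log 0 = 0 makes the summand equal to D(0) log t, as required. -/
theorem logCounting_eq_sum (D : locallyFinsupp ℂ ℤ) {t r : ℝ} (ht : 0 < t) (htr : t ≤ r) :
    locallyFinsuppWithin.logCounting D t
      = ∑ z ∈ insert 0 (finite_inter_support D r).toFinset,
        (D z : ℝ) * (Real.log (max t ‖z‖) - Real.log ‖z‖) := by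
  set S := insert 0 (finite_inter_support D r).toFinset with hS
  have h1 : locallyFinsuppWithin.logCounting D t
      = ∑ᶠ z, (locallyFinsuppWithin.toClosedBall t D z : ℝ) * Real.log (t * ‖z‖⁻¹)
        + D 0 * Real.log t := rfl
  have h2 : (D 0 : ℝ) * Real.log t = ∑ z ∈ S, if z = 0 then (D 0 : ℝ) * Real.log t else 0 := by
    rw [Finset.sum_ite_eq' S 0]
    simp [hS]
  have hsupp : Function.support (fun z => (locallyFinsuppWithin.toClosedBall t D z : ℝ)
      * Real.log (t * ‖z‖⁻¹)) ⊆ S := fun z hz => by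
    have h3 : locallyFinsuppWithin.toClosedBall t D z ≠ 0 := fun h0 => hz (by simp [h0])
    have h4 : z ∈ Metric.closedBall (0 : ℂ) |t| := by
      by_contra hne
      exact h3 (locallyFinsuppWithin.apply_eq_zero_of_notMem _ hne)
    rw [locallyFinsuppWithin.toClosedBall_eval_within D h4] at h3
    rw [abs_of_pos ht] at h4
    rw [hS, Finset.coe_insert, Finite.coe_toFinset]
    exact Or.inr ⟨Metric.closedBall_subset_closedBall htr h4, h3⟩
  rw [h1, h2, finsum_eq_sum_of_support_subset _ hsupp, ← Finset.sum_add_distrib]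
  refine Finset.sum_congr rfl fun z _ => ?_
  rcases eq_or_ne z 0 with rfl | hz
  · simp [max_eq_left ht.le]
  rw [if_neg hz, add_zero]
  have hzn := norm_pos_iff.2 hz
  rcases le_or_gt ‖z‖ t with hzt | hzt
  · rw [locallyFinsuppWithin.toClosedBall_eval_within D (by simpa [abs_of_pos ht] using hzt),
      max_eq_left hzt, Real.log_mul ht.ne' (inv_ne_zero hzn.ne'), Real.log_inv, sub_eq_add_neg]
  · rw [locallyFinsuppWithin.apply_eq_zero_of_notMem _ (by simpa [abs_of_pos ht] using hzt),
      max_eq_right hzt.le]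
    simp

theorem support_mul_annularKernel_subset (D : locallyFinsupp ℂ ℤ) {r₀ r : ℝ} (h : r₀ ≤ r) (c : ℂ) :
    Function.support (fun z => (D z : ℝ) * annularKernel r₀ r (z - c))
      ⊆ Metric.closedBall (0 : ℂ) (r + ‖c‖) ∩ Function.support D := fun z hz => by
  have h1 : (D z : ℝ) ≠ 0 := left_ne_zero_of_mul hz
  have h2 : annularKernel r₀ r (z - c) ≠ 0 := right_ne_zero_of_mul hz
  refine ⟨?_, by simpa using h1⟩
  have h3 : ‖z - c‖ < r := by
    by_contra! hne
    exact h2 (annularKernel_of_le h hne)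
  rw [mem_closedBall_zero_iff]
  have := norm_add_le (z - c) c
  rw [sub_add_cancel] at this
  linarith

theorem finite_support_mul_annularKernel (D : locallyFinsupp ℂ ℤ) {r₀ r : ℝ} (h : r₀ ≤ r) (c : ℂ) :
    (Function.support fun z => (D z : ℝ) * annularKernel r₀ r (z - c)).Finite :=
  (finite_inter_support D (r + ‖c‖)).subset (support_mul_annularKernel_subset D h c)

theorem logCounting_sub_logCounting (D : locallyFinsupp ℂ ℤ) {r₀ r : ℝ} (h₀ : 0 < r₀)
    (h : r₀ ≤ r) :
    locallyFinsuppWithin.logCounting D r - locallyFinsuppWithin.logCounting D r₀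
      = ∑ᶠ z, (D z : ℝ) * annularKernel r₀ r z := by
  have hs := support_mul_annularKernel_subset D h 0
  simp only [sub_zero, norm_zero, add_zero] at hs
  rw [logCounting_eq_sum D (h₀.trans_le h) le_rfl, logCounting_eq_sum D h₀ h,
    finsum_eq_sum_of_support_subset (s := insert 0 (finite_inter_support D r).toFinset),
    ← Finset.sum_sub_distrib]
  · refine Finset.sum_congr rfl fun z _ => ?_
    rw [annularKernel]
    ring
  · rw [Finset.coe_insert, Finite.coe_toFinset]
    exact hs.trans (subset_insert _ _)

theorem isLogConvexGrowth_logCounting (hD : 0 ≤ D) :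
    IsLogConvexGrowth (locallyFinsuppWithin.logCounting D) := by
  refine ⟨locallyFinsuppWithin.logCounting_mono hD, fun r q hr hq => ?_⟩
  have hq0 : 0 < q := by linarith
  have h1 : r / q ≤ r := div_le_self hr.le hq
  have h2 : r ≤ q * r := le_mul_of_one_le_left hr.le hq
  have f1 := finite_support_mul_annularKernel D h1 0
  have f2 := finite_support_mul_annularKernel D h2 0
  simp only [sub_zero] at f1 f2
  rw [logCounting_sub_logCounting D (by positivity) h1, logCounting_sub_logCounting D hr h2]
  refine finsum_le_finsum' f1 f2 fun z => ?_
  exact mul_le_mul_of_nonneg_left (annularKernel_div_le_mul hr hq z) (Int.cast_nonneg (hD z))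

/-- The divisor plays the part of the measure: reindexing by the shift recentres the kernel, and the
kernel inequality is summed against nonnegative multiplicities. -/
theorem isShiftDominated_logCounting (hD : 0 ≤ D) {c : ℂ} (h : ∀ z, D' z = D (z + c)) :
    IsShiftDominated ‖c‖ (locallyFinsuppWithin.logCounting D')
      (locallyFinsuppWithin.logCounting D) := by
  intro r₀ r h₀ hr
  have hn := norm_nonneg c
  have f2 := finite_support_mul_annularKernel D (by linarith : r₀ + ‖c‖ ≤ r + ‖c‖) 0
  simp only [sub_zero] at f2
  rw [logCounting_sub_logCounting D' h₀ hr,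
    logCounting_sub_logCounting D (by linarith) (by linarith)]
  have e : ∑ᶠ z, (D' z : ℝ) * annularKernel r₀ r z
      = ∑ᶠ z, (D z : ℝ) * annularKernel r₀ r (z - c) := by
    rw [← finsum_comp_equiv (Equiv.addRight c)
      (f := fun z => (D z : ℝ) * annularKernel r₀ r (z - c))]
    simp [h]
  rw [e, mul_finsum' _ _ f2]
  refine finsum_le_finsum' (finite_support_mul_annularKernel D hr c) ?_ fun z => ?_
  · exact f2.subset fun z hz => right_ne_zero_of_mul hz
  · have := annularKernel_le_of_norm_sub_le hn h₀ hr (z := z) (w := z - c) (by simp)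
    have := mul_le_mul_of_nonneg_left this (Int.cast_nonneg (R := ℝ) (hD z))
    simp only
    linarith

end divisor

section meromorphic

variable {f : ℂ → ℂ}

theorem meromorphic_shift (hf : Meromorphic f) (c : ℂ) : Meromorphic (shift c f) :=
  Meromorphic.meromorphic_fun_comp_add_const_iff_meromorphic.2 hf

open scoped Pointwise in
theorem divisor_shift_sub (f : ℂ → ℂ) (c a z : ℂ) :
    MeromorphicOn.divisor (fun w => shift c f w - a) univ z
      = MeromorphicOn.divisor (fun w => f w - a) univ (z + c) := by
  have := MeromorphicOn.divisor_comp_add_const_eq_divisor (U := univ) (c := c) (x := z + c)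
    (f := fun w => f w - a)
  have hU : (univ : Set ℂ) + {c} = univ :=
    eq_univ_of_forall fun w => ⟨w - c, mem_univ _, c, rfl, sub_add_cancel w c⟩
  rw [add_sub_cancel_right, hU] at this
  exact this

theorem isLogConvexGrowth_logCounting_coe (f : ℂ → ℂ) (a : ℂ) :
    IsLogConvexGrowth (ValueDistribution.logCounting f a) := by
  rw [ValueDistribution.logCounting_coe]
  exact isLogConvexGrowth_logCounting (posPart_nonneg _)

theorem isShiftDominated_logCounting_coe (f : ℂ → ℂ) (c a : ℂ) :
    IsShiftDominated ‖c‖ (ValueDistribution.logCounting (shift c f) a)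
      (ValueDistribution.logCounting f a) := by
  rw [ValueDistribution.logCounting_coe, ValueDistribution.logCounting_coe]
  refine isShiftDominated_logCounting (posPart_nonneg _) fun z => ?_
  simp only [Function.locallyFinsuppWithin.posPart_apply, divisor_shift_sub]

/-- Cartan's formula; its additive constant, which may differ between f and its shift, drops out of
increments. -/
theorem characteristic_sub_characteristic (hf : Meromorphic f) {r₀ r : ℝ} (h₀ : 0 < r₀)
    (hr : 0 < r) : ValueDistribution.characteristic f ⊤ r - ValueDistribution.characteristic f ⊤ r₀
      = circleAverage (fun a => ValueDistribution.logCounting f a r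
          - ValueDistribution.logCounting f a r₀) 0 1 := by
  obtain ⟨C, hC⟩ := ValueDistribution.characteristic_top_eq_circleAverage_add_const hf
  rw [hC r hr.ne', hC r₀ h₀.ne', add_sub_add_right_eq_sub]
  exact (Real.circleAverage_sub (ValueDistribution.circleIntegrable_logCounting hf)
    (ValueDistribution.circleIntegrable_logCounting hf)).symm

theorem circleIntegrable_logCounting_sub (hf : Meromorphic f) (r₀ r : ℝ) :
    CircleIntegrable (fun a => ValueDistribution.logCounting f a r
      - ValueDistribution.logCounting f a r₀) 0 1 :=
  (ValueDistribution.circleIntegrable_logCounting hf).sub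
    (ValueDistribution.circleIntegrable_logCounting hf)

theorem isLogConvexGrowth_characteristic (hf : Meromorphic f) :
    IsLogConvexGrowth (ValueDistribution.characteristic f ⊤) := by
  refine ⟨ValueDistribution.characteristic_monotoneOn hf, fun r q hr hq => ?_⟩
  have hq0 : 0 < q := by linarith
  rw [characteristic_sub_characteristic hf (by positivity) hr,
    characteristic_sub_characteristic hf hr (by positivity)]
  exact Real.circleAverage_mono (circleIntegrable_logCounting_sub hf _ _)
    (circleIntegrable_logCounting_sub hf _ _) fun a _ =>
      (isLogConvexGrowth_logCounting_coe f a).sub_div_le r q hr hq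

theorem isShiftDominated_characteristic (hf : Meromorphic f) (c : ℂ) :
    IsShiftDominated ‖c‖ (ValueDistribution.characteristic (shift c f) ⊤)
      (ValueDistribution.characteristic f ⊤) := by
  intro r₀ r h₀ hr
  have hn := norm_nonneg c
  have hfc := meromorphic_shift hf c
  rw [characteristic_sub_characteristic hfc h₀ (by linarith),
    characteristic_sub_characteristic hf (by linarith) (by linarith), ← smul_eq_mul,
    ← Real.circleAverage_fun_smul]
  refine Real.circleAverage_mono (circleIntegrable_logCounting_sub hfc _ _)
    ((circleIntegrable_logCounting_sub hf _ _).const_smul) fun a _ => ?_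
  exact isShiftDominated_logCounting_coe f c a r₀ r h₀ hr

theorem shift_neg_shift {α : Type*} (c : ℂ) (u : ℂ → α) : shift (-c) (shift c u) = u := by
  ext z
  simp [shift]

theorem proximity_shift (f : ℂ → ℂ) (c : ℂ) (r : ℝ) :
    ValueDistribution.proximity (shift c f) ⊤ r
      = circleAverage (fun z => Real.posLog ‖f z‖) c r := by
  rw [ValueDistribution.proximity_top]
  exact circleAverage_shift (fun w : ℂ => Real.posLog ‖w‖) f c r

theorem logCounting_top_isBigO_one {C : ℝ}
    (h : ∀ r, 0 < r → ValueDistribution.characteristic f ⊤ r = C) :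
    ValueDistribution.logCounting f ⊤ =O[atTop] (1 : ℝ → ℝ) := by
  refine Asymptotics.IsBigO.of_bound C ?_
  filter_upwards [eventually_ge_atTop 1] with r hr
  have h1 := ValueDistribution.logCounting_nonneg (f := f) (e := ⊤) hr
  have h2 := ValueDistribution.proximity_nonneg (f := f) (a := ⊤) r
  have h3 := h r (by linarith)
  simp only [ValueDistribution.characteristic, Pi.add_apply] at h3
  rw [Real.norm_of_nonneg h1]
  simp only [Pi.one_apply, norm_one, mul_one]
  linarith [show (0 : ℝ) ≤ ValueDistribution.proximity f ⊤ r from h2]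

theorem logCounting_top_eq_zero (h : ValueDistribution.logCounting f ⊤ =O[atTop] (1 : ℝ → ℝ)) :
    ValueDistribution.logCounting f ⊤ = 0 := by
  rw [ValueDistribution.logCounting_top] at h ⊢
  rw [(Function.locallyFinsuppWithin.zero_iff_logCounting_bounded (negPart_nonneg _)).2 h, map_zero]

/-- A bounded counting function of poles means that f agrees almost everywhere with an entire
function. -/
theorem locallyIntegrable_posLog_norm (hf : Meromorphic f)
    (h : ValueDistribution.logCounting f ⊤ =O[atTop] (1 : ℝ → ℝ)) :
    LocallyIntegrable fun z => Real.posLog ‖f z‖ := by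
  have ha := (ValueDistribution.logCounting_isBigO_one_iff_analyticOnNhd hf).1 h
  set g := toMeromorphicNFOn f univ
  have hg : Continuous g := continuousOn_univ.1 ha.continuousOn
  have heq : f =ᵐ[volume] g := by
    have := ae_restrict_le_codiscreteWithin (μ := (volume : Measure ℂ)) MeasurableSet.univ
      (toMeromorphicNFOn_eqOn_codiscrete hf.meromorphicOn)
    rwa [Measure.restrict_univ] at this
  have hc : Continuous fun z => Real.posLog ‖g z‖ := Real.continuous_posLog.comp hg.norm
  refine hc.locallyIntegrable.congr (heq.mono fun z hz => ?_)
  simp only [hz]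

/-- The Nevanlinna characteristic of a meromorphic function is asymptotically invariant under shifts. -/
theorem equivOutsideSmallSet_characteristic (c : ℂ) (hf : Meromorphic f) :
    EquivOutsideSmallSet (ValueDistribution.characteristic (shift c f) ⊤)
      (ValueDistribution.characteristic f ⊤) := by
  have hfc := meromorphic_shift hf c
  have hF := isLogConvexGrowth_characteristic hf
  have hG := isLogConvexGrowth_characteristic hfc
  have hGF := isShiftDominated_characteristic hf c
  have hFG := isShiftDominated_characteristic hfc (-c)
  rw [shift_neg_shift, norm_neg] at hFG
  have hn := norm_nonneg c
  rcases hF.const_or_tendsto with h | h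
  -- Degenerate case: both characteristics are constant, so the pole counting functions, being
  -- bounded, vanish. The characteristics are then the means of log⁺ |f| over circles about 0 and c,
  -- constant in the radius and hence equal to each other.
  · have hFc : ∀ r, 0 < r → ValueDistribution.characteristic f ⊤ r
        = ValueDistribution.characteristic f ⊤ 1 := fun r hr => h r 1 hr one_pos
    have hGle : ∀ r₀ r, 0 < r₀ → r₀ ≤ r → ValueDistribution.characteristic (shift c f) ⊤ r
        = ValueDistribution.characteristic (shift c f) ⊤ r₀ := fun r₀ r h₀ hr => by
      have h1 := hGF r₀ r h₀ hr
      rw [h (r + ‖c‖) (r₀ + ‖c‖) (by linarith) (by linarith), sub_self, mul_zero] at h1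
      have h2 := hG.monotoneOn h₀ (show (0 : ℝ) < r by linarith) hr
      linarith
    have hGc : ∀ r, 0 < r → ValueDistribution.characteristic (shift c f) ⊤ r
        = ValueDistribution.characteristic (shift c f) ⊤ 1 := fun r hr => by
      rcases le_total 1 r with h1 | h1
      · exact hGle 1 r one_pos h1
      · exact (hGle r 1 hr h1).symm
    have hO := logCounting_top_isBigO_one hFc
    have hN := logCounting_top_eq_zero hO
    have hNc := logCounting_top_eq_zero (logCounting_top_isBigO_one hGc)
    have e0 : ∀ r, ValueDistribution.characteristic f ⊤ r
        = circleAverage (fun z => Real.posLog ‖f z‖) 0 r := fun r => by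
      simp [ValueDistribution.characteristic, hN, ValueDistribution.proximity_top]
    have ec : ∀ r, ValueDistribution.characteristic (shift c f) ⊤ r
        = circleAverage (fun z => Real.posLog ‖f z‖) c r := fun r => by
      simp [ValueDistribution.characteristic, hNc, proximity_shift]
    simp only [e0] at hFc
    simp only [ec] at hGc
    have hm : Measurable fun z => Real.posLog ‖f z‖ :=
      Real.continuous_posLog.measurable.comp hf.measurable.norm
    have hi := locallyIntegrable_posLog_norm hf hO
    have h0 : ∀ᵐ z, 0 ≤ Real.posLog ‖f z‖ := ae_of_all _ fun _ => Real.posLog_nonneg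
    have heq := le_antisymm (circleAverage_const_le hm hi h0 hFc hGc)
      (circleAverage_const_le hm hi h0 hGc hFc)
    refine equivOutsideSmallSet_of_eventuallyEq ?_
    filter_upwards [eventually_gt_atTop 0] with r hr
    rw [e0, ec, hFc r hr, hGc r hr, heq]
  · exact equivOutsideSmallSet_of_isShiftDominated hn hF hGF hFG h

end meromorphic

end ShiftInvariance

theorem theorem2p1 (c : ℂ) :
    -- the counting function of a `δ`-subharmonic function
    (∀ u : ℂ → EReal, IsDeltaSubharmonic u → NSFinite u → NSFinite (shift c u) →
      EquivOutsideSmallSet (fun r => NS r (shift c u)) (fun r => NS r u)) ∧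
    -- the Nevanlinna characteristic of a `δ`-subharmonic function
    (∀ u : ℂ → EReal, IsDeltaSubharmonic u → NSFinite u → NSFinite (shift c u) →
      EquivOutsideSmallSet (fun r => TS r (shift c u)) (fun r => TS r u)) ∧
    -- the Cartan characteristic of a subharmonic function
    (∀ u : ℂ → EReal, IsSubharmonic u → Tendsto (fun r => cartanS r u) atTop atTop →
      EquivOutsideSmallSet (fun r => cartanS r (shift c u)) (fun r => cartanS r u)) ∧
    -- the Nevanlinna characteristic of a meromorphic function
    (∀ f : ℂ → ℂ, Meromorphic f →
      EquivOutsideSmallSet (ValueDistribution.characteristic (shift c f) ⊤)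
        (ValueDistribution.characteristic f ⊤)) ∧
    -- the Cartan characteristic of a holomorphic curve
    (∀ (n : ℕ) (f : Fin (n + 1) → ℂ → ℂ), IsReducedRepresentation f →
      EquivOutsideSmallSet (fun r => cartanCurve r (fun j => shift c (f j)))
        (fun r => cartanCurve r f)) :=
  ⟨fun _ => equivOutsideSmallSet_NS c, fun _ => equivOutsideSmallSet_TS c,
    fun _ => equivOutsideSmallSet_cartanS c, fun _ => equivOutsideSmallSet_characteristic c,
    fun _ _ => equivOutsideSmallSet_cartanCurve c⟩
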